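/- \textbf{Setting.} Nodes $p_i\in\mathcal P$ (finite, totally ordered identifiers) host a server, a client, or both; there are $N$ servers, at most $f$ of which may fail and at most $e$ of which are malicious (they may corrupt only the coded elements in their replies to clients), and $1\le k<N$, $k\le N-2(f+e)$. A quorum is a set of at least $\lceil (N+k+2e)/2\rceil$ servers. Tags are pairs $(z,j)\in\mathcal T=\mathbb Z^+\times\mathcal P$, ordered lexicographically, together with a default tag $t_0$ below all of them; phases are $\mathcal D=\{\text{pre},\text{fin},\text{FIN}\}$. A server stores a finite set $S$ of records $(t,w,d)$, where $t\in\mathcal T$, $d\in\mathcal D$, and $w$ is a coded element or $\bot$. Let $MAXINT>1$ be an integer and $t_{top}=(MAXINT,\max\{k:p_k\in\mathcal P\})$. For $D\subseteq\mathcal D$ let $maxPhase(D)$ be the largest tag in $S$ with phase in $D$ ($t_0$ if there is none), and let $tagTuple()=(maxPhase(\mathcal D),maxPhase(\mathcal D\setminus\{\text{pre}\}),maxPhase(\{\text{FIN}\}))$. \textbf{Records.} $updatePhase(t,w,u)$ does nothing for $t=t_0$; otherwise, if $w=\bot$ and $S$ has a record of tag $t$ with a coded element, it keeps that element and changes the record's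 phase from pre to fin if $u=\text{fin}$, from fin to FIN if $u=\text{FIN}$, and not at all in the other cases; otherwise it replaces all records of tag $t$ by $(t,w,u)$. A record is FINALIZED if its phase is FIN or $S$ has a record with a larger tag of the same client. For a fixed $\delta\ge 0$, $relevant(S)$ keeps the records whose tag is $maxPhase(\mathcal D)$, or $maxPhase(\mathcal D\setminus\{\text{pre}\})$, or the tag of a record that is not FINALIZED, or one of the $\delta+1$ largest tags of FINALIZED records. \textbf{The bounded algorithm.} Clients access the servers by sending a request to every server and waiting for acknowledgments of this request by a quorum. A writer queries, takes the largest reported tag $(z,\cdot)$ ($z=0$ for $t_0$), and then, with the tag $(z+1,i)$ and coded elements $w_j$, accesses the servers with the pre-write $((z+1,i),w_j,\text{pre})$, then with $((z+1,i),\bot,\text{fin})$, and then with $((z+1,i),\bot,\text{FIN})$. A reader queries and then accesses the servers with $(t,\bot,\text{fin})$, where $t$ is the largest reported tag. A server answers a reader's query by $maxPhase(\mathcal D\setminus\{\text{pre}\})$; it answers a writer's query by $maxPhase(\mathcal D)$, but only if $maxPhase(\mathcal D)\le t_{top}$; on a request $(t,w,d)$ it calls $updatePhase(t,w,d)$ and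 acknowledges. Servers repeatedly send each other their last computed $tagTuple()$. When gossip arrives at the server of $p_i$, whose array $gossip[\,]$ holds the last triples $(pre[k],fin[k],FIN[k])$ received from all servers (entry $i$ being its own), it sets, in this order, $pre[i]$ to the maximum of all entries of $gossip[\,]$ and of $maxPhase(\mathcal D)$ and calls $updatePhase(pre[i],\bot,\text{pre})$; sets $fin[i]$ to the maximum of all $fin[k],FIN[k]$ and of $maxPhase(\mathcal D\setminus\{\text{pre}\})$ and calls $updatePhase(fin[i],\bot,\text{fin})$; sets $FIN[i]$ to the maximum of all $FIN[k]$, of $maxPhase(\{\text{FIN}\})$ and of the tags $t$ for which $\{k:fin[k]=t\}$ is a quorum, and calls $updatePhase(FIN[i],\bot,\text{FIN})$. Then, if $maxPhase(\mathcal D)\ge t_{top}$, $gossip[k]=tagTuple()$ for every server $k$, and $tagTuple()=(t,t',t')$ with $t\ge t'$, it calls $globalReset(maxPhase(\mathcal D\setminus\{\text{pre}\}))$; otherwise it sets $S\leftarrow relevant(S)$. \textbf{Executions.} An execution $R$ is an infinite sequence of atomic steps from an arbitrary starting state (arbitrary contents of servers, clients and links, arbitrary reset activity). Communication is by links between servers,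 and between clients and servers, on each of which one token alternates. $R$ is fair if every step of the program or of the links that is applicable infinitely often is taken infinitely often (so no node fails in $R$). An asynchronous cycle of $R$ is the shortest prefix in which every server completes an iteration (it receives gossip from another server, then sends to every other server, and then completes a round trip with each of them), every client node completes a round trip with every server, and every node that runs a client procedure during the prefix completes a client round (it stops waiting for the responses of one access, possibly because it is aborted); the next cycle is the first cycle of the remaining suffix. A state is within $m$ cycles of another if it does not come after the end of the $m$-th cycle counted from there. \textbf{The reset service.} A state is \emph{reset-free} if all servers and clients are enabled and no channel includes reset-related messages. Disabled machines take no part in the algorithm. $localReset(t)$ at a (disabled) node aborts the client's operation, empties the gossip buffers, removes every record with a tag other than $t$ from the server's storage, and replaces the tag $t=(z,k)$ by $(1,k)$; for $t=t_0$ no record is kept. With the bound $\Psi\ge 1$, the service meets the following requirements in $R$. (a) Within $\Psi$ cycles from the starting state there is a state from which on all states are reset-free as long as no node has called $globalReset$. (b) Within $\Psi$ cycles from the first call to $globalReset$ (if there is one), the service has had every node disabled and, while disabled, execute $localReset(t)$ for the argument $t$ of a call; all channels are clean of other than reset-related messages; and then, from this state, it enables all machines, which results in a reset-free state. \textbf{Lemma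 (Eventual recovery of the bounded variation).} There is a universal constant $C$ such that the following holds. Let $R$ be a fair execution of the bounded algorithm with a reset service that meets the above requirements with the bound $\Psi$, and suppose that in the starting state of $R$ some server stores a record with a tag $t\ge t_{top}$. Then, within $C\cdot\Psi$ asynchronous cycles, $R$ reaches a state that is both reset-free and overflow-free, i.e., all machines are enabled, no channel includes reset-related messages, and every tag in the state (in the servers, the clients and the messages in transit) is smaller than $t_{top}$. -/

import Mathlib

namespace BoundedCAS

/-! ### Tags, phases, records -/

/-- The set `𝒯 = ℤ⁺ × 𝒫` of tags, ordered lexicographically. -/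
abbrev Stamp (P : Type*) := ℕ+ ×ₗ P

/-- Tags together with the default tag `t₀ = ⊥`, which is below every element of `𝒯`. -/
abbrev Tag (P : Type*) := WithBot (Stamp P)

/-- The three phases of a record: 'pre', 'fin' (finalized) and 'FIN' (FINALIZED). -/
inductive Phase
  | pre
  | fin
  | FIN
  deriving DecidableEq

/-- The set `𝒟` of all phases. -/
def allPhases : Finset Phase := {Phase.pre, Phase.fin, Phase.FIN}

/-- The set `𝒟 \ {'pre'}`. -/
def finPhases : Finset Phase := {Phase.fin, Phase.FIN}

/-- A stored record `(t, w, d)`; `w = none` stands for the absent coded element `⊥`. -/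
structure Record (P W : Type*) where
  tag : Stamp P
  word : Option W
  phase : Phase
  deriving DecidableEq

/-- The gossiped triple (maximal tag of all records, of the finalized and FINALIZED ones,
of the FINALIZED ones). -/
structure Triple (P : Type*) where
  pre : Tag P
  fin : Tag P
  FIN : Tag P
  deriving DecidableEq

/-- The fixed parameters of the system. -/
structure Setup (P W V : Type*) [Fintype P] [LinearOrder P] where
  /-- nodes that host a server, and nodes that host a client (a node may host both) -/
  servers : Finset P
  clients : Finset P
  hosts : servers ∪ clients = Finset.univ
  /-- bound on failing servers, on malicious servers, and the code parameter -/
  f : ℕ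
  e : ℕ
  k : ℕ
  k_pos : 1 ≤ k
  k_lt : k < servers.card
  k_le : k + 2 * (f + e) ≤ servers.card
  /-- servers that may corrupt the coded elements in their replies to clients -/
  malicious : Finset P
  malicious_sub : malicious ⊆ servers
  malicious_card : malicious.card ≤ e
  /-- the coded elements of a secret, one for every server -/
  code : V → P → W
  /-- the bound on the number of writes concurrent with a read, used by `relevant` -/
  δ : ℕ
  maxInt : ℕ+
  maxInt_gt : 1 < maxInt

section Storage

variable {P W V : Type*} [Fintype P] [LinearOrder P] [Nonempty P] [DecidableEq W]

/-- `t_top = (MAXINT, max {k : p_k ∈ 𝒫})`. -/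
def Setup.tTop (p : Setup P W V) : Stamp P :=
  toLex (p.maxInt, Finset.univ.max' Finset.univ_nonempty)

/-- A quorum is a set of at least `⌈(N + k + 2e)/2⌉` of the `N` servers. -/
def Setup.IsQuorum (p : Setup P W V) (Q : Finset P) : Prop :=
  Q ⊆ p.servers ∧ (p.servers.card + p.k + 2 * p.e + 1) / 2 ≤ Q.card

instance (p : Setup P W V) (Q : Finset P) : Decidable (p.IsQuorum Q) :=
  inferInstanceAs (Decidable (_ ∧ _))

/-- `maxPhase(phs)`: the maximal tag of a record of `S` with a phase in `phs`, and `t₀` if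
there is none. -/
def maxPhase (S : Finset (Record P W)) (phs : Finset Phase) : Tag P :=
  S.sup fun r => if r.phase ∈ phs then (r.tag : Tag P) else ⊥

/-- `tagTuple()`. -/
def tagTuple (S : Finset (Record P W)) : Triple P :=
  ⟨maxPhase S allPhases, maxPhase S finPhases, maxPhase S {Phase.FIN}⟩

/-- `upgradePhase(old, new)`. -/
def upgradePhase : Phase → Phase → Phase
  | Phase.pre, Phase.fin => Phase.fin
  | Phase.fin, Phase.FIN => Phase.FIN
  | old, _ => old

/-- `updatePhase(t, w, u)`.  A record's tag is an element of `𝒯`, so nothing is stored for `t₀`.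
(If, in a corrupted storage, several records with tag `t` have a coded element, then each
of them is upgraded.) -/
def updatePhase (S : Finset (Record P W)) (t : Tag P) (w : Option W) (u : Phase) :
    Finset (Record P W) :=
  match t with
  | none => S
  | some t =>
    if w = none ∧ ∃ r ∈ S, r.tag = t ∧ r.word ≠ none then
      S.image fun r =>
        if r.tag = t ∧ r.word ≠ none then { r with phase := upgradePhase r.phase u } else r
    else insert ⟨t, w, u⟩ (S.filter fun r => r.tag ≠ t)

/-- A record of `S` is FINALIZED explicitly (by its phase) or implicitly (by a record of `S` with
a larger tag of the same client). -/
def IsFinalized (S : Finset (Record P W)) (r : Record P W) : Prop :=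
  r.phase = Phase.FIN ∨
    ∃ r' ∈ S, (ofLex r'.tag).2 = (ofLex r.tag).2 ∧ (ofLex r.tag).1 < (ofLex r'.tag).1

instance (S : Finset (Record P W)) (r : Record P W) : Decidable (IsFinalized S r) :=
  inferInstanceAs (Decidable (_ ∨ _))

/-- The tags of the explicitly or implicitly FINALIZED records of `S`. -/
def finalizedTags (S : Finset (Record P W)) : Finset (Stamp P) :=
  (S.filter fun r => IsFinalized S r).image Record.tag

/-- `relevant(S)`: the records whose tag is the maximal one, the maximal finalized one, the tag
of a record that is not yet FINALIZED, or one of the `δ + 1` largest FINALIZED tags. -/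
def relevant (δ : ℕ) (S : Finset (Record P W)) : Finset (Record P W) :=
  S.filter fun r =>
    (r.tag : Tag P) = maxPhase S allPhases ∨
    (r.tag : Tag P) = maxPhase S finPhases ∨
    (∃ r' ∈ S, r'.tag = r.tag ∧ ¬ IsFinalized S r') ∨
    (r.tag ∈ finalizedTags S ∧ ((finalizedTags S).filter fun t => r.tag < t).card ≤ δ)

end Storage

/-! ### Local states, messages and links -/

/-- The state of a server: the storage, the last gossip received from every server (the entry
of the server itself aggregates), and the gossip to be sent. -/
structure Server (P W : Type*) where
  store : Finset (Record P W)
  rx : P → Triple P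
  tx : Triple P

/-- Requests of a client to a server.  The flag `reader` tells whether the client is a reader;
the flag `last` distinguishes FINALIZE ('FIN') from finalize ('fin'). -/
inductive Req (P W : Type*)
  | query (reader : Bool)
  | prewrite (t : Stamp P) (w : W)
  | finalize (reader : Bool) (t : Tag P) (last : Bool)
  deriving DecidableEq

/-- An acknowledgment: a tag and possibly a coded element. -/
structure Ack (P W : Type*) where
  tag : Tag P
  word : Option W

/-- The quorum access a client is in: the four phases of a writer, the two of a reader. -/
inductive Proc (P V : Type*)
  | wQuery (s : V)
  | wPre (t : Stamp P) (s : V)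
  | wFin (t : Stamp P)
  | wFIN (t : Stamp P)
  | rQuery
  | rFin (t : Tag P)

/-- The state of a client.  During a quorum access, `sent k` tells whether the request of this
access was sent to server `k`, and `acks k` is the acknowledgment of `k`, if it has arrived. -/
inductive Client (P W V : Type*)
  | idle
  | busy (proc : Proc P V) (sent : P → Bool) (acks : P → Option (Ack P W))

/-- The procedure phase that a client runs, if any. -/
def Client.proc {P W V : Type*} : Client P W V → Option (Proc P V)
  | .idle => none
  | .busy pr _ _ => some pr

/-- The token of the gossip link from one server to another: at the sender, or on its way to the
receiver with a payload (`none` if the sender was disabled). -/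
inductive GossipLink (P : Type*)
  | atSender
  | inTransit (m : Option (Triple P))

/-- The token of the ping-pong link between a client and a server: at the client, on its way to the
server with a request, at the server with the request and the reply, on its way back. -/
inductive PingLink (P W : Type*)
  | atClient
  | request (q : Option (Req P W))
  | atServer (q : Option (Req P W)) (a : Option (Ack P W))
  | response (q : Option (Req P W)) (a : Option (Ack P W))

/-- The same link with its payload removed. -/
def GossipLink.clear {P : Type*} : GossipLink P → GossipLink P
  | .atSender => .atSender
  | .inTransit _ => .inTransit none

/-- The same link with its payload removed. -/
def PingLink.clear {P W : Type*} : PingLink P W → PingLink P W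
  | .atClient => .atClient
  | .request _ => .request none
  | .atServer _ _ => .atServer none none
  | .response _ _ => .response none none

/-- A system state. -/
structure State (P W V : Type*) where
  srv : P → Server P W
  cli : P → Client P W V
  gossip : P → P → GossipLink P
  ping : P → P → PingLink P W
  /-- whether the server and the client of a node are enabled -/
  srvOn : P → Bool
  cliOn : P → Bool
  /-- whether the channel from a node to a node contains reset-related messages -/
  resetMsg : P → P → Bool

/-- The steps of the system.  The last six kinds are steps of the global reset service. -/
inductive Event (P V : Type*)
  | gossipSend (i j : P)
  | gossipReceive (i j : P)
  | pingSend (i j : P)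
  | pingReceive (i j : P)
  | pongSend (i j : P)
  | pongReceive (i j : P)
  | startWrite (i : P) (s : V)
  | startRead (i : P)
  | resetSend (i j : P)
  | resetReceive (i j : P)
  | disable (i : P)
  | localReset (i : P) (t : Tag P)
  | clean (i : P)
  | enable (A : Finset P)

/-- The steps that the nodes' program and the links are bound to take.  (Invocations of operations
come from outside; the reset service has its own requirements.) -/
def Event.IsComm {P V : Type*} : Event P V → Prop
  | .gossipSend _ _ => True
  | .gossipReceive _ _ => True
  | .pingSend _ _ => True
  | .pingReceive _ _ => True
  | .pongSend _ _ => True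
  | .pongReceive _ _ => True
  | _ => False

/-! ### The program -/

section Program

variable {P W V : Type*} [Fintype P] [LinearOrder P] [Nonempty P] [DecidableEq W]

/-- Write `x` at position `(i, j)`. -/
def set₂ {α : Type*} (g : P → P → α) (i j : P) (x : α) : P → P → α :=
  Function.update g i (Function.update (g i) j x)

/-- Arrival of the gossip `m` from `j` at the server `s` of `i`.  The second component is the
argument of the call to `globalReset`, if there is such a call. -/
def onGossip (p : Setup P W V) (i : P) (s : Server P W) (j : P) (m : Triple P) :
    Server P W × Option (Tag P) :=
  let rx := Function.update s.rx j m
  let pre := p.servers.sup (fun k => (rx k).pre ⊔ (rx k).fin ⊔ (rx k).FIN) ⊔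
    maxPhase s.store allPhases
  let S₁ := updatePhase s.store pre none Phase.pre
  let fin := p.servers.sup (fun k => (rx k).fin ⊔ (rx k).FIN) ⊔ maxPhase S₁ finPhases
  let S₂ := updatePhase S₁ fin none Phase.fin
  let finOf := fun k => if k = i then fin else (rx k).fin
  let FIN := p.servers.sup (fun k => (rx k).FIN) ⊔ maxPhase S₂ {Phase.FIN} ⊔
    p.servers.sup (fun k =>
      if p.IsQuorum (p.servers.filter fun l => finOf l = finOf k) then finOf k else ⊥)
  let S₃ := updatePhase S₂ FIN none Phase.FIN
  let rx' := Function.update rx i ⟨pre, fin, FIN⟩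
  if (p.tTop : Tag P) ≤ maxPhase S₃ allPhases ∧ (∀ k ∈ p.servers, rx' k = tagTuple S₃) ∧
      (tagTuple S₃).fin = (tagTuple S₃).FIN ∧ (tagTuple S₃).fin ≤ (tagTuple S₃).pre then
    (⟨S₃, rx', tagTuple S₃⟩, some (maxPhase S₃ finPhases))
  else
    (⟨relevant p.δ S₃, rx', tagTuple (relevant p.δ S₃)⟩, none)

/-- The storage of a server after the arrival of a request. -/
def storeAfter (S : Finset (Record P W)) : Req P W → Finset (Record P W)
  | .query _ => S
  | .prewrite t w => updatePhase S (t : Tag P) (some w) Phase.pre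
  | .finalize _ t last => updatePhase S t none (if last then Phase.FIN else Phase.fin)

/-- `Replies p S' r a`: a server with storage `S'` (after the update) answers the request `r` by `a`;
`a = none` says that it does not answer.  A query of a writer is answered only if no
tag above `t_top` is stored.  A reader's finalize request is answered with the coded element of a
stored record with the requested tag and phase, if there is one. -/
def Replies (p : Setup P W V) (S' : Finset (Record P W)) :
    Req P W → Option (Ack P W) → Prop
  | .query reader, a =>
      if reader then a = some ⟨maxPhase S' finPhases, none⟩
      else if maxPhase S' allPhases ≤ (p.tTop : Tag P) then a = some ⟨maxPhase S' allPhases, none⟩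
      else a = none
  | .prewrite t _, a => a = some ⟨t, none⟩
  | .finalize reader t last, a =>
      ∃ w : Option W, a = some ⟨t, w⟩ ∧
        if reader = true ∧ ∃ r ∈ S', (r.tag : Tag P) = t ∧
            r.phase = (if last then Phase.FIN else Phase.fin) then
          ∃ r ∈ S', (r.tag : Tag P) = t ∧
            r.phase = (if last then Phase.FIN else Phase.fin) ∧ r.word = w
        else w = none

/-- The request that a client sends to the server of `j` in a given phase of its procedure. -/
def Proc.req (p : Setup P W V) (j : P) : Proc P V → Req P W
  | .wQuery _ => .query false
  | .wPre t s => .prewrite t (p.code s j)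
  | .wFin t => .finalize false (t : Tag P) false
  | .wFIN t => .finalize false (t : Tag P) true
  | .rQuery => .query true
  | .rFin t => .finalize true t false

/-- The tag `(z + 1, i)` that the writer of `i` uses when the largest reported tag is `(z, j)`, and
`(1, i)` when it is `t₀`. -/
def nextStamp (i : P) : Tag P → Stamp P
  | none => toLex (1, i)
  | some t => toLex ((ofLex t).1 + 1, i)

/-- The largest acknowledged tag. -/
def maxAck (p : Setup P W V) (acks : P → Option (Ack P W)) : Tag P :=
  p.servers.sup fun k => match acks k with
    | none => ⊥
    | some a => a.tag

/-- A new quorum access: nothing is sent yet and nothing is acknowledged. -/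
def Client.enter (pr : Proc P V) : Client P W V := .busy pr (fun _ => false) (fun _ => none)

/-- The client of `i` after its current quorum access returned with `acks`.  (What a reader returns
to its caller is not part of the system state.) -/
def Client.advance (p : Setup P W V) (i : P) (acks : P → Option (Ack P W)) :
    Proc P V → Client P W V
  | .wQuery s => .enter (.wPre (nextStamp i (maxAck p acks)) s)
  | .wPre t _ => .enter (.wFin t)
  | .wFin t => .enter (.wFIN t)
  | .wFIN _ => .idle
  | .rQuery => .enter (.rFin (maxAck p acks))
  | .rFin _ => .idle

/-- The client of `i` when the token returns from the server of `j` with a request and a reply.  Only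
a reply to the request of the current quorum access counts; the access returns once a quorum
has replied. -/
def onReply (p : Setup P W V) (i j : P) (q : Option (Req P W)) (a : Option (Ack P W)) :
    Client P W V → Client P W V
  | .idle => .idle
  | .busy pr sent acks =>
    let acks' := if sent j = true ∧ q = some (pr.req p j) ∧ a.isSome then
      Function.update acks j a else acks
    if p.IsQuorum (p.servers.filter fun k => (acks' k).isSome) then .advance p i acks' pr
    else .busy pr sent acks'

/-- The request that departs from the client to the server of `j`, if any. -/
def Client.outgoing (p : Setup P W V) (j : P) : Client P W V → Option (Req P W)
  | .idle => none
  | .busy pr _ _ => some (pr.req p j)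

/-- The client remembers that its request departed to the server of `j`. -/
def Client.markSent (j : P) : Client P W V → Client P W V
  | .idle => .idle
  | .busy pr sent acks => .busy pr (Function.update sent j true) acks

/-- `localReset(t)` on a storage: only the records with tag `t = (z, k)` are kept, and their tag
becomes `(1, k)`; nothing is kept for `t₀`. -/
def localResetStore (S : Finset (Record P W)) : Tag P → Finset (Record P W)
  | none => ∅
  | some t => (S.filter fun r => r.tag = t).image fun r =>
      { r with tag := toLex (1, (ofLex r.tag).2) }

/-- `localReset(t)` on a server; the buffers of the gossip service are emptied. -/
def localResetServer (s : Server P W) (t : Tag P) : Server P W :=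
  ⟨localResetStore s.store t, fun _ => ⟨⊥, ⊥, ⊥⟩, ⟨⊥, ⊥, ⊥⟩⟩

/-- One step of the system.  The tokens of the links circulate also while machines are disabled;
a disabled machine neither fills nor reads them. -/
def Step (p : Setup P W V) (c : State P W V) : Event P V → State P W V → Prop
  | .gossipSend i j, c' =>
      i ∈ p.servers ∧ j ∈ p.servers ∧ i ≠ j ∧ c.gossip i j = .atSender ∧
      c' = { c with
        gossip := set₂ c.gossip i j (.inTransit (if c.srvOn i then some (c.srv i).tx else none)) }
  | .gossipReceive i j, c' =>
      i ∈ p.servers ∧ j ∈ p.servers ∧ i ≠ j ∧ ∃ m, c.gossip i j = .inTransit m ∧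
      c' = { c with
        gossip := set₂ c.gossip i j .atSender
        srv := match m, c.srvOn j with
          | some m, true => Function.update c.srv j (onGossip p j (c.srv j) i m).1
          | _, _ => c.srv }
  | .pingSend i j, c' =>
      i ∈ p.clients ∧ j ∈ p.servers ∧ c.ping i j = .atClient ∧
      c' = { c with
        ping := set₂ c.ping i j (.request (if c.cliOn i then (c.cli i).outgoing p j else none))
        cli := if c.cliOn i then Function.update c.cli i ((c.cli i).markSent j) else c.cli }
  | .pingReceive i j, c' =>
      i ∈ p.clients ∧ j ∈ p.servers ∧ ∃ q, c.ping i j = .request q ∧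
      match q, c.srvOn j with
      | some r, true => ∃ a a',
          Replies p (storeAfter (c.srv j).store r) r a ∧
          (if j ∈ p.malicious then a'.map Ack.tag = a.map Ack.tag else a' = a) ∧
          c' = { c with
            ping := set₂ c.ping i j (.atServer (some r) a')
            srv := Function.update c.srv j
              { c.srv j with store := storeAfter (c.srv j).store r } }
      | _, _ => c' = { c with ping := set₂ c.ping i j (.atServer none none) }
  | .pongSend i j, c' =>
      i ∈ p.clients ∧ j ∈ p.servers ∧ ∃ q a, c.ping i j = .atServer q a ∧
      c' = { c with
        ping := set₂ c.ping i j
          (if c.srvOn j then .response q a else .response none none) }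
  | .pongReceive i j, c' =>
      i ∈ p.clients ∧ j ∈ p.servers ∧ ∃ q a, c.ping i j = .response q a ∧
      c' = { c with
        ping := set₂ c.ping i j .atClient
        cli := if c.cliOn i then Function.update c.cli i (onReply p i j q a (c.cli i))
          else c.cli }
  | .startWrite i s, c' =>
      i ∈ p.clients ∧ c.cliOn i = true ∧ c.cli i = .idle ∧
      c' = { c with cli := Function.update c.cli i (.enter (.wQuery s)) }
  | .startRead i, c' =>
      i ∈ p.clients ∧ c.cliOn i = true ∧ c.cli i = .idle ∧
      c' = { c with cli := Function.update c.cli i (.enter .rQuery) }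
  | .resetSend i j, c' => c' = { c with resetMsg := set₂ c.resetMsg i j true }
  | .resetReceive i j, c' => c' = { c with resetMsg := set₂ c.resetMsg i j false }
  | .disable i, c' =>
      c' = { c with
        srvOn := Function.update c.srvOn i false
        cliOn := Function.update c.cliOn i false }
  | .localReset i t, c' =>
      c.srvOn i = false ∧ c.cliOn i = false ∧
      c' = { c with
        srv := Function.update c.srv i (localResetServer (c.srv i) t)
        cli := Function.update c.cli i .idle }
  | .clean i, c' =>
      c.srvOn i = false ∧ c.cliOn i = false ∧
      c' = { c with
        gossip := fun j k => if j = i ∨ k = i then (c.gossip j k).clear else c.gossip j k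
        ping := fun j k => if j = i ∨ k = i then (c.ping j k).clear else c.ping j k }
  | .enable A, c' =>
      c' = { c with
        srvOn := fun i => if i ∈ A then true else c.srvOn i
        cliOn := fun i => if i ∈ A then true else c.cliOn i }

/-- An (unbounded) execution; its starting state is arbitrary. -/
structure Execution (p : Setup P W V) where
  state : ℕ → State P W V
  event : ℕ → Event P V
  step : ∀ n, Step p (state n) (event n) (state (n + 1))

variable {p : Setup P W V}

/-- Every step that is applicable infinitely often is taken infinitely often. -/
def Execution.Fair (R : Execution p) : Prop :=
  ∀ ev : Event P V, ev.IsComm →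
    (∀ n, ∃ m, n ≤ m ∧ ∃ c', Step p (R.state m) ev c') → ∀ n, ∃ m, n ≤ m ∧ R.event m = ev

/-- In step `n`, node `i` calls `globalReset(t)`. -/
def Execution.CallsReset (R : Execution p) (n : ℕ) (i : P) (t : Tag P) : Prop :=
  ∃ j m, R.event n = .gossipReceive j i ∧ (R.state n).gossip j i = .inTransit (some m) ∧
    (R.state n).srvOn i = true ∧ (onGossip p i ((R.state n).srv i) j m).2 = some t

/-! ### Asynchronous cycles -/

/-- The steps `x, …, y - 1` include a complete iteration of the server at `i`: it gets a message from
another server, then sends to every other server `j`, `j` receives, then `j` sends, and `i`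
receives. -/
def Execution.ServerIteration (R : Execution p) (x y : ℕ) (i : P) : Prop :=
  ∃ a k, x ≤ a ∧ R.event a = .gossipReceive k i ∧
    ∀ j ∈ p.servers, j ≠ i → ∃ b₁ b₂ b₃ b₄, a < b₁ ∧ b₁ < b₂ ∧ b₂ < b₃ ∧ b₃ < b₄ ∧ b₄ < y ∧
      R.event b₁ = .gossipSend i j ∧ R.event b₂ = .gossipReceive i j ∧
      R.event b₃ = .gossipSend j i ∧ R.event b₄ = .gossipReceive j i

/-- The steps `x, …, y - 1` include a complete round trip of the client of `i` with the server of
`j`. -/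
def Execution.RoundTrip (R : Execution p) (x y : ℕ) (i j : P) : Prop :=
  ∃ b₁ b₂ b₃ b₄, x ≤ b₁ ∧ b₁ < b₂ ∧ b₂ < b₃ ∧ b₃ < b₄ ∧ b₄ < y ∧
    R.event b₁ = .pingSend i j ∧ R.event b₂ = .pingReceive i j ∧
    R.event b₃ = .pongSend i j ∧ R.event b₄ = .pongReceive i j

/-- In step `n` the client of `i` ends a round: it stops waiting for the servers' responses and
moves on to the next phase or to the end of the procedure (also when the operation is aborted). -/
def Execution.EndsRound (R : Execution p) (n : ℕ) (i : P) : Prop :=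
  ((R.state n).cli i).proc ≠ none ∧
    ((R.state (n + 1)).cli i).proc ≠ ((R.state n).cli i).proc

/-- The segment with the steps `x, …, y - 1` includes a complete iteration of every server, a complete
round trip of every client node with every server, and a completed client round of every
node that runs a client procedure during the segment. -/
def Execution.CycleDone (R : Execution p) (x y : ℕ) : Prop :=
  (∀ i ∈ p.servers, R.ServerIteration x y i) ∧
  (∀ i ∈ p.clients, ∀ j ∈ p.servers, R.RoundTrip x y i j) ∧
  ∀ i ∈ p.clients, (∃ n, x ≤ n ∧ n < y ∧ ((R.state n).cli i).proc ≠ none) →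
    ∃ n, x ≤ n ∧ n < y ∧ R.EndsRound n i

/-- The first asynchronous cycle of the suffix starting at state `x` ends at state `y`. -/
def Execution.IsCycle (R : Execution p) (x y : ℕ) : Prop :=
  R.CycleDone x y ∧ ∀ y', y' < y → ¬ R.CycleDone x y'

/-- `R.CyclesEnd x n z`: the `n`-th asynchronous cycle after state `x` ends at state `z`. -/
inductive Execution.CyclesEnd (R : Execution p) (x : ℕ) : ℕ → ℕ → Prop
  | zero : Execution.CyclesEnd R x 0 x
  | succ {n y z : ℕ} : Execution.CyclesEnd R x n y → R.IsCycle y z →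
      Execution.CyclesEnd R x (n + 1) z

/-- State `y` is reached within `n` asynchronous cycles from state `x`: it does not come after
the end of the `n`-th cycle. -/
def Execution.Within (R : Execution p) (x n y : ℕ) : Prop :=
  x ≤ y ∧ ∀ z, R.CyclesEnd x n z → y ≤ z

/-! ### Reset-free and overflow-free states, the reset service -/

/-- All machines are enabled and no channel includes reset-related messages. -/
def State.ResetFree (p : Setup P W V) (c : State P W V) : Prop :=
  (∀ i ∈ p.servers, c.srvOn i = true) ∧ (∀ i ∈ p.clients, c.cliOn i = true) ∧
  ∀ i j, c.resetMsg i j = false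

/-- The machines of node `i` are disabled. -/
def State.Disabled (c : State P W V) (i : P) : Prop :=
  c.srvOn i = false ∧ c.cliOn i = false

/-- Only reset-related messages are in the channels. -/
def State.Cleaned (c : State P W V) : Prop :=
  (∀ i j, c.gossip i j = (c.gossip i j).clear) ∧ ∀ i j, c.ping i j = (c.ping i j).clear

/-- The tags in a gossip triple. -/
def Triple.tags (m : Triple P) : Set (Tag P) := {m.pre, m.fin, m.FIN}

/-- The tags in a request. -/
def Req.tags : Req P W → Set (Tag P)
  | .query _ => ∅
  | .prewrite t _ => {(t : Tag P)}
  | .finalize _ t _ => {t}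

/-- The tags in the phase of a client procedure. -/
def Proc.tags : Proc P V → Set (Tag P)
  | .wQuery _ => ∅
  | .wPre t _ => {(t : Tag P)}
  | .wFin t => {(t : Tag P)}
  | .wFIN t => {(t : Tag P)}
  | .rQuery => ∅
  | .rFin t => {t}

/-- The tags in the state of a client. -/
def Client.tags (p : Setup P W V) : Client P W V → Set (Tag P)
  | .idle => ∅
  | .busy pr _ acks => pr.tags ∪ {t | ∃ k ∈ p.servers, ∃ a, acks k = some a ∧ a.tag = t}

/-- The tags in the state of a server. -/
def Server.tags (p : Setup P W V) (s : Server P W) : Set (Tag P) :=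
  {t | ∃ r ∈ s.store, (r.tag : Tag P) = t} ∪ {t | ∃ k ∈ p.servers, t ∈ (s.rx k).tags} ∪ s.tx.tags

/-- The tags in a request (if any) and a reply (if any). -/
def payloadTags (q : Option (Req P W)) (a : Option (Ack P W)) : Set (Tag P) :=
  {t | ∃ r, q = some r ∧ t ∈ r.tags} ∪ {t | ∃ b, a = some b ∧ b.tag = t}

/-- The tags in transit on a gossip link. -/
def GossipLink.tags : GossipLink P → Set (Tag P)
  | .atSender => ∅
  | .inTransit m => {t | ∃ m', m = some m' ∧ t ∈ m'.tags}

/-- The tags in transit on a ping-pong link. -/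
def PingLink.tags : PingLink P W → Set (Tag P)
  | .atClient => ∅
  | .request q => payloadTags q none
  | .atServer q a => payloadTags q a
  | .response q a => payloadTags q a

/-- All tags in a system state: in servers, clients and messages. -/
def State.tags (p : Setup P W V) (c : State P W V) : Set (Tag P) :=
  {t | (∃ i ∈ p.servers, t ∈ (c.srv i).tags p) ∨ (∃ i ∈ p.clients, t ∈ (c.cli i).tags p) ∨
    (∃ i ∈ p.servers, ∃ j ∈ p.servers, i ≠ j ∧ t ∈ (c.gossip i j).tags) ∨
    ∃ i ∈ p.clients, ∃ j ∈ p.servers, t ∈ (c.ping i j).tags}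

/-- Every tag in the system state is smaller than `t_top`. -/
def State.OverflowFree (p : Setup P W V) (c : State P W V) : Prop :=
  ∀ t ∈ c.tags p, t < (p.tTop : Tag P)

/-- The requirements on the global reset service, with the bound `Ψ` on its duration. -/
structure Execution.ResetLegal (R : Execution p) (Ψ : ℕ) : Prop where
  /-- Whatever reset activity there is in the starting state, it is over within `Ψ` cycles: as long
  as no node has called `globalReset`, all states from then on are reset-free. -/
  spontaneous : ∃ y, R.Within 0 Ψ y ∧ ∀ z, y ≤ z →
    (∀ n < z, ∀ i t, ¬ R.CallsReset n i t) → (R.state z).ResetFree p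
  /-- Within `Ψ` cycles from the first call to `globalReset`, every node was disabled and has executed
  `localReset(t)` for the argument `t` of a call, the channels are clean, and then all
  machines are enabled and the reset is over. -/
  explicit : ∀ x, (∃ i t, R.CallsReset x i t) → (∀ n < x, ∀ i t, ¬ R.CallsReset n i t) →
    ∃ u, x < u ∧ R.Within x Ψ (u + 1) ∧
      (∀ i, ∃ v t, x < v ∧ v < u ∧ R.event v = .localReset i t ∧
        (∃ n j, n < v ∧ R.CallsReset n j t) ∧
        ∀ w, v < w → w ≤ u → (R.state w).Disabled i) ∧
      (R.state u).Cleaned ∧ (R.state (u + 1)).ResetFree p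

end Program

end BoundedCAS

/-!
If a node calls `globalReset`, then the reset service has every node execute `localReset` and cleans
the channels, so the resulting state only has the default tag and tags with the counter
`1 < MAXINT`.  Within `Ψ` cycles there is such a call or a reset-free state, and in the latter case
a call within the next `81` cycles is as good.  So suppose that there is none, and call the largest
tag that a server stores its top; tops do not decrease, and gossip spreads them.

If all tops stay below `tTop` for a few cycles, then so does every tag in a message or a client,
because it would soon arrive at a server.  Otherwise all tops are soon at least `tTop`.  Then no
writer moves on from its query: a server with a top above `tTop` does not answer, and where the
answer is `tTop` itself, the new tag would raise the top.  So either some top exceeds `tTop` and all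
of them soon do, or writers have stopped already.  From then on tags are only spread by gossip and
by readers: the tops agree on a tag `M`, and the largest finalized tag `H` becomes constant, since
the only finalized tag that can still emerge is `M`.  Then the arrays `fin[]` agree on `H`, their
entries form a quorum, and all servers gossip `(M, H, H)`.  The next arrival of gossip finds this
agreement with `tTop ≤ M` and calls `globalReset`, a contradiction.
-/

namespace BoundedCAS

section Storage

variable {P W : Type*}

lemma finPhases_subset_allPhases : finPhases ⊆ allPhases := by decide

lemma singleton_FIN_subset_finPhases : {Phase.FIN} ⊆ finPhases := by decide

lemma mem_allPhases (d : Phase) : d ∈ allPhases := by cases d <;> decide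

lemma mem_finPhases {d : Phase} : d ∈ finPhases ↔ d ≠ Phase.pre := by cases d <;> decide

lemma upgradePhase_pre (d : Phase) : upgradePhase d Phase.pre = d := by cases d <;> rfl

lemma upgradePhase_fin_mem_finPhases (d : Phase) : upgradePhase d Phase.fin ∈ finPhases := by
  cases d <;> decide

lemma upgradePhase_FIN {d : Phase} (h : d ∈ finPhases) : upgradePhase d Phase.FIN = Phase.FIN := by
  cases d <;> revert h <;> decide

lemma upgradePhase_mem_finPhases {d : Phase} (u : Phase) (h : d ∈ finPhases) :
    upgradePhase d u ∈ finPhases := by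
  cases d <;> cases u <;> revert h <;> decide

/-- `S` has a record with the tag `t` and a phase in `D`. -/
def HasTag (S : Finset (Record P W)) (D : Finset Phase) (t : Tag P) : Prop :=
  ∃ r ∈ S, r.phase ∈ D ∧ (r.tag : Tag P) = t

variable {S : Finset (Record P W)} {D D' : Finset Phase} {s t b : Tag P}

lemma HasTag.mono (h : HasTag S D t) (hD : D ⊆ D') : HasTag S D' t := by
  obtain ⟨r, hr, hrD, hrt⟩ := h
  exact ⟨r, hr, hD hrD, hrt⟩

variable [LinearOrder P]

lemma maxPhase_le_iff : maxPhase S D ≤ b ↔ ∀ t, HasTag S D t → t ≤ b := by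
  unfold maxPhase HasTag
  rw [Finset.sup_le_iff]
  constructor
  · rintro h t ⟨r, hr, hrD, rfl⟩
    simpa only [hrD, if_true] using h r hr
  · intro h r hr
    split_ifs with hrD
    · exact h _ ⟨r, hr, hrD, rfl⟩
    · exact bot_le

lemma HasTag.le_maxPhase (h : HasTag S D t) : t ≤ maxPhase S D :=
  maxPhase_le_iff.1 le_rfl t h

lemma maxPhase_eq_bot_or_hasTag (S : Finset (Record P W)) (D : Finset Phase) :
    maxPhase S D = ⊥ ∨ HasTag S D (maxPhase S D) := by
  rcases S.eq_empty_or_nonempty with rfl | hS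
  · exact Or.inl rfl
  obtain ⟨r, hr, hmax⟩ := Finset.exists_mem_eq_sup S hS
    fun r => if r.phase ∈ D then (r.tag : Tag P) else ⊥
  split_ifs at hmax with hrD
  · exact Or.inr ⟨r, hr, hrD, hmax.symm⟩
  · exact Or.inl hmax

lemma maxPhase_mono (S : Finset (Record P W)) (hD : D ⊆ D') : maxPhase S D ≤ maxPhase S D' :=
  maxPhase_le_iff.2 fun _ h => (h.mono hD).le_maxPhase

/-- The largest tag other than `M` of a record of `S` that is finalized or FINALIZED. -/
def maxFinNe (S : Finset (Record P W)) (M : Tag P) : Tag P :=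
  maxPhase (S.filter fun r => (r.tag : Tag P) ≠ M) finPhases

variable {M : Tag P}

lemma maxFinNe_le_iff : maxFinNe S M ≤ b ↔ ∀ t, HasTag S finPhases t → t ≠ M → t ≤ b := by
  rw [maxFinNe, maxPhase_le_iff]
  constructor
  · rintro h t ⟨r, hr, hrD, rfl⟩ hM
    exact h _ ⟨r, Finset.mem_filter.2 ⟨hr, hM⟩, hrD, rfl⟩
  · rintro h t ⟨r, hr, hrD, rfl⟩
    exact h _ ⟨r, (Finset.mem_filter.1 hr).1, hrD, rfl⟩ (Finset.mem_filter.1 hr).2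

lemma HasTag.le_maxFinNe (h : HasTag S finPhases t) (hM : t ≠ M) : t ≤ maxFinNe S M :=
  maxFinNe_le_iff.1 le_rfl t h hM

lemma maxFinNe_le_maxPhase (S : Finset (Record P W)) (M : Tag P) :
    maxFinNe S M ≤ maxPhase S finPhases :=
  maxFinNe_le_iff.2 fun _ ht _ => ht.le_maxPhase

lemma maxPhase_finPhases_le_or_eq (S : Finset (Record P W)) (M : Tag P) :
    maxPhase S finPhases ≤ maxFinNe S M ∨ maxPhase S finPhases = M := by
  rcases maxPhase_eq_bot_or_hasTag S finPhases with hbot | htag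
  · exact Or.inl (hbot ▸ bot_le)
  · exact or_iff_not_imp_right.2 htag.le_maxFinNe

lemma HasTag.of_relevant {δ : ℕ} (h : HasTag (relevant δ S) D t) : HasTag S D t := by
  obtain ⟨r, hr, hrD, hrt⟩ := h
  exact ⟨r, (Finset.mem_filter.1 hr).1, hrD, hrt⟩

lemma maxPhase_relevant {δ : ℕ}
    (hD : maxPhase S D = maxPhase S allPhases ∨ maxPhase S D = maxPhase S finPhases) :
    maxPhase (relevant δ S) D = maxPhase S D := by
  refine le_antisymm (maxPhase_le_iff.2 fun t ht => ht.of_relevant.le_maxPhase) ?_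
  rcases maxPhase_eq_bot_or_hasTag S D with hbot | ⟨r, hr, hrD, hrt⟩
  · exact hbot ▸ bot_le
  · have hkept : r ∈ relevant δ S :=
      Finset.mem_filter.2 ⟨hr, by rw [hrt]; exact hD.imp_right Or.inl⟩
    exact HasTag.le_maxPhase ⟨r, hkept, hrD, hrt⟩

variable [DecidableEq W]

lemma updatePhase_coe (S : Finset (Record P W)) (t : Stamp P) (w : Option W) (u : Phase) :
    updatePhase S (t : Tag P) w u =
      if w = none ∧ ∃ r ∈ S, r.tag = t ∧ r.word ≠ none then
        S.image fun r =>
          if r.tag = t ∧ r.word ≠ none then { r with phase := upgradePhase r.phase u } else r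
      else insert ⟨t, w, u⟩ (S.filter fun r => r.tag ≠ t) :=
  rfl

lemma hasTag_updatePhase_of_ne (w : Option W) (u : Phase) (hst : s ≠ t) :
    HasTag (updatePhase S t w u) D s ↔ HasTag S D s := by
  induction t using WithBot.recBotCoe with
  | bot => rfl
  | coe t =>
    rw [updatePhase_coe]
    split_ifs
    · constructor
      · rintro ⟨_, hr', hD, rfl⟩
        obtain ⟨r, hr, rfl⟩ := Finset.mem_image.1 hr'
        have hne : ¬(r.tag = t ∧ r.word ≠ none) := fun h => hst (by rw [if_pos h, h.1])
        rw [if_neg hne] at hD ⊢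
        exact ⟨r, hr, hD, rfl⟩
      · rintro ⟨r, hr, hD, rfl⟩
        have hne : ¬(r.tag = t ∧ r.word ≠ none) := fun h => hst (by rw [h.1])
        exact ⟨r, Finset.mem_image.2 ⟨r, hr, if_neg hne⟩, hD, rfl⟩
    · constructor
      · rintro ⟨r, hr, hD, rfl⟩
        rcases Finset.mem_insert.1 hr with rfl | hr
        · exact absurd rfl hst
        · exact ⟨r, (Finset.mem_filter.1 hr).1, hD, rfl⟩
      · rintro ⟨r, hr, hD, rfl⟩
        have hne : r.tag ≠ t := fun h => hst (by rw [h])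
        exact ⟨r, Finset.mem_insert_of_mem (Finset.mem_filter.2 ⟨hr, hne⟩), hD, rfl⟩

lemma hasTag_updatePhase_self (S : Finset (Record P W)) (t : Stamp P) (w : Option W) (u : Phase) :
    HasTag (updatePhase S (t : Tag P) w u) allPhases t := by
  rw [updatePhase_coe]
  split_ifs with h
  · obtain ⟨-, r, hr, hrt, hw⟩ := h
    exact ⟨_, Finset.mem_image_of_mem _ hr, mem_allPhases _, by rw [if_pos ⟨hrt, hw⟩, hrt]⟩
  · exact ⟨_, Finset.mem_insert_self _ _, mem_allPhases _, rfl⟩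

lemma maxPhase_allPhases_updatePhase (S : Finset (Record P W)) (t : Tag P) (w : Option W)
    (u : Phase) : maxPhase (updatePhase S t w u) allPhases = maxPhase S allPhases ⊔ t := by
  apply le_antisymm
  · refine maxPhase_le_iff.2 fun s hs => ?_
    by_cases hst : s = t
    · exact hst ▸ le_sup_right
    · exact le_sup_of_le_left ((hasTag_updatePhase_of_ne w u hst).1 hs).le_maxPhase
  · induction t using WithBot.recBotCoe with
    | bot => exact sup_le le_rfl bot_le
    | coe t =>
      have ht := (hasTag_updatePhase_self S t w u).le_maxPhase
      refine sup_le (maxPhase_le_iff.2 fun s hs => ?_) ht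
      by_cases hst : s = t
      · exact hst ▸ ht
      · exact ((hasTag_updatePhase_of_ne w u hst).2 hs).le_maxPhase

lemma HasTag.of_updatePhase_pre (h : HasTag (updatePhase S t none Phase.pre) finPhases s) :
    HasTag S finPhases s := by
  by_cases hst : s = t
  · subst hst
    induction s using WithBot.recBotCoe with
    | bot => exact h
    | coe s =>
      obtain ⟨r, hr, hrD, hrs⟩ := h
      rw [updatePhase_coe] at hr
      split_ifs at hr
      · obtain ⟨r₀, hr₀, rfl⟩ := Finset.mem_image.1 hr
        simp only [upgradePhase_pre, ite_self] at hrD hrs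
        exact ⟨r₀, hr₀, hrD, hrs⟩
      · rcases Finset.mem_insert.1 hr with rfl | hr
        · exact absurd rfl (mem_finPhases.1 hrD)
        · exact ⟨r, (Finset.mem_filter.1 hr).1, hrD, hrs⟩
  · exact (hasTag_updatePhase_of_ne none Phase.pre hst).1 h

lemma HasTag.updatePhase_of_ne_pre {u : Phase} (h : HasTag S finPhases s) (hu : u ≠ Phase.pre) :
    HasTag (updatePhase S t none u) finPhases s := by
  by_cases hst : s = t
  · subst hst
    obtain ⟨r, hr, hrD, rfl⟩ := h
    rw [updatePhase_coe]
    split_ifs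
    · refine ⟨_, Finset.mem_image_of_mem _ hr, ?_, by split_ifs <;> rfl⟩
      split_ifs
      exacts [upgradePhase_mem_finPhases u hrD, hrD]
    · exact ⟨_, Finset.mem_insert_self _ _, mem_finPhases.2 hu, rfl⟩
  · exact (hasTag_updatePhase_of_ne none u hst).2 h

lemma hasTag_finPhases_updatePhase_fin (S : Finset (Record P W)) (t : Stamp P) :
    HasTag (updatePhase S (t : Tag P) none Phase.fin) finPhases t := by
  rw [updatePhase_coe]
  split_ifs with h
  · obtain ⟨-, r, hr, hrt, hw⟩ := h
    exact ⟨_, Finset.mem_image_of_mem _ hr, by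
      rw [if_pos ⟨hrt, hw⟩]; exact upgradePhase_fin_mem_finPhases _, by rw [if_pos ⟨hrt, hw⟩, hrt]⟩
  · exact ⟨_, Finset.mem_insert_self _ _, mem_finPhases.2 Phase.noConfusion, rfl⟩

lemma phase_mem_finPhases_of_mem_updatePhase_fin {t : Stamp P} {r : Record P W}
    (hr : r ∈ updatePhase S (t : Tag P) none Phase.fin) (ht : r.tag = t) (hw : r.word ≠ none) :
    r.phase ∈ finPhases := by
  rw [updatePhase_coe] at hr
  split_ifs at hr
  · obtain ⟨r₀, -, rfl⟩ := Finset.mem_image.1 hr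
    split_ifs at ht hw ⊢ with h
    · exact upgradePhase_fin_mem_finPhases _
    · exact absurd ⟨ht, hw⟩ h
  · rcases Finset.mem_insert.1 hr with rfl | hr
    · exact absurd rfl hw
    · exact absurd ht (Finset.mem_filter.1 hr).2

lemma hasTag_FIN_updatePhase_FIN {t : Stamp P}
    (hS : ∀ r ∈ S, r.tag = t → r.word ≠ none → r.phase ∈ finPhases) :
    HasTag (updatePhase S (t : Tag P) none Phase.FIN) {Phase.FIN} t := by
  rw [updatePhase_coe]
  split_ifs with h
  · obtain ⟨-, r, hr, hrt, hw⟩ := h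
    refine ⟨_, Finset.mem_image_of_mem _ hr, ?_, by rw [if_pos ⟨hrt, hw⟩, hrt]⟩
    rw [if_pos ⟨hrt, hw⟩]
    exact Finset.mem_singleton.2 (upgradePhase_FIN (hS r hr hrt hw))
  · exact ⟨_, Finset.mem_insert_self _ _, Finset.mem_singleton_self _, rfl⟩

lemma le_maxPhase_FIN_updatePhase_fin_FIN (S : Finset (Record P W)) (t : Tag P) :
    t ≤ maxPhase (updatePhase (updatePhase S t none Phase.fin) t none Phase.FIN) {Phase.FIN} := by
  induction t using WithBot.recBotCoe with
  | bot => exact bot_le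
  | coe t =>
    exact (hasTag_FIN_updatePhase_FIN fun r =>
      phase_mem_finPhases_of_mem_updatePhase_fin).le_maxPhase

end Storage

section Quorum

variable {P W V : Type*} [Fintype P] [LinearOrder P] {p : Setup P W V}

lemma Setup.isQuorum_servers (p : Setup P W V) : p.IsQuorum p.servers := by
  refine ⟨subset_rfl, ?_⟩
  have := p.k_le
  omega

lemma Setup.IsQuorum.nonempty {Q : Finset P} (h : p.IsQuorum Q) : Q.Nonempty := by
  have := p.k_lt
  have := h.2
  exact Finset.card_pos.1 (by omega)

lemma Setup.servers_nonempty (p : Setup P W V) : p.servers.Nonempty :=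
  p.isQuorum_servers.nonempty

lemma Setup.exists_server_ne (p : Setup P W V) (i : P) : ∃ j ∈ p.servers, j ≠ i :=
  Finset.exists_mem_ne (p.k_pos.trans_lt p.k_lt) i

end Quorum

section OnGossip

variable {P W V : Type*} [Fintype P] [LinearOrder P]

/-- The largest tag in a gossip triple. -/
def Triple.top (m : Triple P) : Tag P := m.pre ⊔ m.fin ⊔ m.FIN

/-- The largest tag that a gossip triple reports as finalized or FINALIZED. -/
def Triple.topFin (m : Triple P) : Tag P := m.fin ⊔ m.FIN

variable (p : Setup P W V) (i : P) (rx : P → Triple P) (S : Finset (Record P W))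

/-- The value of `pre[i]` computed by `onGossip` from the received gossip `rx` and the
storage `S`. -/
def gossipPre : Tag P := p.servers.sup (fun k => (rx k).top) ⊔ maxPhase S allPhases

variable {p i rx S} {k : P} {t b M : Tag P}

lemma top_le_gossipPre (hk : k ∈ p.servers) : (rx k).top ≤ gossipPre p rx S :=
  le_sup_of_le_left (Finset.le_sup (f := fun k => (rx k).top) hk)

lemma maxPhase_le_gossipPre : maxPhase S allPhases ≤ gossipPre p rx S := le_sup_right

lemma gossipPre_le (hrx : ∀ k ∈ p.servers, (rx k).top ≤ b) (hS : maxPhase S allPhases ≤ b) :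
    gossipPre p rx S ≤ b :=
  sup_le (Finset.sup_le hrx) hS

variable [DecidableEq W] (p i rx S)

/-- The storage after the first of the three updates in `onGossip`. -/
def gossipPreStore : Finset (Record P W) := updatePhase S (gossipPre p rx S) none Phase.pre

/-- The value of `fin[i]` computed by `onGossip`. -/
def gossipFin : Tag P :=
  p.servers.sup (fun k => (rx k).topFin) ⊔ maxPhase (gossipPreStore p rx S) finPhases

/-- The storage after the second of the three updates in `onGossip`. -/
def gossipFinStore : Finset (Record P W) :=
  updatePhase (gossipPreStore p rx S) (gossipFin p rx S) none Phase.fin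

/-- The array `fin[]` of the server of `i` after `onGossip` has set `fin[i]`. -/
def gossipFinArray (k : P) : Tag P := if k = i then gossipFin p rx S else (rx k).fin

/-- The value of `FIN[i]` computed by `onGossip`. -/
def gossipFIN : Tag P :=
  p.servers.sup (fun k => (rx k).FIN) ⊔ maxPhase (gossipFinStore p rx S) {Phase.FIN} ⊔
    p.servers.sup fun k =>
      if p.IsQuorum
        (p.servers.filter fun l => gossipFinArray p i rx S l = gossipFinArray p i rx S k)
      then gossipFinArray p i rx S k else ⊥

/-- The storage after the three updates in `onGossip`. -/
def gossipFINStore : Finset (Record P W) :=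
  updatePhase (gossipFinStore p rx S) (gossipFIN p i rx S) none Phase.FIN

variable {p i rx S}

lemma maxPhase_gossipPreStore : maxPhase (gossipPreStore p rx S) allPhases = gossipPre p rx S := by
  rw [gossipPreStore, maxPhase_allPhases_updatePhase, sup_eq_right.2 maxPhase_le_gossipPre]

lemma topFin_le_gossipFin (hk : k ∈ p.servers) : (rx k).topFin ≤ gossipFin p rx S :=
  le_sup_of_le_left (Finset.le_sup (f := fun k => (rx k).topFin) hk)

lemma gossipFin_le_gossipPre : gossipFin p rx S ≤ gossipPre p rx S := by
  refine sup_le (Finset.sup_le fun k hk => ?_) ?_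
  · exact (sup_le_sup_right le_sup_right _).trans (top_le_gossipPre hk)
  · exact (maxPhase_mono _ finPhases_subset_allPhases).trans maxPhase_gossipPreStore.le

lemma HasTag.le_gossipFin (h : HasTag S finPhases t) (ht : t ≠ gossipPre p rx S) :
    t ≤ gossipFin p rx S :=
  le_sup_of_le_right ((hasTag_updatePhase_of_ne none Phase.pre ht).2 h).le_maxPhase

lemma gossipFin_le_or_eq (hrx : ∀ k ∈ p.servers, (rx k).topFin ≤ b) (hS : maxFinNe S M ≤ b) :
    gossipFin p rx S ≤ b ∨ gossipFin p rx S = M := by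
  have hstore : maxFinNe (gossipPreStore p rx S) M ≤ b :=
    maxFinNe_le_iff.2 fun t ht hM => (ht.of_updatePhase_pre.le_maxFinNe hM).trans hS
  have hsup : p.servers.sup (fun k => (rx k).topFin) ≤ b := Finset.sup_le hrx
  rcases maxPhase_finPhases_le_or_eq (gossipPreStore p rx S) M with hle | heq
  · exact Or.inl (sup_le hsup (hle.trans hstore))
  · rw [gossipFin, heq]
    exact (le_total M b).imp (sup_le hsup) fun h => sup_eq_right.2 (hsup.trans h)

lemma maxPhase_allPhases_gossipFinStore :
    maxPhase (gossipFinStore p rx S) allPhases = gossipPre p rx S := by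
  rw [gossipFinStore, maxPhase_allPhases_updatePhase, maxPhase_gossipPreStore,
    sup_eq_left.2 gossipFin_le_gossipPre]

lemma maxPhase_finPhases_gossipFinStore :
    maxPhase (gossipFinStore p rx S) finPhases = gossipFin p rx S := by
  apply le_antisymm
  · refine maxPhase_le_iff.2 fun t ht => ?_
    by_cases heq : t = gossipFin p rx S
    · exact heq.le
    · exact le_sup_of_le_right ((hasTag_updatePhase_of_ne none Phase.fin heq).1 ht).le_maxPhase
  · rw [gossipFinStore]
    induction gossipFin p rx S using WithBot.recBotCoe with
    | bot => exact bot_le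
    | coe t => exact (hasTag_finPhases_updatePhase_fin _ t).le_maxPhase

lemma gossipFIN_le_gossipFin : gossipFIN p i rx S ≤ gossipFin p rx S := by
  refine sup_le (sup_le (Finset.sup_le fun k hk => ?_) ?_) (Finset.sup_le fun k hk => ?_)
  · exact le_sup_right.trans (topFin_le_gossipFin hk)
  · exact (maxPhase_mono _ singleton_FIN_subset_finPhases).trans
      maxPhase_finPhases_gossipFinStore.le
  · unfold gossipFinArray
    split_ifs
    exacts [le_rfl, bot_le, le_sup_left.trans (topFin_le_gossipFin hk), bot_le]

lemma gossipFIN_eq_gossipFin (h : ∀ k ∈ p.servers, k ≠ i → (rx k).fin = gossipFin p rx S) :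
    gossipFIN p i rx S = gossipFin p rx S := by
  have harray : ∀ k ∈ p.servers, gossipFinArray p i rx S k = gossipFin p rx S := fun k hk => by
    unfold gossipFinArray
    split_ifs with hki
    exacts [rfl, h k hk hki]
  obtain ⟨k, hk⟩ := p.servers_nonempty
  have hquorum : p.IsQuorum
      (p.servers.filter fun l => gossipFinArray p i rx S l = gossipFinArray p i rx S k) := by
    rw [harray k hk, Finset.filter_true_of_mem harray]
    exact p.isQuorum_servers
  refine le_antisymm gossipFIN_le_gossipFin (le_sup_of_le_right (Finset.le_sup_of_le hk ?_))
  rw [if_pos hquorum, harray k hk]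

lemma maxPhase_allPhases_gossipFINStore :
    maxPhase (gossipFINStore p i rx S) allPhases = gossipPre p rx S := by
  rw [gossipFINStore, maxPhase_allPhases_updatePhase, maxPhase_allPhases_gossipFinStore,
    sup_eq_left.2 (gossipFIN_le_gossipFin.trans gossipFin_le_gossipPre)]

lemma maxPhase_finPhases_gossipFINStore :
    maxPhase (gossipFINStore p i rx S) finPhases = gossipFin p rx S := by
  rw [← maxPhase_finPhases_gossipFinStore]
  apply le_antisymm
  · refine maxPhase_le_iff.2 fun t ht => ?_
    by_cases heq : t = gossipFIN p i rx S
    · exact heq.trans_le (gossipFIN_le_gossipFin.trans maxPhase_finPhases_gossipFinStore.ge)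
    · exact ((hasTag_updatePhase_of_ne none Phase.FIN heq).1 ht).le_maxPhase
  · refine maxPhase_le_iff.2 fun t ht => ?_
    exact (ht.updatePhase_of_ne_pre (by decide)).le_maxPhase

lemma maxPhase_FIN_gossipFINStore (h : gossipFIN p i rx S = gossipFin p rx S) :
    maxPhase (gossipFINStore p i rx S) {Phase.FIN} = gossipFin p rx S := by
  apply le_antisymm
  · exact (maxPhase_mono _ singleton_FIN_subset_finPhases).trans
      maxPhase_finPhases_gossipFINStore.le
  · rw [gossipFINStore, h]
    exact le_maxPhase_FIN_updatePhase_fin_FIN _ _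

variable [Nonempty P] (p i) (s : Server P W) (j : P) (m : Triple P)

lemma onGossip_rx : (onGossip p i s j m).1.rx =
    Function.update (Function.update s.rx j m) i
      ⟨gossipPre p (Function.update s.rx j m) s.store,
        gossipFin p (Function.update s.rx j m) s.store,
        gossipFIN p i (Function.update s.rx j m) s.store⟩ := by
  unfold onGossip
  dsimp only
  split_ifs <;> rfl

lemma onGossip_rx_self : (onGossip p i s j m).1.rx i =
    ⟨gossipPre p (Function.update s.rx j m) s.store,
      gossipFin p (Function.update s.rx j m) s.store,
      gossipFIN p i (Function.update s.rx j m) s.store⟩ := by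
  rw [onGossip_rx, Function.update_self]

variable {i} in
lemma onGossip_rx_of_ne (hk : k ≠ i) :
    (onGossip p i s j m).1.rx k = Function.update s.rx j m k := by
  rw [onGossip_rx, Function.update_of_ne hk]

lemma onGossip_tx : (onGossip p i s j m).1.tx = tagTuple (onGossip p i s j m).1.store := by
  unfold onGossip
  dsimp only
  split_ifs <;> rfl

lemma onGossip_store :
    (onGossip p i s j m).1.store = gossipFINStore p i (Function.update s.rx j m) s.store ∨
      (onGossip p i s j m).1.store =
        relevant p.δ (gossipFINStore p i (Function.update s.rx j m) s.store) := by
  unfold onGossip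
  dsimp only
  split_ifs
  exacts [Or.inl rfl, Or.inr rfl]

lemma maxPhase_allPhases_onGossip : maxPhase (onGossip p i s j m).1.store allPhases =
    gossipPre p (Function.update s.rx j m) s.store := by
  rcases onGossip_store p i s j m with h | h
  · rw [h, maxPhase_allPhases_gossipFINStore]
  · rw [h, maxPhase_relevant (Or.inl rfl), maxPhase_allPhases_gossipFINStore]

lemma maxPhase_finPhases_onGossip : maxPhase (onGossip p i s j m).1.store finPhases =
    gossipFin p (Function.update s.rx j m) s.store := by
  rcases onGossip_store p i s j m with h | h
  · rw [h, maxPhase_finPhases_gossipFINStore]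
  · rw [h, maxPhase_relevant (Or.inr rfl), maxPhase_finPhases_gossipFINStore]

lemma maxPhase_FIN_onGossip
    (h : gossipFIN p i (Function.update s.rx j m) s.store =
      gossipFin p (Function.update s.rx j m) s.store) :
    maxPhase (onGossip p i s j m).1.store {Phase.FIN} =
      gossipFin p (Function.update s.rx j m) s.store := by
  have hFIN := maxPhase_FIN_gossipFINStore h
  rcases onGossip_store p i s j m with hstore | hstore
  · rw [hstore, hFIN]
  · rw [hstore, maxPhase_relevant, hFIN]
    exact Or.inr (hFIN.trans maxPhase_finPhases_gossipFINStore.symm)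

lemma onGossip_snd_ne_none
    (htop : (p.tTop : Tag P) ≤ gossipPre p (Function.update s.rx j m) s.store)
    (hFIN : gossipFIN p i (Function.update s.rx j m) s.store =
      gossipFin p (Function.update s.rx j m) s.store)
    (hrx : ∀ k ∈ p.servers, (onGossip p i s j m).1.rx k = (onGossip p i s j m).1.rx i) :
    (onGossip p i s j m).2 ≠ none := by
  have htuple : tagTuple (gossipFINStore p i (Function.update s.rx j m) s.store) =
      (onGossip p i s j m).1.rx i := by
    rw [onGossip_rx_self, tagTuple, maxPhase_allPhases_gossipFINStore,
      maxPhase_finPhases_gossipFINStore, maxPhase_FIN_gossipFINStore hFIN, hFIN]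
  simp only [← htuple, onGossip_rx] at hrx
  unfold onGossip
  dsimp only
  refine (congrArg (fun c : Server P W × Option (Tag P) => c.2 ≠ none)
    (if_pos ⟨?_, hrx, ?_, ?_⟩)).mpr (Option.some_ne_none _)
  · exact htop.trans maxPhase_allPhases_gossipFINStore.ge
  · exact maxPhase_finPhases_gossipFINStore.trans (maxPhase_FIN_gossipFINStore hFIN).symm
  · exact maxPhase_mono _ finPhases_subset_allPhases

end OnGossip

section Requests

variable {P W V : Type*} [Fintype P] [LinearOrder P] {p : Setup P W V}

lemma Proc.tags_req (p : Setup P W V) (j : P) (pr : Proc P V) : (pr.req p j).tags = pr.tags := by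
  cases pr <;> rfl

variable [Nonempty P] {S : Finset (Record P W)} {r : Req P W} {a : Ack P W}

lemma Replies.tag_eq_of_reader (h : Replies p S (.query true) (some a)) :
    a.tag = maxPhase S finPhases := by
  rw [Option.some.inj h]

lemma Replies.tag_eq_of_writer (h : Replies p S (.query false) (some a)) :
    a.tag = maxPhase S allPhases := by
  simp only [Replies, Bool.false_eq_true, if_false] at h
  split_ifs at h
  rw [Option.some.inj h]

lemma Replies.maxPhase_le_tTop (h : Replies p S (.query false) (some a)) :
    maxPhase S allPhases ≤ (p.tTop : Tag P) := by
  simp only [Replies, Bool.false_eq_true, if_false] at h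
  split_ifs at h with htop
  exact htop

lemma Replies.ne_none {a : Option (Ack P W)} (h : Replies p S r a)
    (hr : r = .query false → maxPhase S allPhases ≤ (p.tTop : Tag P)) : a ≠ none := by
  cases r with
  | query reader =>
    cases reader with
    | true => exact Option.ne_none_iff_exists'.2 ⟨_, h⟩
    | false =>
      simp only [Replies, Bool.false_eq_true, if_false, if_pos (hr rfl)] at h
      exact Option.ne_none_iff_exists'.2 ⟨_, h⟩
  | prewrite => exact Option.ne_none_iff_exists'.2 ⟨_, h⟩
  | finalize =>
    obtain ⟨w, ha, -⟩ := h
    exact Option.ne_none_iff_exists'.2 ⟨_, ha⟩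

lemma exists_replies (p : Setup P W V) (S : Finset (Record P W)) (r : Req P W) :
    ∃ a, Replies p S r a := by
  cases r with
  | query reader =>
    simp only [Replies]
    split_ifs
    exacts [⟨_, rfl⟩, ⟨_, rfl⟩, ⟨_, rfl⟩]
  | prewrite => exact ⟨_, rfl⟩
  | finalize reader t last =>
    by_cases h : reader = true ∧ ∃ r ∈ S, (r.tag : Tag P) = t ∧
        r.phase = (if last then Phase.FIN else Phase.fin)
    · obtain ⟨-, r, hr, htag, hphase⟩ := id h
      exact ⟨_, r.word, rfl, by rw [if_pos h]; exact ⟨r, hr, htag, hphase, rfl⟩⟩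
    · exact ⟨_, none, rfl, by rw [if_neg h]⟩

end Requests

section StoreAfter

variable {P W V : Type*} [LinearOrder P] [DecidableEq W] {S : Finset (Record P W)} {r : Req P W}
  {t b : Tag P}

lemma maxPhase_le_storeAfter (S : Finset (Record P W)) (r : Req P W) :
    maxPhase S allPhases ≤ maxPhase (storeAfter S r) allPhases := by
  cases r with
  | query => exact le_rfl
  | prewrite => exact le_sup_left.trans (maxPhase_allPhases_updatePhase ..).ge
  | finalize => exact le_sup_left.trans (maxPhase_allPhases_updatePhase ..).ge

lemma Req.le_maxPhase_storeAfter (S : Finset (Record P W)) (ht : t ∈ r.tags) :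
    t ≤ maxPhase (storeAfter S r) allPhases := by
  cases r with
  | query => exact ht.elim
  | prewrite =>
    subst ht
    exact le_sup_right.trans (maxPhase_allPhases_updatePhase ..).ge
  | finalize =>
    subst ht
    exact le_sup_right.trans (maxPhase_allPhases_updatePhase ..).ge

lemma maxPhase_storeAfter_le (hS : maxPhase S allPhases ≤ b) (hr : ∀ t ∈ r.tags, t ≤ b) :
    maxPhase (storeAfter S r) allPhases ≤ b := by
  cases r with
  | query => exact hS
  | prewrite => exact (maxPhase_allPhases_updatePhase ..).trans_le (sup_le hS (hr _ rfl))
  | finalize => exact (maxPhase_allPhases_updatePhase ..).trans_le (sup_le hS (hr _ rfl))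

variable [Fintype P] [Nonempty P] {p : Setup P W V} {a : Ack P W}

lemma Replies.tag_le (h : Replies p (storeAfter S r) r (some a)) :
    a.tag ≤ maxPhase (storeAfter S r) allPhases := by
  cases r with
  | query =>
    simp only [Replies] at h
    split_ifs at h
    · rw [Option.some.inj h]
      exact maxPhase_mono _ finPhases_subset_allPhases
    · rw [Option.some.inj h]
  | prewrite =>
    rw [Option.some.inj h]
    exact Req.le_maxPhase_storeAfter S rfl
  | finalize =>
    obtain ⟨w, ha, -⟩ := h
    rw [Option.some.inj ha]
    exact Req.le_maxPhase_storeAfter S rfl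

end StoreAfter

section Step

lemma update_eq_ite {α β : Type*} [DecidableEq α] (g : α → β) (i : α) (x : β) :
    Function.update g i x = fun a => if a = i then x else g a :=
  funext fun _ => Function.update_apply ..

lemma set₂_eq_ite {P α : Type*} [LinearOrder P] (g : P → P → α) (i j : P) (x : α) :
    set₂ g i j x = fun a b => if a = i ∧ b = j then x else g a b := by
  funext a b
  by_cases ha : a = i
  · subst ha
    simp [set₂, Function.update_apply]
  · simp [set₂, ha]

variable {P W V : Type*} [Fintype P] [LinearOrder P] {p : Setup P W V}

variable {c c' : State P W V} {ev : Event P V}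

lemma State.ResetFree.srvOn_or_cliOn (hc : c.ResetFree p) (i : P) :
    c.srvOn i = true ∨ c.cliOn i = true :=
  (Finset.mem_union.1 (p.hosts ▸ Finset.mem_univ i)).imp (hc.1 i) (hc.2.1 i)

variable [Nonempty P] [DecidableEq W]

lemma Step.ne_localReset (hs : Step p c ev c') (hc : c.ResetFree p) (i : P) (t : Tag P) :
    ev ≠ .localReset i t := by
  rintro rfl
  have hon := hc.srvOn_or_cliOn i
  simp only [hs.1, hs.2.1, Bool.false_eq_true, or_self] at hon

lemma Step.ne_clean (hs : Step p c ev c') (hc : c.ResetFree p) (i : P) : ev ≠ .clean i := by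
  rintro rfl
  have hon := hc.srvOn_or_cliOn i
  simp only [hs.1, hs.2.1, Bool.false_eq_true, or_self] at hon

lemma Step.pingReceive_cases {i j : P} (hs : Step p c (.pingReceive i j) c') :
    i ∈ p.clients ∧ j ∈ p.servers ∧ ∃ q, c.ping i j = .request q ∧
      ((q = none ∨ c.srvOn j = false) ∧
          c' = { c with ping := set₂ c.ping i j (.atServer none none) } ∨
        ∃ r a a', q = some r ∧ c.srvOn j = true ∧ Replies p (storeAfter (c.srv j).store r) r a ∧
          a'.map Ack.tag = a.map Ack.tag ∧
          c' = { c with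
            ping := set₂ c.ping i j (.atServer (some r) a')
            srv := Function.update c.srv j
              { c.srv j with store := storeAfter (c.srv j).store r } }) := by
  obtain ⟨hi, hj, q, hq, hs⟩ := hs
  refine ⟨hi, hj, q, hq, ?_⟩
  rcases q with - | r
  · exact Or.inl ⟨Or.inl rfl, hs⟩
  rcases hon : c.srvOn j with - | -
  · simp only [hon] at hs
    exact Or.inl ⟨Or.inr rfl, hs⟩
  · simp only [hon] at hs
    obtain ⟨a, a', hreply, ha', rfl⟩ := hs
    refine Or.inr ⟨r, a, a', rfl, rfl, hreply, ?_, rfl⟩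
    split_ifs at ha' with hmalicious
    exacts [ha', by rw [ha']]

lemma Step.srv_cases (hs : Step p c ev c') (hc : c.ResetFree p) (j : P) :
    c'.srv j = c.srv j ∨
    (∃ i m, ev = .gossipReceive i j ∧ i ∈ p.servers ∧ i ≠ j ∧ c.gossip i j = .inTransit (some m) ∧
      c'.srv j = (onGossip p j (c.srv j) i m).1) ∨
    ∃ i r, i ∈ p.clients ∧ c.ping i j = .request (some r) ∧
      c'.srv j = { c.srv j with store := storeAfter (c.srv j).store r } := by
  have hon := hc.1
  have hreset := hs.ne_localReset hc
  cases ev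
  case pingReceive => have := hs.pingReceive_cases; clear hs; grind [update_eq_ite]
  all_goals grind [Step, update_eq_ite]

lemma Step.gossip_cases (hs : Step p c ev c') (hc : c.ResetFree p)
    (i j : P) :
    (c'.gossip i j = c.gossip i j ∧ ev ≠ .gossipSend i j ∧ ev ≠ .gossipReceive i j) ∨
    (ev = .gossipSend i j ∧ c.gossip i j = .atSender ∧
      c'.gossip i j = .inTransit (some (c.srv i).tx)) ∨
    (ev = .gossipReceive i j ∧ (∃ m, c.gossip i j = .inTransit m) ∧
      c'.gossip i j = .atSender) := by
  have hon := hc.1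
  have hclean := hs.ne_clean hc
  cases ev
  case pingReceive => have := hs.pingReceive_cases; clear hs; grind
  all_goals grind [Step, set₂_eq_ite]

lemma Step.ping_cases (hs : Step p c ev c') (hc : c.ResetFree p)
    (i j : P) :
    (c'.ping i j = c.ping i j ∧ ev ≠ .pingSend i j ∧ ev ≠ .pingReceive i j ∧ ev ≠ .pongSend i j ∧
      ev ≠ .pongReceive i j) ∨
    (ev = .pingSend i j ∧ c.ping i j = .atClient ∧
      c'.ping i j = .request ((c.cli i).outgoing p j)) ∨
    (ev = .pingReceive i j ∧ c.ping i j = .request none ∧ c'.ping i j = .atServer none none) ∨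
    (∃ r a a', ev = .pingReceive i j ∧ c.ping i j = .request (some r) ∧
      Replies p (storeAfter (c.srv j).store r) r a ∧ a'.map Ack.tag = a.map Ack.tag ∧
      (c'.srv j).store = storeAfter (c.srv j).store r ∧
      c'.ping i j = .atServer (some r) a') ∨
    (∃ q a, ev = .pongSend i j ∧ c.ping i j = .atServer q a ∧ c'.ping i j = .response q a) ∨
    (∃ q a, ev = .pongReceive i j ∧ c.ping i j = .response q a ∧ c'.ping i j = .atClient) := by
  have hon := hc.1
  have hcli := hc.2.1
  have hclean := hs.ne_clean hc
  cases ev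
  case pingReceive =>
    have := hs.pingReceive_cases; clear hs; grind [set₂_eq_ite, update_eq_ite]
  all_goals grind [Step, set₂_eq_ite]

lemma Step.cli_cases (hs : Step p c ev c') (hc : c.ResetFree p) (i : P) :
    (c'.cli i = c.cli i ∧ (∀ j, ev ≠ .pingSend i j) ∧ ∀ j, ev ≠ .pongReceive i j) ∨
    (∃ j ∈ p.servers, ev = .pingSend i j ∧ c'.cli i = (c.cli i).markSent j) ∨
    (∃ j ∈ p.servers, ∃ q a, ev = .pongReceive i j ∧ c.ping i j = .response q a ∧
      c'.cli i = onReply p i j q a (c.cli i)) ∨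
    (c.cli i = .idle ∧ (∀ j, ev ≠ .pingSend i j) ∧ (∀ j, ev ≠ .pongReceive i j) ∧
      ((∃ s, c'.cli i = .enter (.wQuery s)) ∨ c'.cli i = .enter .rQuery)) := by
  have hcli := hc.2.1
  have hreset := hs.ne_localReset hc
  cases ev
  case pingReceive => have := hs.pingReceive_cases; clear hs; grind
  all_goals grind [Step, update_eq_ite]

end Step

section Calm

variable {P W V : Type*} [Fintype P] [LinearOrder P] [Nonempty P] [DecidableEq W]
  {p : Setup P W V} {R : Execution p}

/-- The segment with the steps `x, …, y - 1` includes a complete iteration of every server and a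
complete round trip of every client node with every server.  This is the part of an asynchronous
cycle that does not depend on the clients' procedures. -/
def Execution.LinkCycle (R : Execution p) (x y : ℕ) : Prop :=
  (∀ i ∈ p.servers, R.ServerIteration x y i) ∧
  ∀ i ∈ p.clients, ∀ j ∈ p.servers, R.RoundTrip x y i j

lemma Execution.LinkCycle.exists_gossip {x y : ℕ} (h : R.LinkCycle x y) {i j : P}
    (hi : i ∈ p.servers) (hj : j ∈ p.servers) (hij : i ≠ j) :
    ∃ b₁ b₂, x ≤ b₁ ∧ b₁ < b₂ ∧ b₂ < y ∧ R.event b₁ = .gossipSend i j ∧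
      R.event b₂ = .gossipReceive i j := by
  obtain ⟨a, -, hxa, -, h⟩ := h.1 i hi
  obtain ⟨b₁, b₂, b₃, b₄, h₁, h₂, h₃, h₄, hy, hsend, hreceive, -⟩ := h j hj hij.symm
  exact ⟨b₁, b₂, by omega, h₂, by omega, hsend, hreceive⟩

lemma Execution.LinkCycle.lt {x y : ℕ} (h : R.LinkCycle x y) : x < y := by
  obtain ⟨i, hi⟩ := p.servers_nonempty
  obtain ⟨j, hj, hji⟩ := p.exists_server_ne i
  obtain ⟨b₁, b₂, h₁, h₂, h₃, -⟩ := h.exists_gossip hi hj hji.symm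
  omega

/-- The states `w 0, …, B` are reset-free, there is no call to `globalReset` meanwhile, no gossip
without payload is in transit, and the steps from `w k` to `w (k + 1)` include a link cycle.  The
link cycles need not end before `B`. -/
structure Calm (R : Execution p) (w : ℕ → ℕ) (B : ℕ) : Prop where
  cycle : ∀ k, R.LinkCycle (w k) (w (k + 1))
  resetFree : ∀ n, w 0 ≤ n → n ≤ B → (R.state n).ResetFree p
  noCall : ∀ n, w 0 ≤ n → n < B → ∀ i t, ¬ R.CallsReset n i t
  gossip_ne : ∀ n, w 0 ≤ n → n ≤ B → ∀ i ∈ p.servers, ∀ j ∈ p.servers, i ≠ j →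
    (R.state n).gossip i j ≠ .inTransit none

/-- `Q` holds in all states from `w k` to `B`. -/
def After (w : ℕ → ℕ) (B k : ℕ) (Q : ℕ → Prop) : Prop :=
  ∀ n, w k ≤ n → n ≤ B → Q n

variable {w : ℕ → ℕ} {B : ℕ}

lemma segment_induction {x y : ℕ} {Q : ℕ → Prop} (hQ : ∀ n, x ≤ n → n < y → Q n → Q (n + 1))
    (h : Q x) : ∀ n, x ≤ n → n ≤ y → Q n := by
  intro n hn
  induction n, hn using Nat.le_induction with
  | base => exact fun _ => h
  | succ n hn ih => exact fun hy => hQ n hn (by omega) (ih (by omega))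

lemma After.of_cycle {k : ℕ} {Q : ℕ → Prop} (hQ : ∀ n, w k ≤ n → n < B → Q n → Q (n + 1))
    (h : w (k + 1) ≤ B → ∃ n, w k ≤ n ∧ n ≤ w (k + 1) ∧ Q n) : After w B (k + 1) Q := by
  intro n hn hB
  obtain ⟨m, hm, hm', hQm⟩ := h (hn.trans hB)
  exact segment_induction (fun l hl => hQ l (hm.trans hl)) hQm n (hm'.trans hn) hB

namespace Calm

lemma monotone (h : Calm R w B) : Monotone w :=
  monotone_nat_of_le_succ fun k => (h.cycle k).lt.le

lemma zero_le (h : Calm R w B) (k : ℕ) : w 0 ≤ w k := h.monotone (Nat.zero_le k)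

lemma drop (h : Calm R w B) (c : ℕ) : Calm R (fun k => w (k + c)) B where
  cycle k := by simpa only [Nat.add_right_comm] using h.cycle (k + c)
  resetFree n hn hB := h.resetFree n ((h.zero_le _).trans hn) hB
  noCall n hn hB := h.noCall n ((h.zero_le _).trans hn) hB
  gossip_ne n hn hB := h.gossip_ne n ((h.zero_le _).trans hn) hB

lemma restrict (h : Calm R w B) {B' : ℕ} (hB : B' ≤ B) : Calm R w B' where
  cycle := h.cycle
  resetFree n hn hn' := h.resetFree n hn (hn'.trans hB)
  noCall n hn hn' := h.noCall n hn (hn'.trans_le hB)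
  gossip_ne n hn hn' := h.gossip_ne n hn (hn'.trans hB)

end Calm

lemma After.weaken {k l : ℕ} {Q Q' : ℕ → Prop} (h : Calm R w B) (hQ : After w B k Q)
    (hkl : k ≤ l) (hQ' : ∀ n, w 0 ≤ n → n ≤ B → Q n → Q' n) : After w B l Q' :=
  fun n hn hB => hQ' n ((h.zero_le l).trans hn) hB (hQ n ((h.monotone hkl).trans hn) hB)

lemma After.shift {k l : ℕ} {Q : ℕ → Prop} (hQ : After w B k Q) (h : Calm R w B)
    (hkl : k ≤ l) : After w B l Q :=
  hQ.weaken h hkl fun _ _ _ => id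

/-- The largest tag that the server of `i` stores. -/
def Execution.top (R : Execution p) (n : ℕ) (i : P) : Tag P :=
  maxPhase ((R.state n).srv i).store allPhases

/-- The last gossip that the server of `j` received from `i`. -/
abbrev Execution.rx (R : Execution p) (n : ℕ) (j i : P) : Triple P := ((R.state n).srv j).rx i

/-- The gossip that the server of `i` sends. -/
abbrev Execution.tx (R : Execution p) (n : ℕ) (i : P) : Triple P := ((R.state n).srv i).tx

/-- The gossip buffers of the server `s` of `j` are consistent with each other and with its
storage, as they are after each arrival of gossip. -/
structure Settled (p : Setup P W V) (j : P) (s : Server P W) : Prop where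
  top_le : ∀ k ∈ p.servers, (s.rx k).top ≤ (s.rx j).pre
  topFin_le : ∀ k ∈ p.servers, (s.rx k).topFin ≤ (s.rx j).fin
  fin_le_pre : (s.rx j).fin ≤ (s.rx j).pre
  pre_le : (s.rx j).pre ≤ maxPhase s.store allPhases
  tx_pre : s.tx.pre = (s.rx j).pre
  tx_fin : s.tx.fin = (s.rx j).fin
  tx_FIN_le : s.tx.FIN ≤ (s.rx j).fin

lemma settled_onGossip (p : Setup P W V) (j : P) (s : Server P W) (i : P) (m : Triple P) :
    Settled p j (onGossip p j s i m).1 where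
  top_le k hk := by
    rw [onGossip_rx_self]
    by_cases hkj : k = j
    · rw [hkj, onGossip_rx_self]
      exact sup_le (sup_le le_rfl gossipFin_le_gossipPre)
        (gossipFIN_le_gossipFin.trans gossipFin_le_gossipPre)
    · rw [onGossip_rx_of_ne p s i m hkj]
      exact top_le_gossipPre hk
  topFin_le k hk := by
    rw [onGossip_rx_self]
    by_cases hkj : k = j
    · rw [hkj, onGossip_rx_self]
      exact sup_le le_rfl gossipFIN_le_gossipFin
    · rw [onGossip_rx_of_ne p s i m hkj]
      exact topFin_le_gossipFin hk
  fin_le_pre := by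
    rw [onGossip_rx_self]
    exact gossipFin_le_gossipPre
  pre_le := by rw [onGossip_rx_self, maxPhase_allPhases_onGossip]
  tx_pre := by rw [onGossip_rx_self, onGossip_tx, tagTuple, maxPhase_allPhases_onGossip]
  tx_fin := by rw [onGossip_rx_self, onGossip_tx, tagTuple, maxPhase_finPhases_onGossip]
  tx_FIN_le := by
    rw [onGossip_rx_self, onGossip_tx, ← maxPhase_finPhases_onGossip p j s i m]
    exact maxPhase_mono _ singleton_FIN_subset_finPhases

namespace Calm

lemma exists_receive (h : Calm R w B) {n : ℕ} (hn : w 0 ≤ n) (hB : n < B) {i j : P}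
    (hev : R.event n = .gossipReceive i j) :
    ∃ m, (R.state n).gossip i j = .inTransit (some m) ∧
      (R.state (n + 1)).srv j = (onGossip p j ((R.state n).srv j) i m).1 := by
  have hs := R.step n
  rw [hev] at hs
  obtain ⟨hi, hj, hij, m, hm, hstate⟩ := hs
  rcases m with - | m
  · exact absurd hm (h.gossip_ne n hn hB.le i hi j hj hij)
  · refine ⟨m, hm, ?_⟩
    simp only [hstate, (h.resetFree n hn hB.le).1 j hj, Function.update_self]

lemma onGossip_snd (h : Calm R w B) {n : ℕ} (hn : w 0 ≤ n) (hB : n < B) {i j : P}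
    (hj : j ∈ p.servers) {m : Triple P} (hev : R.event n = .gossipReceive i j)
    (hm : (R.state n).gossip i j = .inTransit (some m)) :
    (onGossip p j ((R.state n).srv j) i m).2 = none :=
  Option.eq_none_iff_forall_ne_some.2 fun t ht =>
    h.noCall n hn hB j t ⟨i, m, hev, hm, (h.resetFree n hn hB.le).1 j hj, ht⟩

lemma after_receive {k : ℕ} (h : Calm R w B) {j : P} (hj : j ∈ p.servers) {Q : ℕ → Prop}
    (hpersist : ∀ n, w k ≤ n → n < B → Q n →
      ((R.state (n + 1)).srv j = (R.state n).srv j ∨ ∃ i r, i ∈ p.clients ∧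
        (R.state n).ping i j = .request (some r) ∧ (R.state (n + 1)).srv j =
        { (R.state n).srv j with store := storeAfter ((R.state n).srv j).store r }) → Q (n + 1))
    (hreceive : ∀ n, w k ≤ n → n < B → ∀ i ∈ p.servers, i ≠ j → ∀ m,
      (R.state n).gossip i j = .inTransit (some m) →
      (R.state (n + 1)).srv j = (onGossip p j ((R.state n).srv j) i m).1 → Q (n + 1)) :
    After w B (k + 1) Q := by
  refine After.of_cycle (fun n hn hB hQ => ?_) (fun _ => ?_)
  · have hc := h.resetFree n ((h.zero_le k).trans hn) hB.le
    rcases (R.step n).srv_cases hc j with heq | ⟨i, m, -, hi, hij, hm, hgossip⟩ | hrequest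
    · exact hpersist n hn hB hQ (Or.inl heq)
    · exact hreceive n hn hB i hi hij m hm hgossip
    · exact hpersist n hn hB hQ (Or.inr hrequest)
  · obtain ⟨i, hi, hij⟩ := p.exists_server_ne j
    obtain ⟨b₁, b₂, h₁, h₂, h₃, -, hev⟩ := (h.cycle k).exists_gossip hi hj hij
    obtain ⟨m, hm, hgossip⟩ :=
      h.exists_receive (n := b₂) ((h.zero_le k).trans (by omega)) (by omega) hev
    exact ⟨b₂ + 1, by omega, by omega,
      hreceive b₂ (by omega) (by omega) i hi hij m hm hgossip⟩

lemma after_inTransit {k : ℕ} (h : Calm R w B) {Φ : ℕ → Triple P → Prop} {i j : P}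
    (hi : i ∈ p.servers) (hj : j ∈ p.servers) (hij : i ≠ j)
    (hΦ : ∀ n, w k ≤ n → n < B → ∀ m, Φ n m → Φ (n + 1) m)
    (htx : After w B k fun n => Φ n (R.tx n i)) :
    After w B (k + 1) fun n => ∀ m, (R.state n).gossip i j = .inTransit (some m) → Φ n m := by
  refine After.of_cycle (fun n hn hB hQ => ?_) (fun _ => ?_)
  · have hc := h.resetFree n ((h.zero_le k).trans hn) hB.le
    rcases (R.step n).gossip_cases hc i j with ⟨heq, -⟩ | ⟨-, -, hsent⟩ | ⟨-, -, hgone⟩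
    · rw [heq]
      exact fun m hm => hΦ n hn hB m (hQ m hm)
    · rw [hsent]
      rintro m ⟨⟩
      exact hΦ n hn hB _ (htx n hn hB.le)
    · rw [hgone]
      rintro m ⟨⟩
  · obtain ⟨b₁, b₂, h₁, h₂, h₃, hsend, -⟩ := (h.cycle k).exists_gossip hi hj hij
    have hs := R.step b₁
    rw [hsend] at hs
    refine ⟨b₁, h₁, by omega, ?_⟩
    rw [hs.2.2.2.1]
    rintro m ⟨⟩

lemma after_rx {k : ℕ} (h : Calm R w B) {Φ : ℕ → Triple P → Prop} {i j : P}
    (hi : i ∈ p.servers) (hj : j ∈ p.servers) (hij : i ≠ j)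
    (hΦ : ∀ n, w k ≤ n → n < B → ∀ m, Φ n m → Φ (n + 1) m)
    (htx : After w B k fun n => Φ n (R.tx n i)) :
    After w B (k + 2) fun n => Φ n (R.rx n j i) := by
  have htransit := h.after_inTransit hi hj hij hΦ htx
  have hk : w k ≤ w (k + 1) := h.monotone (Nat.le_succ k)
  refine After.of_cycle (k := k + 1) (fun n hn hB hQ => ?_) (fun hB => ?_)
  · have hQ' := hΦ n (hk.trans hn) hB _ hQ
    have hc := h.resetFree n ((h.zero_le _).trans hn) hB.le
    rcases (R.step n).srv_cases hc j with heq | ⟨l, m, -, -, -, hm, heq⟩ | ⟨-, r, -, -, heq⟩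
    · rwa [Execution.rx, heq]
    · rw [Execution.rx, heq, onGossip_rx_of_ne _ _ _ _ hij]
      by_cases hil : i = l
      · subst hil
        rw [Function.update_self]
        exact hΦ n (hk.trans hn) hB _ (htransit n hn hB.le m hm)
      · rwa [Function.update_of_ne hil]
    · rwa [Execution.rx, heq]
  · obtain ⟨b₁, b₂, h₁, h₂, h₃, -, hev⟩ := (h.cycle (k + 1)).exists_gossip hi hj hij
    have hb : w (k + 1) ≤ b₂ := h₁.trans h₂.le
    obtain ⟨m, hm, heq⟩ := h.exists_receive ((h.zero_le _).trans hb) (by omega) hev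
    refine ⟨b₂ + 1, by omega, by omega, ?_⟩
    rw [Execution.rx, heq, onGossip_rx_of_ne _ _ _ _ hij, Function.update_self]
    exact hΦ b₂ (hk.trans hb) (by omega) m (htransit b₂ hb (by omega) m hm)

lemma top_mono (h : Calm R w B) {n m : ℕ} (hn : w 0 ≤ n) (hnm : n ≤ m) (hB : m ≤ B) (j : P) :
    R.top n j ≤ R.top m j := by
  refine segment_induction (Q := fun m => R.top n j ≤ R.top m j) (fun m hm hB hnm => ?_) le_rfl m
    hnm hB
  refine hnm.trans ?_
  have hc := h.resetFree m (hn.trans hm) hB.le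
  unfold Execution.top
  rcases (R.step m).srv_cases hc j with heq | ⟨l, m, -, -, -, -, heq⟩ | ⟨-, r, -, -, heq⟩
  · rw [heq]
  · rw [heq, maxPhase_allPhases_onGossip]
    exact maxPhase_le_gossipPre
  · rw [heq]
    exact maxPhase_le_storeAfter _ _

lemma settled (h : Calm R w B) :
    After w B 1 fun n => ∀ j ∈ p.servers, Settled p j ((R.state n).srv j) := by
  intro n hn hB j hj
  refine h.after_receive (k := 0) hj (Q := fun n => Settled p j ((R.state n).srv j)) ?_ ?_ n hn hB
  · rintro n - - hQ (heq | ⟨-, r, -, -, heq⟩)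
    · rwa [heq]
    · rw [heq]
      exact { hQ with pre_le := hQ.pre_le.trans (maxPhase_le_storeAfter _ r) }
  · intro n _ _ i _ _ m _ heq
    rw [heq]
    exact settled_onGossip ..

lemma le_top_after (h : Calm R w B) {k : ℕ} {v : Tag P} {i : P} (hi : i ∈ p.servers)
    (hv : v ≤ R.top (w k) i) : After w B (k + 4) fun n => ∀ j ∈ p.servers, v ≤ R.top n j := by
  have htx : After w B (k + 1) fun n => v ≤ (R.tx n i).pre := by
    refine h.after_receive hi ?_ ?_
    · rintro n - - hQ (heq | ⟨-, r, -, -, heq⟩) <;> rwa [Execution.tx, heq]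
    · intro n hn hB j _ _ m _ heq
      rw [Execution.tx, heq, (settled_onGossip ..).tx_pre, onGossip_rx_self]
      exact (hv.trans (h.top_mono (h.zero_le k) hn hB.le i)).trans maxPhase_le_gossipPre
  intro n hn hB j hj
  by_cases hij : i = j
  · subst hij
    exact hv.trans (h.top_mono (h.zero_le k) ((h.monotone (Nat.le_add_right k 4)).trans hn) hB i)
  have hrx := (h.after_rx hi hj hij (Φ := fun _ m => v ≤ m.pre) (fun _ _ _ _ => id) htx).shift h
    (show k + 1 + 2 ≤ k + 4 by omega) n hn hB
  have hsettled := h.settled.shift h (show 1 ≤ k + 4 by omega) n hn hB j hj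
  calc v ≤ (R.rx n j i).pre := hrx
    _ ≤ (R.rx n j i).top := le_sup_of_le_left le_sup_left
    _ ≤ (R.rx n j j).pre := hsettled.top_le i hi
    _ ≤ R.top n j := hsettled.pre_le

end Calm

end Calm

section ClientSteps

variable {P W V : Type*} [Fintype P] [LinearOrder P] {p : Setup P W V}

/-- The servers from which `acks` has an acknowledgment form a quorum. -/
def AckedByQuorum (p : Setup P W V) (acks : P → Option (Ack P W)) : Prop :=
  p.IsQuorum (p.servers.filter fun k => (acks k).isSome)

lemma AckedByQuorum.exists_ack {acks : P → Option (Ack P W)} (h : AckedByQuorum p acks) :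
    ∃ k ∈ p.servers, ∃ a, acks k = some a := by
  obtain ⟨k, hk⟩ := Setup.IsQuorum.nonempty h
  obtain ⟨hk, hack⟩ := Finset.mem_filter.1 hk
  exact ⟨k, hk, Option.isSome_iff_exists.1 hack⟩

lemma ackedByQuorum_of_forall {acks : P → Option (Ack P W)}
    (h : ∀ k ∈ p.servers, (acks k).isSome) : AckedByQuorum p acks := by
  rw [AckedByQuorum, Finset.filter_true_of_mem h]
  exact p.isQuorum_servers

lemma not_ackedByQuorum_of_enter {pr pr' : Proc P V} {sent : P → Bool}
    {acks : P → Option (Ack P W)} (h : (Client.enter pr' : Client P W V) = .busy pr sent acks) :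
    ¬ AckedByQuorum p acks := by
  cases h
  intro hquorum
  simpa using hquorum.exists_ack

/-- The acknowledgments of the client of `i` in phase `pr` change from `acks` to `acks'` at most by
replies that are on their way to `i`. -/
def AckStep (p : Setup P W V) (c : State P W V) (i : P) (pr : Proc P V) (sent : P → Bool)
    (acks acks' : P → Option (Ack P W)) : Prop :=
  ∀ k, acks' k = acks k ∨ (sent k = true ∧ ∃ a,
    c.ping i k = .response (some (pr.req p k)) (some a) ∧ acks' k = some a)

lemma AckStep.refl {c : State P W V} {i : P} {pr : Proc P V} {sent : P → Bool}
    {acks : P → Option (Ack P W)} : AckStep p c i pr sent acks acks :=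
  fun _ => Or.inl rfl

/-- The client of `i` in phase `pr` has no acknowledgments and each of the requests that it has
sent is still on its way. -/
def State.Undelivered (p : Setup P W V) (c : State P W V) (i : P) (pr : Proc P V) : Prop :=
  ∃ sent acks, c.cli i = .busy pr sent acks ∧ ∀ j ∈ p.servers,
    acks j = none ∧ (sent j = true → c.ping i j = .request (some (pr.req p j)))

lemma State.undelivered_of_enter {c : State P W V} {i : P} {pr : Proc P V}
    (h : c.cli i = .enter pr) : c.Undelivered p i pr :=
  ⟨_, _, h, fun _ _ => ⟨rfl, by simp⟩⟩

lemma Client.exists_busy {P W V : Type*} {cl : Client P W V} {pr : Proc P V}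
    (h : cl.proc = some pr) : ∃ sent acks, cl = .busy pr sent acks := by
  cases cl with
  | idle => cases h
  | busy pr' sent acks =>
    cases h
    exact ⟨sent, acks, rfl⟩

lemma proc_advance_ne [Nonempty P] (i : P) (acks : P → Option (Ack P W)) (pr : Proc P V) :
    (Client.advance p i acks pr).proc ≠ some pr := by
  cases pr <;> simp [Client.advance, Client.enter, Client.proc]

variable [DecidableEq W]

/-- The acknowledgments of a client in phase `pr` after the reply `a` to the request `q` arrives
from `j`. -/
def newAcks (p : Setup P W V) (j : P) (q : Option (Req P W)) (a : Option (Ack P W))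
    (pr : Proc P V) (sent : P → Bool) (acks : P → Option (Ack P W)) : P → Option (Ack P W) :=
  if sent j = true ∧ q = some (pr.req p j) ∧ a.isSome then Function.update acks j a else acks

lemma newAcks_apply (p : Setup P W V) (j : P) (q : Option (Req P W)) (a : Option (Ack P W))
    (pr : Proc P V) (sent : P → Bool) (acks : P → Option (Ack P W)) (k : P) :
    newAcks p j q a pr sent acks k =
      if k = j ∧ sent j = true ∧ q = some (pr.req p j) ∧ a.isSome then a else acks k := by
  rw [newAcks]
  split_ifs <;> grind [Function.update_apply]

lemma ackStep_newAcks {c : State P W V} {i j : P} {q : Option (Req P W)}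
    {a : Option (Ack P W)} (h : c.ping i j = .response q a) (pr : Proc P V) (sent : P → Bool)
    (acks : P → Option (Ack P W)) : AckStep p c i pr sent acks (newAcks p j q a pr sent acks) := by
  intro k
  grind [newAcks_apply, Option.isSome_iff_exists]

lemma onReply_busy [Nonempty P] (i j : P) (q : Option (Req P W)) (a : Option (Ack P W))
    (pr : Proc P V) (sent : P → Bool) (acks : P → Option (Ack P W)) :
    (AckedByQuorum p (newAcks p j q a pr sent acks) ∧ onReply p i j q a (.busy pr sent acks) =
      .advance p i (newAcks p j q a pr sent acks) pr) ∨
    (¬ AckedByQuorum p (newAcks p j q a pr sent acks) ∧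
      onReply p i j q a (.busy pr sent acks) = .busy pr sent (newAcks p j q a pr sent acks)) := by
  by_cases h : AckedByQuorum p (newAcks p j q a pr sent acks)
  · exact Or.inl ⟨h, if_pos h⟩
  · exact Or.inr ⟨h, if_neg h⟩

variable [Nonempty P] {c c' : State P W V} {ev : Event P V} {i j : P} {pr : Proc P V}
  {sent : P → Bool} {acks : P → Option (Ack P W)}

lemma Step.cli_of_busy (hs : Step p c ev c') (hc : c.ResetFree p)
    (hcli : c.cli i = .busy pr sent acks) :
    ∃ acks', AckStep p c i pr sent acks acks' ∧
      ((∃ sent', c'.cli i = .busy pr sent' acks') ∨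
        (AckedByQuorum p acks' ∧ c'.cli i = .advance p i acks' pr)) := by
  rcases hs.cli_cases hc i with heq | ⟨j, -, -, heq⟩ | ⟨j, -, q, a, -, hlink, heq⟩ | hidle
  · exact ⟨acks, .refl, Or.inl ⟨sent, heq.1.trans hcli⟩⟩
  · exact ⟨acks, .refl, Or.inl ⟨_, by rw [heq, hcli]; rfl⟩⟩
  · refine ⟨_, ackStep_newAcks hlink pr sent acks, ?_⟩
    rw [heq, hcli]
    exact (onReply_busy i j q a pr sent acks).elim Or.inr fun h => Or.inl ⟨sent, h.2⟩
  · simp [hcli] at hidle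

lemma Step.cli_of_idle (hs : Step p c ev c') (hc : c.ResetFree p) (hcli : c.cli i = .idle) :
    c'.cli i = .idle ∨ (∃ s, c'.cli i = .enter (.wQuery s)) ∨ c'.cli i = .enter .rQuery := by
  rcases hs.cli_cases hc i with heq | ⟨j, -, -, heq⟩ | ⟨j, -, q, a, -, -, heq⟩ | hidle
  · exact Or.inl (heq.1.trans hcli)
  · exact Or.inl (by rw [heq, hcli]; rfl)
  · exact Or.inl (by rw [heq, hcli]; rfl)
  · exact Or.inr hidle.2.2.2

lemma Step.cli_of_proc_eq (hs : Step p c ev c') (hc : c.ResetFree p)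
    (hcli : c.cli i = .busy pr sent acks) (hproc : (c'.cli i).proc = some pr) :
    (c'.cli i = c.cli i ∧ (∀ j, ev ≠ .pingSend i j) ∧ ∀ j, ev ≠ .pongReceive i j) ∨
    (∃ j, ev = .pingSend i j ∧ c'.cli i = .busy pr (Function.update sent j true) acks) ∨
    ∃ j q a, ev = .pongReceive i j ∧ c.ping i j = .response q a ∧
      ¬ AckedByQuorum p (newAcks p j q a pr sent acks) ∧
      c'.cli i = .busy pr sent (newAcks p j q a pr sent acks) := by
  rcases hs.cli_cases hc i with heq | ⟨j, -, hev, heq⟩ | ⟨j, -, q, a, hev, hlink, heq⟩ | hidle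
  · exact Or.inl heq
  · exact Or.inr (Or.inl ⟨j, hev, by rw [heq, hcli]; rfl⟩)
  · rw [hcli] at heq
    rcases onReply_busy (p := p) i j q a pr sent acks with h | h
    · rw [heq, h.2] at hproc
      exact absurd hproc (proc_advance_ne i _ pr)
    · exact Or.inr (Or.inr ⟨j, q, a, hev, hlink, h.1, heq.trans h.2⟩)
  · simp [hcli] at hidle

/-- The client of `i` in phase `pr` sent its request to `j` and either has the acknowledgment, or
the request or a reply with an acknowledgment is on its way. -/
def State.Underway (p : Setup P W V) (c : State P W V) (i j : P) (pr : Proc P V) : Prop :=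
  ∃ sent acks, c.cli i = .busy pr sent acks ∧ sent j = true ∧
    ((acks j).isSome ∨ c.ping i j = .request (some (pr.req p j)) ∨
      (∃ a, c.ping i j = .atServer (some (pr.req p j)) (some a)) ∨
      ∃ a, c.ping i j = .response (some (pr.req p j)) (some a))

/-- The client of `i` in phase `pr` has an acknowledgment of `j`. -/
def State.Acked (c : State P W V) (i j : P) (pr : Proc P V) : Prop :=
  ∃ sent acks, c.cli i = .busy pr sent acks ∧ (acks j).isSome

lemma Step.underway_of_pingSend (hs : Step p c (.pingSend i j) c') (hc : c.ResetFree p)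
    (hcli : c.cli i = .busy pr sent acks) : c'.Underway p i j pr := by
  have hcases := hs.cli_cases hc i
  have hlink := hs.ping_cases hc i j
  refine ⟨Function.update sent j true, acks, ?_, by simp, Or.inr (Or.inl ?_)⟩ <;>
    grind [Client.markSent, Client.outgoing]

lemma Step.underway (hs : Step p c ev c') (hc : c.ResetFree p)
    (hproc : (c'.cli i).proc = some pr) (h : c.Underway p i j pr)
    (htop : ∀ s, pr = .wQuery s → maxPhase (c'.srv j).store allPhases ≤ (p.tTop : Tag P)) :
    c'.Underway p i j pr := by
  obtain ⟨sent, acks, hcli, hsent, hlink⟩ := h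
  have hcases := hs.cli_of_proc_eq hc hcli hproc
  have hping := hs.ping_cases hc i j
  have hquery : pr.req p j = .query false → ∃ s, pr = .wQuery s := by
    cases pr <;> simp [Proc.req]
  have hreply : ∀ a, Replies p (c'.srv j).store (pr.req p j) a → ∃ b, a = some b := fun a ha =>
    Option.ne_none_iff_exists'.1
      (ha.ne_none fun hr => (hquery hr).elim htop)
  have hmap : ∀ a b : Option (Ack P W), b.map Ack.tag = a.map Ack.tag → a.isSome → b.isSome := by
    rintro (- | a) (- | b) <;> simp
  grind [State.Underway, newAcks_apply, Option.isSome_iff_exists]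

lemma Step.acked_of_pongReceive (hs : Step p c (.pongReceive i j) c') (hc : c.ResetFree p)
    (hproc : (c'.cli i).proc = some pr) (h : c.Underway p i j pr) : c'.Acked i j pr := by
  obtain ⟨sent, acks, hcli, hsent, hlink⟩ := h
  have hcases := hs.cli_of_proc_eq hc hcli hproc
  grind [State.Acked, newAcks_apply]

lemma Step.acked (hs : Step p c ev c') (hc : c.ResetFree p)
    (hproc : (c'.cli i).proc = some pr) (h : c.Acked i j pr) : c'.Acked i j pr := by
  obtain ⟨sent, acks, hcli, hack⟩ := h
  have hcases := hs.cli_of_proc_eq hc hcli hproc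
  grind [State.Acked, newAcks_apply]

lemma not_ackedByQuorum_of_onReply {q : Option (Req P W)} {a : Option (Ack P W)}
    {cl : Client P W V} (h : onReply p i j q a cl = .busy pr sent acks) :
    ¬ AckedByQuorum p acks := by
  rcases cl with - | ⟨pr₀, sent₀, acks₀⟩
  · cases h
  · rcases onReply_busy (p := p) i j q a pr₀ sent₀ acks₀ with hreply | hreply
    · rw [hreply.2] at h
      cases pr₀ <;> first | exact not_ackedByQuorum_of_enter h | cases h
    · grind

lemma Step.not_ackedByQuorum_of_pongReceive (hs : Step p c (.pongReceive i j) c')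
    (hc : c.ResetFree p) (hcli' : c'.cli i = .busy pr sent acks) : ¬ AckedByQuorum p acks := by
  obtain ⟨q, a, hreply⟩ : ∃ q a, c'.cli i = onReply p i j q a (c.cli i) := by
    have := hs.cli_cases hc i
    grind
  exact not_ackedByQuorum_of_onReply (hreply.symm.trans hcli')

lemma Step.not_ackedByQuorum (hs : Step p c ev c') (hc : c.ResetFree p)
    (h : ∀ pr sent acks, c.cli i = .busy pr sent acks → ¬ AckedByQuorum p acks)
    (hcli' : c'.cli i = .busy pr sent acks) : ¬ AckedByQuorum p acks := by
  rcases hs.cli_cases hc i with heq | ⟨j, -, -, heq⟩ | ⟨j, -, q, a, -, -, heq⟩ | hidle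
  · exact h pr sent acks (heq.1.symm.trans hcli')
  · cases hcli : c.cli i <;> grind [Client.markSent]
  · exact not_ackedByQuorum_of_onReply (heq.symm.trans hcli')
  · rcases hidle.2.2.2 with ⟨s, henter⟩ | henter <;>
      exact not_ackedByQuorum_of_enter (henter.symm.trans hcli')

lemma Step.ping_of_request {q : Option (Req P W)} (hs : Step p c ev c') (hc : c.ResetFree p)
    (hlink : c.ping i j = .request q) (hev : ev ≠ .pingReceive i j) :
    c'.ping i j = .request q := by
  have := hs.ping_cases hc i j
  grind

lemma Step.ping_of_pingSend (hs : Step p c (.pingSend i j) c') (hc : c.ResetFree p)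
    (hproc : (c.cli i).proc = some pr) : c'.ping i j = .request (some (pr.req p j)) := by
  obtain ⟨sent, acks, hcli⟩ := Client.exists_busy hproc
  have := hs.ping_cases hc i j
  grind [Client.outgoing]

lemma Step.undelivered (hs : Step p c ev c') (hc : c.ResetFree p) (h : c.Undelivered p i pr)
    (hev : ∀ j ∈ p.servers, c.ping i j = .request (some (pr.req p j)) → ev ≠ .pingReceive i j) :
    c'.Undelivered p i pr := by
  obtain ⟨sent, acks, hcli, h⟩ := h
  have hlink : ∀ j ∈ p.servers, sent j = true → c'.ping i j = .request (some (pr.req p j)) :=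
    fun j hj hsent => hs.ping_of_request hc ((h j hj).2 hsent) (hev j hj ((h j hj).2 hsent))
  rcases hs.cli_cases hc i with heq | ⟨j, -, rfl, heq⟩ | ⟨j, hj, q, a, -, hreply, heq⟩ | hidle
  · exact ⟨sent, acks, heq.1.trans hcli, fun j hj => ⟨(h j hj).1, hlink j hj⟩⟩
  · refine ⟨Function.update sent j true, acks, by rw [heq, hcli]; rfl, fun k hk => ⟨(h k hk).1, ?_⟩⟩
    have := hs.ping_of_pingSend hc (pr := pr) (by rw [hcli]; rfl)
    grind [update_eq_ite]
  · have hacks : newAcks p j q a pr sent acks = acks := if_neg (by grind)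
    have hcli' := onReply_busy (p := p) i j q a pr sent acks
    rw [hacks] at hcli'
    refine ⟨sent, acks, ?_, fun j hj => ⟨(h j hj).1, hlink j hj⟩⟩
    have := AckedByQuorum.exists_ack (p := p) (acks := acks)
    grind
  · simp [hcli] at hidle

end ClientSteps

section CalmClients

variable {P W V : Type*} [Fintype P] [LinearOrder P] [Nonempty P] [DecidableEq W]
  {p : Setup P W V} {R : Execution p} {w : ℕ → ℕ} {B k : ℕ} {i : P} {pr : Proc P V}

lemma After.of_atClient (h : Calm R w B) {j : P} (hi : i ∈ p.clients) (hj : j ∈ p.servers)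
    {Q : ℕ → Prop} (hQ : ∀ n, w k ≤ n → n < B → Q n → Q (n + 1))
    (hat : ∀ n, w k ≤ n → n < B → (R.state n).ping i j = .atClient → Q n) :
    After w B (k + 1) Q := by
  refine After.of_cycle hQ fun hB => ?_
  obtain ⟨b₁, b₂, b₃, b₄, h₁, h₂, h₃, h₄, h₅, hsend, -⟩ := (h.cycle k).2 i hi j hj
  have hs := R.step b₁
  rw [hsend] at hs
  exact ⟨b₁, h₁, by omega, hat b₁ h₁ (by omega) hs.2.2.1⟩

namespace Calm

lemma acked (h : Calm R w B) (hB : w (k + 1) ≤ B) (hi : i ∈ p.clients) {j : P}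
    (hj : j ∈ p.servers)
    (hproc : ∀ n, w k ≤ n → n ≤ w (k + 1) → ((R.state n).cli i).proc = some pr)
    (htop : ∀ s, pr = .wQuery s → ∀ n, w k ≤ n → n ≤ w (k + 1) → R.top n j ≤ (p.tTop : Tag P)) :
    (R.state (w (k + 1))).Acked i j pr := by
  have hc : ∀ n, w k ≤ n → n < w (k + 1) → (R.state n).ResetFree p :=
    fun n hn hn' => h.resetFree n ((h.zero_le k).trans hn) (by omega)
  obtain ⟨b₁, b₂, b₃, b₄, h₁, h₂, h₃, h₄, h₅, hsend, -, -, hreceive⟩ := (h.cycle k).2 i hi j hj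
  have hunderway : (R.state b₄).Underway p i j pr := by
    refine segment_induction (x := b₁ + 1) (y := w (k + 1))
      (Q := fun n => (R.state n).Underway p i j pr) (fun n hn hn' => ?_) ?_ b₄ (by omega) h₅.le
    · exact fun hQ => (R.step n).underway (hc n (by omega) hn') (hproc (n + 1) (by omega) hn') hQ
        fun s hs => htop s hs (n + 1) (by omega) hn'
    · obtain ⟨sent, acks, hcli⟩ := Client.exists_busy (hproc b₁ h₁ (by omega))
      exact (hsend ▸ R.step b₁).underway_of_pingSend (hc b₁ h₁ (by omega)) hcli
  refine segment_induction (x := b₄ + 1) (Q := fun n => (R.state n).Acked i j pr)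
    (fun n hn hn' => ?_) ?_ _ h₅ le_rfl
  · exact (R.step n).acked (hc n (by omega) hn') (hproc (n + 1) (by omega) hn')
  · exact (hreceive ▸ R.step b₄).acked_of_pongReceive (hc b₄ (by omega) h₅)
      (hproc (b₄ + 1) (by omega) h₅) hunderway

lemma not_ackedByQuorum (h : Calm R w B) (hi : i ∈ p.clients) :
    After w B (k + 1) fun n => ∀ pr sent acks, (R.state n).cli i = .busy pr sent acks →
      ¬ AckedByQuorum p acks := by
  have hc : ∀ n, w k ≤ n → n < B → (R.state n).ResetFree p :=
    fun n hn hB => h.resetFree n ((h.zero_le k).trans hn) hB.le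
  refine After.of_cycle (fun n hn hB hQ _ _ _ => (R.step n).not_ackedByQuorum (hc n hn hB) hQ)
    fun hB => ?_
  obtain ⟨j, hj⟩ := p.servers_nonempty
  obtain ⟨b₁, b₂, b₃, b₄, h₁, h₂, h₃, h₄, h₅, -, -, -, hreceive⟩ := (h.cycle k).2 i hi j hj
  exact ⟨b₄ + 1, by omega, h₅, fun _ _ _ =>
    (hreceive ▸ R.step b₄).not_ackedByQuorum_of_pongReceive (hc b₄ (by omega) (by omega))⟩

lemma exists_advance (h : Calm R w B) (hB : w (k + 1) ≤ B) (hi : i ∈ p.clients)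
    (hproc : ((R.state (w k)).cli i).proc = some pr)
    (htop : ∀ s, pr = .wQuery s → ∀ n, w k ≤ n → n ≤ w (k + 1) → ∀ j ∈ p.servers,
      R.top n j ≤ (p.tTop : Tag P)) :
    ∃ n, w k ≤ n ∧ n < w (k + 1) ∧ ∃ sent acks acks', (R.state n).cli i = .busy pr sent acks ∧
      AckStep p (R.state n) i pr sent acks acks' ∧ AckedByQuorum p acks' ∧
      (R.state (n + 1)).cli i = .advance p i acks' pr := by
  by_contra hno
  have hstays : ∀ n, w k ≤ n → n ≤ w (k + 1) → ((R.state n).cli i).proc = some pr := by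
    refine segment_induction (fun n hn hn' hQ => ?_) hproc
    obtain ⟨sent, acks, hcli⟩ := Client.exists_busy hQ
    obtain ⟨acks', hack, ⟨sent', hbusy⟩ | hadvance⟩ :=
      (R.step n).cli_of_busy (h.resetFree n ((h.zero_le k).trans hn) (by omega)) hcli
    · rw [hbusy]
      rfl
    · exact absurd ⟨n, hn, hn', sent, acks, acks', hcli, hack, hadvance⟩ hno
  obtain ⟨sent, acks, hcli⟩ := Client.exists_busy (hstays _ (h.monotone (Nat.le_succ k)) le_rfl)
  refine h.not_ackedByQuorum hi _ le_rfl hB _ _ _ hcli (ackedByQuorum_of_forall fun j hj => ?_)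
  obtain ⟨sent', acks', hcli', hack⟩ :=
    h.acked hB hi hj hstays fun s hs n hn hn' => htop s hs n hn hn' j hj
  rw [hcli] at hcli'
  cases hcli'
  exact hack

lemma le_top_of_pingReceive (h : Calm R w B) {n m : ℕ} (hn : w 0 ≤ n) (hnm : n < m) (hB : m ≤ B)
    {j : P} (hev : R.event n = .pingReceive i j)
    (hlink : (R.state n).ping i j = .request (some (pr.req p j))) {t : Tag P} (ht : t ∈ pr.tags) :
    t ≤ R.top m j := by
  refine le_trans ?_ (h.top_mono (by omega) hnm hB j)
  have hping := (R.step n).ping_cases (h.resetFree n hn (by omega)) i j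
  have hstore : ((R.state (n + 1)).srv j).store =
      storeAfter ((R.state n).srv j).store (pr.req p j) := by
    grind
  rw [Execution.top, hstore]
  exact Req.le_maxPhase_storeAfter _ (by rwa [Proc.tags_req])

lemma exists_le_top_of_enter (h : Calm R w B) {x : ℕ} (hx : w 0 ≤ x) (hxk : x ≤ w k)
    (hB : w (k + 1) ≤ B) (hi : i ∈ p.clients) (hcli : (R.state x).cli i = .enter pr)
    {t : Tag P} (ht : t ∈ pr.tags) : ∃ j ∈ p.servers, t ≤ R.top (w (k + 1)) j := by
  by_contra! hno
  have hc : ∀ n, x ≤ n → n < w (k + 1) → (R.state n).ResetFree p :=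
    fun n hn hn' => h.resetFree n (hx.trans hn) (by omega)
  have hnot : ∀ n, x ≤ n → n < w (k + 1) → ∀ j ∈ p.servers,
      (R.state n).ping i j = .request (some (pr.req p j)) → R.event n ≠ .pingReceive i j :=
    fun n hn hn' j hj hlink hev =>
      (hno j hj).not_ge (h.le_top_of_pingReceive (hx.trans hn) hn' hB hev hlink ht)
  have hundelivered : ∀ n, x ≤ n → n ≤ w (k + 1) → (R.state n).Undelivered p i pr :=
    segment_induction (fun n hn hn' hQ => (R.step n).undelivered (hc n hn hn') hQ (hnot n hn hn'))
      (State.undelivered_of_enter hcli)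
  obtain ⟨j, hj⟩ := p.servers_nonempty
  obtain ⟨b₁, b₂, b₃, b₄, h₁, h₂, h₃, h₄, h₅, hsend, hreceive, -⟩ := (h.cycle k).2 i hi j hj
  refine hnot b₂ (by omega) (by omega) j hj ?_ hreceive
  refine segment_induction (x := b₁ + 1) (y := w (k + 1))
    (Q := fun n => (R.state n).ping i j = .request (some (pr.req p j)))
    (fun n hn hn' hQ => ?_) ?_ b₂ h₂ (by omega)
  · exact (R.step n).ping_of_request (hc n (by omega) hn') hQ (hnot n (by omega) hn' j hj hQ)
  · obtain ⟨sent, acks, hbusy, -⟩ := hundelivered b₁ (by omega) (by omega)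
    exact (hsend ▸ R.step b₁).ping_of_pingSend (hc b₁ (by omega) (by omega)) (by rw [hbusy]; rfl)

end Calm

end CalmClients

section Entry

variable {P W V : Type*} [Fintype P] [LinearOrder P] {p : Setup P W V}
  {c c' : State P W V} {ev : Event P V} {i : P}

/-- In state `c`, the client of `i` can begin phase `pr` as the start of a procedure, or as the next
phase of the current one when a reply arrives. -/
def State.CanEnter (p : Setup P W V) (c : State P W V) (i : P) (pr : Proc P V) : Prop :=
  (c.cli i = .idle ∧ ((∃ s, pr = .wQuery s) ∨ pr = .rQuery)) ∨
  ∃ pr₀ sent acks acks', c.cli i = .busy pr₀ sent acks ∧ AckStep p c i pr₀ sent acks acks' ∧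
    AckedByQuorum p acks' ∧ Client.advance p i acks' pr₀ = .enter pr

lemma Client.advance_eq_idle_or_enter (i : P) (acks : P → Option (Ack P W)) (pr : Proc P V) :
    Client.advance p i acks pr = .idle ∨ ∃ pr', Client.advance p i acks pr = .enter pr' := by
  cases pr <;> simp [Client.advance]

lemma Step.cli_of_busy_right [Nonempty P] [DecidableEq W] {pr : Proc P V} {sent : P → Bool}
    {acks : P → Option (Ack P W)} (hs : Step p c ev c') (hc : c.ResetFree p)
    (hcli' : c'.cli i = .busy pr sent acks) :
    (∃ sent₀ acks₀, c.cli i = .busy pr sent₀ acks₀ ∧ AckStep p c i pr sent₀ acks₀ acks) ∨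
      (c'.cli i = .enter pr ∧ c.CanEnter p i pr) := by
  rcases hcli : c.cli i with - | ⟨pr₀, sent₀, acks₀⟩
  · have := hs.cli_of_idle hc hcli
    grind [Client.enter, State.CanEnter]
  · obtain ⟨acks', hack, ⟨sent', hbusy⟩ | ⟨hquorum, hadvance⟩⟩ := hs.cli_of_busy hc hcli
    · rw [hbusy] at hcli'
      cases hcli'
      exact Or.inl ⟨sent₀, acks₀, rfl, hack⟩
    · have := Client.advance_eq_idle_or_enter (p := p) i acks' pr₀
      right
      grind [Client.enter, State.CanEnter]

end Entry

section CalmContents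

variable {P W V : Type*} [Fintype P] [LinearOrder P] [Nonempty P] [DecidableEq W]
  {p : Setup P W V} {R : Execution p} {w : ℕ → ℕ} {B k : ℕ} {i : P}

namespace Calm

lemma after_cli (h : Calm R w B) (hi : i ∈ p.clients) {Φ : ℕ → Client P W V → Prop}
    (hidle : ∀ n, Φ n .idle)
    (hbusy : ∀ n, w k ≤ n → n < B → ∀ pr sent acks sent' acks',
      (R.state n).cli i = .busy pr sent acks → AckStep p (R.state n) i pr sent acks acks' →
      Φ n (.busy pr sent acks) → Φ (n + 1) (.busy pr sent' acks'))
    (henter : ∀ n, w k ≤ n → n < B → ∀ pr, (R.state n).CanEnter p i pr →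
      (R.state (n + 1)).cli i = .enter pr → Φ (n + 1) (.enter pr))
    (hwriter : ∀ s sent acks, Φ (w k) (.busy (.wQuery s) sent acks) ∨
      ∀ n, w k ≤ n → n ≤ B → ∀ j ∈ p.servers, R.top n j ≤ (p.tTop : Tag P)) :
    After w B (k + 1) fun n => Φ n ((R.state n).cli i) := by
  refine After.of_cycle (fun n hn hB hΦ => ?_) fun hB => ?_
  · rcases hcli' : (R.state (n + 1)).cli i with - | ⟨pr, sent, acks⟩
    · exact hidle _
    · rcases (R.step n).cli_of_busy_right (h.resetFree n ((h.zero_le k).trans hn) hB.le) hcli' with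
        ⟨sent₀, acks₀, hcli, hack⟩ | ⟨hcli, hcan⟩
      · exact hbusy n hn hB _ _ _ _ _ hcli hack (hcli ▸ hΦ)
      · exact hcli' ▸ hcli ▸ henter n hn hB pr hcan hcli
  · have hk := (h.cycle k).lt
    by_cases hΦ : Φ (w k) ((R.state (w k)).cli i)
    · exact ⟨w k, le_rfl, hk.le, hΦ⟩
    rcases hcli : (R.state (w k)).cli i with - | ⟨pr, sent, acks⟩
    · exact absurd (hcli ▸ hidle (w k)) hΦ
    obtain ⟨n, hn, hn', sent', acks₀, acks', hcli₀, hack, hquorum, hadvance⟩ :=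
      h.exists_advance hB hi (pr := pr) (by rw [hcli]; rfl) fun s hs n hn hn' => by
        subst hs
        exact (hwriter s sent acks).resolve_left (hcli ▸ hΦ) n hn (hn'.trans hB)
    refine ⟨n + 1, by omega, hn', ?_⟩
    rcases Client.advance_eq_idle_or_enter (p := p) i acks' pr with hnext | ⟨pr', hnext⟩
    · exact hadvance ▸ hnext ▸ hidle (n + 1)
    · have hcli' := hadvance.trans hnext
      exact hcli' ▸ henter n hn (by omega) pr'
        (Or.inr ⟨pr, sent', acks₀, acks', hcli₀, hack, hquorum, hnext⟩) hcli'

lemma after_proc (h : Calm R w B) (hi : i ∈ p.clients) {Φ : ℕ → Proc P V → Prop}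
    (hΦ : ∀ n, w k ≤ n → n < B → ∀ pr, Φ n pr → Φ (n + 1) pr)
    (henter : ∀ n, w k ≤ n → n < B → ∀ pr, (R.state n).CanEnter p i pr →
      (R.state (n + 1)).cli i = .enter pr → Φ (n + 1) pr)
    (hwriter : ∀ s, Φ (w k) (.wQuery s) ∨
      ∀ n, w k ≤ n → n ≤ B → ∀ j ∈ p.servers, R.top n j ≤ (p.tTop : Tag P)) :
    After w B (k + 1) fun n => ∀ pr, ((R.state n).cli i).proc = some pr → Φ n pr := by
  refine h.after_cli hi (Φ := fun n cl => ∀ pr, cl.proc = some pr → Φ n pr) ?_ ?_ ?_ ?_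
  · intro n pr hpr
    cases hpr
  · intro n hn hB pr _ _ _ _ _ _ hpr pr' hpr'
    exact hΦ n hn hB pr' (hpr pr' hpr')
  · intro n hn hB pr hcan hcli pr' hpr'
    obtain rfl := Option.some.inj hpr'
    exact henter n hn hB pr hcan hcli
  · refine fun s _ _ => (hwriter s).imp_left ?_
    rintro hs - ⟨⟩
    exact hs

lemma after_request (h : Calm R w B) (hi : i ∈ p.clients) {j : P} (hj : j ∈ p.servers)
    {Φ : ℕ → Req P W → Prop} (hΦ : ∀ n, w k ≤ n → n < B → ∀ r, Φ n r → Φ (n + 1) r)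
    (hproc : After w B k fun n => ∀ pr, ((R.state n).cli i).proc = some pr → Φ n (pr.req p j)) :
    After w B (k + 1) fun n => ∀ r, (R.state n).ping i j = .request (some r) → Φ n r := by
  refine After.of_atClient h hi hj (fun n hn hB hQ r hlink' => hΦ n hn hB r ?_)
    fun n _ _ hat r hlink => by cases hat.symm.trans hlink
  have hping := (R.step n).ping_cases (h.resetFree n ((h.zero_le k).trans hn) hB.le) i j
  have hpr := hproc n hn hB.le
  cases hcli : (R.state n).cli i <;> grind [Client.outgoing, Client.proc]

lemma after_reply (h : Calm R w B) (hi : i ∈ p.clients) {j : P} (hj : j ∈ p.servers)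
    {Φ : ℕ → Option (Req P W) → Option (Ack P W) → Prop}
    (hΦ : ∀ n, w k ≤ n → n < B → ∀ q a, Φ n q a → Φ (n + 1) q a) (hnone : ∀ n, Φ n none none)
    (hreply : ∀ n, w k ≤ n → n < B → ∀ r a a',
      Replies p (storeAfter ((R.state n).srv j).store r) r a → a'.map Ack.tag = a.map Ack.tag →
      ((R.state (n + 1)).srv j).store = storeAfter ((R.state n).srv j).store r →
      Φ (n + 1) (some r) a') :
    After w B (k + 1) fun n => ∀ q a, ((R.state n).ping i j = .atServer q a ∨
      (R.state n).ping i j = .response q a) → Φ n q a := by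
  refine After.of_atClient h hi hj (fun n hn hB hQ q a hlink' => ?_)
    fun n _ _ hat q a hlink => by simp [hat] at hlink
  have hping := (R.step n).ping_cases (h.resetFree n ((h.zero_le k).trans hn) hB.le) i j
  grind [hΦ n hn hB, hreply n hn hB]

/-- The bound covers `acks'` rather than only `acks` because a client advances with the reply that
completes its quorum. -/
lemma after_acks (h : Calm R w B) (hi : i ∈ p.clients) {K : Proc P V → Prop} {Φ : ℕ → Tag P → Prop}
    (hΦ : ∀ n, w k ≤ n → n < B → ∀ t, Φ n t → Φ (n + 1) t)
    (hreply : ∀ j ∈ p.servers, After w B k fun n => ∀ pr, K pr → ∀ a,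
      (R.state n).ping i j = .response (some (pr.req p j)) (some a) → Φ n a.tag)
    (hwriter : ∀ s, K (.wQuery s) →
      ∀ n, w k ≤ n → n ≤ B → ∀ j ∈ p.servers, R.top n j ≤ (p.tTop : Tag P)) :
    After w B (k + 1) fun n => ∀ pr sent acks acks', K pr →
      (R.state n).cli i = .busy pr sent acks → AckStep p (R.state n) i pr sent acks acks' →
      ∀ j ∈ p.servers, ∀ a, acks' j = some a → Φ n a.tag := by
  have hstep : ∀ n, w k ≤ n → n ≤ B → ∀ pr sent acks acks', K pr →
      AckStep p (R.state n) i pr sent acks acks' →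
      (∀ j ∈ p.servers, ∀ a, acks j = some a → Φ n a.tag) →
      ∀ j ∈ p.servers, ∀ a, acks' j = some a → Φ n a.tag := by
    intro n hn hB pr sent acks acks' hK hack hacks j hj
    have := hack j
    have := hreply j hj n hn hB pr hK
    grind
  have hcollected := h.after_cli (k := k) hi (Φ := fun n cl => ∀ pr sent acks, K pr →
    cl = .busy pr sent acks → ∀ j ∈ p.servers, ∀ a, acks j = some a → Φ n a.tag) ?_ ?_ ?_ ?_
  · intro n hn hB pr sent acks acks' hK hcli hack
    exact hstep n ((h.monotone (Nat.le_succ k)).trans hn) hB pr sent acks acks' hK hack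
      (hcollected n hn hB pr sent acks hK hcli)
  · rintro - - - - - ⟨⟩
  · intro n hn hB pr sent acks _ acks' _ hack hacks _ _ _ hK hbusy j hj a ha
    cases hbusy
    exact hΦ n hn hB _ (hstep n hn hB.le pr sent acks acks' hK hack (hacks pr sent acks hK rfl)
      j hj a ha)
  · rintro n - - pr - - - - - - ⟨⟩ j - a ⟨⟩
  · intro s sent acks
    by_cases hK : K (.wQuery s)
    · exact Or.inr (hwriter s hK)
    · refine Or.inl ?_
      rintro - - - hK' ⟨⟩
      exact absurd hK' hK

end Calm

end CalmContents

section TagBounds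

variable {P W V : Type*}

section SettledTags

variable [LinearOrder P]

lemma Triple.le_top {m : Triple P} {t : Tag P} (ht : t ∈ m.tags) : t ≤ m.top := by
  rcases ht with rfl | rfl | rfl
  exacts [le_sup_of_le_left le_sup_left, le_sup_of_le_left le_sup_right, le_sup_right]

variable [Fintype P] {p : Setup P W V} {j : P} {s : Server P W}

lemma Settled.rx_top_le (h : Settled p j s) {k : P} (hk : k ∈ p.servers) :
    (s.rx k).top ≤ maxPhase s.store allPhases :=
  (h.top_le k hk).trans h.pre_le

lemma Settled.tx_top_le (h : Settled p j s) : s.tx.top ≤ maxPhase s.store allPhases :=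
  (sup_le (sup_le h.tx_pre.le (h.tx_fin.trans_le h.fin_le_pre))
    (h.tx_FIN_le.trans h.fin_le_pre)).trans h.pre_le

lemma Settled.tag_le (h : Settled p j s) {t : Tag P} (ht : t ∈ s.tags p) :
    t ≤ maxPhase s.store allPhases := by
  rcases ht with (⟨r, hr, rfl⟩ | ⟨k, hk, ht⟩) | ht
  · exact HasTag.le_maxPhase ⟨r, hr, by cases r.phase <;> decide, rfl⟩
  · exact (Triple.le_top ht).trans (h.rx_top_le hk)
  · exact (Triple.le_top ht).trans h.tx_top_le

end SettledTags

variable [Fintype P] [LinearOrder P] {p : Setup P W V}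

lemma Setup.tTop_lt_nextStamp [Nonempty P] (p : Setup P W V) (i : P) {t : Tag P}
    (ht : (p.tTop : Tag P) ≤ t) : p.tTop < nextStamp i t := by
  induction t using WithBot.recBotCoe with
  | bot => simp at ht
  | coe t =>
    have hle : p.maxInt ≤ (ofLex t).1 := Prod.Lex.monotone_fst_ofLex (WithBot.coe_le_coe.1 ht)
    exact Prod.Lex.toLex_lt_toLex.2 (Or.inl (hle.trans_lt (PNat.lt_add_right _ _)))

lemma le_maxAck {acks : P → Option (Ack P W)} {j : P} (hj : j ∈ p.servers) {a : Ack P W}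
    (ha : acks j = some a) : a.tag ≤ maxAck p acks := by
  have hle := Finset.le_sup (f := fun k => match acks k with
    | none => (⊥ : Tag P)
    | some a => a.tag) hj
  simp only [ha] at hle
  exact hle

end TagBounds

section Overflow

variable {P W V : Type*} [Fintype P] [LinearOrder P] [Nonempty P] [DecidableEq W]
  {p : Setup P W V} {R : Execution p} {w : ℕ → ℕ} {B k : ℕ} {v : Tag P}

namespace Calm

lemma gossip_tags_lt (h : Calm R w B)
    (htop : ∀ n, w 0 ≤ n → n ≤ B → ∀ j ∈ p.servers, R.top n j < v) {i j : P}
    (hi : i ∈ p.servers) (hj : j ∈ p.servers) (hij : i ≠ j) :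
    After w B 2 fun n => ∀ t ∈ ((R.state n).gossip i j).tags, t < v := by
  intro n hn hB t ht
  have hm := h.after_inTransit (k := 1) hi hj hij (Φ := fun _ m => m.top < v)
    (fun _ _ _ _ => id) (fun n hn hB => (h.settled n hn hB i hi).tx_top_le.trans_lt
      (htop n ((h.zero_le 1).trans hn) hB i hi)) n hn hB
  rcases hlink : (R.state n).gossip i j with - | m <;> rw [hlink] at ht
  · exact ht.elim
  · obtain ⟨m, rfl, ht⟩ := ht
    exact (Triple.le_top ht).trans_lt (hm m hlink)

lemma payloadTags_lt (h : Calm R w B)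
    (htop : ∀ n, w 0 ≤ n → n ≤ B → ∀ j ∈ p.servers, R.top n j < v) {i j : P}
    (hi : i ∈ p.clients) (hj : j ∈ p.servers) :
    After w B 1 fun n => ∀ q a, ((R.state n).ping i j = .atServer q a ∨
      (R.state n).ping i j = .response q a) → ∀ t ∈ payloadTags q a, t < v := by
  refine h.after_reply (k := 0) hi hj (Φ := fun _ q a => ∀ t ∈ payloadTags q a, t < v)
    (fun _ _ _ _ _ => id) (fun _ => by simp [payloadTags]) ?_
  intro n hn hB r a a' hreply htag hstore t ht
  have hv := htop (n + 1) (hn.trans (Nat.le_succ n)) hB j hj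
  rw [Execution.top, hstore] at hv
  refine lt_of_le_of_lt ?_ hv
  rcases ht with ⟨r', hr', ht⟩ | ⟨b', rfl, rfl⟩
  · cases hr'
    exact Req.le_maxPhase_storeAfter _ ht
  · obtain ⟨b, rfl, hb⟩ := Option.map_eq_some_iff.1 htag.symm
    exact hb ▸ hreply.tag_le

lemma ack_tags_lt (h : Calm R w B)
    (htop : ∀ n, w 0 ≤ n → n ≤ B → ∀ j ∈ p.servers, R.top n j < (p.tTop : Tag P)) {i : P}
    (hi : i ∈ p.clients) :
    After w B 2 fun n => ∀ pr sent acks, (R.state n).cli i = .busy pr sent acks →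
      ∀ j ∈ p.servers, ∀ a, acks j = some a → a.tag < (p.tTop : Tag P) := by
  have hacks := h.after_acks (k := 1) hi (K := fun _ => True)
    (Φ := fun _ t => t < (p.tTop : Tag P)) (fun _ _ _ _ => id)
    (fun j hj n hn hB pr _ a hlink =>
      h.payloadTags_lt htop hi hj n hn hB _ _ (Or.inr hlink) _ (Or.inr ⟨a, rfl, rfl⟩))
    (fun _ _ n hn hB j hj => (htop n ((h.zero_le 1).trans hn) hB j hj).le)
  exact fun n hn hB pr sent acks hcli => hacks n hn hB pr sent acks acks trivial hcli .refl

lemma enter_tags_lt (h : Calm R w B) (hB : w (k + 1) ≤ B)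
    (htop : ∀ n, w 0 ≤ n → n ≤ B → ∀ j ∈ p.servers, R.top n j < v) {i : P} (hi : i ∈ p.clients)
    {n : ℕ} (hn : w 0 ≤ n) (hnk : n ≤ w k) {pr : Proc P V} (hcli : (R.state n).cli i = .enter pr)
    {t : Tag P} (ht : t ∈ pr.tags) : t < v := by
  obtain ⟨j, hj, hle⟩ := h.exists_le_top_of_enter hn hnk hB hi hcli ht
  exact hle.trans_lt (htop _ (h.zero_le _) hB j hj)

lemma proc_tags_lt (h : Calm R w B) (hB : w 5 ≤ B)
    (htop : ∀ n, w 0 ≤ n → n ≤ B → ∀ j ∈ p.servers, R.top n j < (p.tTop : Tag P)) {i : P}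
    (hi : i ∈ p.clients) :
    After w (w 4) 3 fun n => ∀ pr, ((R.state n).cli i).proc = some pr →
      ∀ t ∈ pr.tags, t < (p.tTop : Tag P) := by
  have hB₄ : w 4 ≤ B := (h.monotone (Nat.le_succ 4)).trans hB
  refine (h.restrict hB₄).after_proc (k := 2) hi
    (Φ := fun _ pr => ∀ t ∈ pr.tags, t < (p.tTop : Tag P)) (fun _ _ _ _ => id) ?_
    fun _ => Or.inr fun n hn hn' j hj => (htop n ((h.zero_le 2).trans hn) (hn'.trans hB₄) j hj).le
  exact fun n hn hn' pr _ hcli t =>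
    h.enter_tags_lt (k := 4) hB htop hi ((h.zero_le 2).trans (hn.trans (Nat.le_succ n))) hn' hcli

lemma request_tags_lt (h : Calm R w B) (hB : w 5 ≤ B)
    (htop : ∀ n, w 0 ≤ n → n ≤ B → ∀ j ∈ p.servers, R.top n j < (p.tTop : Tag P)) {i j : P}
    (hi : i ∈ p.clients) (hj : j ∈ p.servers) {r : Req P W}
    (hlink : (R.state (w 4)).ping i j = .request (some r)) {t : Tag P} (ht : t ∈ r.tags) :
    t < (p.tTop : Tag P) := by
  have hB₄ : w 4 ≤ B := (h.monotone (Nat.le_succ 4)).trans hB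
  refine (h.restrict hB₄).after_request (k := 3) hi hj
    (Φ := fun _ r => ∀ t ∈ r.tags, t < (p.tTop : Tag P)) (fun _ _ _ _ => id) ?_ (w 4) le_rfl le_rfl
    r hlink t ht
  intro n hn hn' pr hpr
  rw [Proc.tags_req]
  exact h.proc_tags_lt hB htop hi n hn hn' pr hpr

lemma overflowFree (h : Calm R w B) (hB : w 5 ≤ B)
    (htop : ∀ n, w 0 ≤ n → n ≤ B → ∀ j ∈ p.servers, R.top n j < (p.tTop : Tag P)) :
    (R.state (w 4)).OverflowFree p := by
  have hB₄ : w 4 ≤ B := (h.monotone (Nat.le_succ 4)).trans hB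
  have hk : ∀ k ≤ 4, w k ≤ w 4 := fun k hk => h.monotone hk
  rintro t (⟨i, hi, ht⟩ | ⟨i, hi, ht⟩ | ⟨i, hi, j, hj, hij, ht⟩ | ⟨i, hi, j, hj, ht⟩)
  · exact ((h.settled (w 4) (hk 1 (by omega)) hB₄ i hi).tag_le ht).trans_lt
      (htop _ (h.zero_le 4) hB₄ i hi)
  · rcases hcli : (R.state (w 4)).cli i with - | ⟨pr, sent, acks⟩ <;> rw [hcli] at ht
    · exact ht.elim
    · rcases ht with ht | ⟨j, hj, a, ha, rfl⟩
      · exact h.proc_tags_lt hB htop hi (w 4) (hk 3 (by omega)) le_rfl pr (by rw [hcli]; rfl) t ht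
      · exact h.ack_tags_lt htop hi (w 4) (hk 2 (by omega)) hB₄ pr sent acks hcli j hj a ha
  · exact h.gossip_tags_lt htop hi hj hij (w 4) (hk 2 (by omega)) hB₄ t ht
  · have hreply := h.payloadTags_lt htop hi hj (w 4) (hk 1 (by omega)) hB₄
    rcases hlink : (R.state (w 4)).ping i j with - | q | ⟨q, a⟩ | ⟨q, a⟩ <;> rw [hlink] at ht
    · exact ht.elim
    · rcases ht with ⟨r, rfl, ht⟩ | ⟨a, ha, -⟩
      · exact h.request_tags_lt hB htop hi hj hlink ht
      · cases ha
    · exact hreply q a (Or.inl hlink) t ht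
    · exact hreply q a (Or.inr hlink) t ht

end Calm

end Overflow

section Quiet

variable {P W V : Type*} [Fintype P] [LinearOrder P] [Nonempty P] [DecidableEq W]
  {p : Setup P W V} {R : Execution p} {w : ℕ → ℕ} {B k : ℕ} {i : P}

/-- No writer moves on from its query to the pre-write in the steps `x, …, y - 1`. -/
def Quiet (R : Execution p) (x y : ℕ) : Prop :=
  ∀ n, x ≤ n → n < y → ∀ i ∈ p.clients, ∀ t s,
    ((R.state (n + 1)).cli i).proc = some (.wPre t s) → ((R.state n).cli i).proc = some (.wPre t s)

lemma Step.enters_wPre {c c' : State P W V} {ev : Event P V} {t : Stamp P} {s : V}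
    (hs : Step p c ev c') (hc : c.ResetFree p) (hproc' : (c'.cli i).proc = some (.wPre t s))
    (hproc : (c.cli i).proc ≠ some (.wPre t s)) :
    c'.cli i = .enter (.wPre t s) ∧ ∃ sent acks acks', c.cli i = .busy (.wQuery s) sent acks ∧
      AckStep p c i (.wQuery s) sent acks acks' ∧ AckedByQuorum p acks' ∧
      t = nextStamp i (maxAck p acks') := by
  obtain ⟨sent, acks, hcli'⟩ := Client.exists_busy hproc'
  rcases hs.cli_of_busy_right hc hcli' with ⟨sent₀, acks₀, hcli, -⟩ | ⟨henter, ⟨-, hpr⟩ | hcan⟩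
  · exact absurd (by rw [hcli]; rfl) hproc
  · simp at hpr
  · obtain ⟨pr₀, sent, acks, acks', hcli, hack, hquorum, hadvance⟩ := hcan
    cases pr₀ <;> cases hadvance
    exact ⟨henter, sent, acks, acks', hcli, hack, hquorum, rfl⟩

namespace Calm

lemma tTop_le_ack (h : Calm R w B)
    (htop : ∀ n, w 0 ≤ n → n ≤ B → ∀ j ∈ p.servers, R.top n j = (p.tTop : Tag P))
    (hi : i ∈ p.clients) :
    After w B 2 fun n => ∀ s sent acks acks', (R.state n).cli i = .busy (.wQuery s) sent acks →
      AckStep p (R.state n) i (.wQuery s) sent acks acks' →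
      ∀ j ∈ p.servers, ∀ a, acks' j = some a → (p.tTop : Tag P) ≤ a.tag := by
  have hreply : ∀ j ∈ p.servers, ∀ n, w 0 ≤ n → n < B → ∀ (r : Req P W) (a a' : Option (Ack P W)),
      Replies p (storeAfter ((R.state n).srv j).store r) r a → a'.map Ack.tag = a.map Ack.tag →
      ((R.state (n + 1)).srv j).store = storeAfter ((R.state n).srv j).store r →
      some r = some (.query false) → ∀ b, a' = some b → (p.tTop : Tag P) ≤ b.tag := by
    rintro j hj n hn hn' r a _ hreply htag - ⟨⟩ b rfl
    obtain ⟨b', rfl, hb⟩ := Option.map_eq_some_iff.1 htag.symm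
    rw [← hb, hreply.tag_eq_of_writer]
    exact (htop n hn hn'.le j hj).ge
  have hacks := h.after_acks (k := 1) hi (K := fun pr => ∃ s, pr = .wQuery s)
    (Φ := fun _ t => (p.tTop : Tag P) ≤ t) (fun _ _ _ _ => id) ?_
    fun _ _ n hn hn' j hj => (htop n ((h.zero_le 1).trans hn) hn' j hj).le
  · exact fun n hn hn' s sent acks acks' => hacks n hn hn' _ sent acks acks' ⟨s, rfl⟩
  · rintro j hj n hn hn' - ⟨s, rfl⟩ a hlink
    exact h.after_reply (k := 0) hi hj (Φ := fun _ q a => q = some (.query false) →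
      ∀ b, a = some b → (p.tTop : Tag P) ≤ b.tag) (fun _ _ _ _ _ => id) (fun _ _ _ => nofun)
      (hreply j hj) n hn hn' _ _ (Or.inr hlink) rfl a rfl

lemma quiet_of_top_eq (h : Calm R w B) (hB : w (k + 1) ≤ B)
    (htop : ∀ n, w 0 ≤ n → n ≤ B → ∀ j ∈ p.servers, R.top n j = (p.tTop : Tag P)) :
    Quiet R (w 2) (w k) := by
  intro n hn hn' i hi t s hproc'
  by_contra hproc
  have hwk : w k ≤ w (k + 1) := h.monotone (Nat.le_succ k)
  have hn₀ := (h.zero_le 2).trans hn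
  obtain ⟨henter, sent, acks, acks', hcli, hstep, hquorum, rfl⟩ :=
    (R.step n).enters_wPre (h.resetFree n hn₀ (by omega)) hproc' hproc
  obtain ⟨j, hj, a, ha⟩ := hquorum.exists_ack
  have hmax : (p.tTop : Tag P) ≤ maxAck p acks' :=
    (h.tTop_le_ack htop hi n hn (by omega) s sent acks acks' hcli hstep j hj a ha).trans
      (le_maxAck hj ha)
  obtain ⟨l, hl, hle⟩ := h.exists_le_top_of_enter (by omega) hn' hB hi henter
    (t := (nextStamp i (maxAck p acks') : Tag P)) rfl
  rw [htop _ (h.zero_le _) hB l hl, WithBot.coe_le_coe] at hle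
  exact hle.not_gt (p.tTop_lt_nextStamp i hmax)

lemma reply_eq_none (h : Calm R w B)
    (htop : ∀ n, w 0 ≤ n → n ≤ B → ∀ j ∈ p.servers, (p.tTop : Tag P) < R.top n j)
    (hi : i ∈ p.clients) {j : P} (hj : j ∈ p.servers) :
    After w B 1 fun n => ∀ a, (R.state n).ping i j = .response (some (.query false)) a →
      a = none := by
  have hreply := h.after_reply (k := 0) hi hj
    (Φ := fun _ q a => q = some (.query false) → a = none) (fun _ _ _ _ _ => id) (fun _ _ => rfl) ?_
  · exact fun n hn hn' a hlink => hreply n hn hn' _ a (Or.inr hlink) rfl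
  · rintro n hn hn' r a a' hreply htag - ⟨⟩
    cases a with
    | none => exact Option.map_eq_none_iff.1 htag
    | some b => exact absurd hreply.maxPhase_le_tTop (htop n hn hn'.le j hj).not_ge

lemma quiet_of_lt_top (h : Calm R w B)
    (htop : ∀ n, w 0 ≤ n → n ≤ B → ∀ j ∈ p.servers, (p.tTop : Tag P) < R.top n j) :
    Quiet R (w 2) B := by
  intro n hn hn' i hi t s hproc'
  by_contra hproc
  have hn₁ : w 1 ≤ n := (h.monotone (Nat.le_succ 1)).trans hn
  obtain ⟨-, sent, acks, acks', hcli, hstep, hquorum, -⟩ :=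
    (R.step n).enters_wPre (h.resetFree n ((h.zero_le 2).trans hn) hn'.le) hproc' hproc
  have hacks : ∀ j ∈ p.servers, acks' j = acks j := by
    intro j hj
    refine (hstep j).resolve_right ?_
    rintro ⟨-, a, hlink, -⟩
    cases h.reply_eq_none htop hi hj n hn₁ hn'.le _ hlink
  refine h.not_ackedByQuorum (k := 1) hi n hn hn'.le _ _ _ hcli ?_
  rwa [AckedByQuorum, Finset.filter_congr fun j hj => by rw [hacks j hj]] at hquorum

end Calm

end Quiet

section Level

variable {P W V : Type*}

/-- The number of quorum accesses that a writer has to end after its query. -/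
def Proc.level : Proc P V → ℕ
  | .wPre _ _ => 3
  | .wFin _ => 2
  | .wFIN _ => 1
  | _ => 0

lemma Proc.level_le (pr : Proc P V) : pr.level ≤ 3 := by
  cases pr <;> simp [Proc.level]

/-- A mild request is one that no writer sends after its query. -/
def Req.IsMild (r : Req P W) : Prop :=
  (∃ reader, r = .query reader) ∨ ∃ t, r = .finalize true t false

lemma Proc.isMild_req [Fintype P] [LinearOrder P] {p : Setup P W V} {pr : Proc P V}
    (h : pr.level = 0) (j : P) : (pr.req p j).IsMild := by
  cases pr <;> simp_all [Proc.level, Proc.req, Req.IsMild]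

lemma Req.IsMild.hasTag_storeAfter [LinearOrder P] [DecidableEq W] {r : Req P W} (h : r.IsMild)
    {S : Finset (Record P W)} {t : Tag P} (ht : HasTag S finPhases t) :
    HasTag (storeAfter S r) finPhases t := by
  rcases h with ⟨reader, rfl⟩ | ⟨t', rfl⟩
  exacts [ht, ht.updatePhase_of_ne_pre (by decide)]

lemma Req.IsMild.hasTag_of_storeAfter [LinearOrder P] [DecidableEq W] {r : Req P W}
    (h : r.IsMild) {S : Finset (Record P W)} {t : Tag P}
    (ht : HasTag (storeAfter S r) finPhases t) :
    HasTag S finPhases t ∨ r = .finalize true t false := by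
  rcases h with ⟨reader, rfl⟩ | ⟨t', rfl⟩
  · exact Or.inl ht
  · by_cases heq : t = t'
    · exact Or.inr (heq ▸ rfl)
    · exact Or.inl ((hasTag_updatePhase_of_ne none _ heq).1 ht)

lemma Client.level_of_advance [Fintype P] [LinearOrder P] [Nonempty P] {p : Setup P W V} {i : P}
    {acks : P → Option (Ack P W)} {pr pr' : Proc P V}
    (h : Client.advance p i acks pr = .enter pr') :
    (∃ t s, pr = .wQuery s ∧ pr' = .wPre t s) ∨ pr'.level ≤ pr.level - 1 := by
  cases pr <;> cases h <;> simp [Proc.level]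

end Level

section Stabilization

variable {P W V : Type*} [Fintype P] [LinearOrder P] [Nonempty P] [DecidableEq W]
  {p : Setup P W V} {R : Execution p} {w : ℕ → ℕ} {B : ℕ} {i j : P}

namespace Calm

lemma level_le (h : Calm R w B) (hq : Quiet R (w 0) B) (hi : i ∈ p.clients) (l : ℕ) :
    After w B l fun n => ∀ pr, ((R.state n).cli i).proc = some pr → pr.level ≤ 3 - l := by
  induction l with
  | zero => exact fun n _ _ pr _ => pr.level_le
  | succ l ih =>
    refine h.after_proc hi (Φ := fun _ pr => pr.level ≤ 3 - (l + 1)) (fun _ _ _ _ => id) ?_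
      fun s => Or.inl (Nat.zero_le _)
    rintro n hn hn' pr (⟨-, ⟨s, rfl⟩ | rfl⟩ | ⟨pr₀, sent, acks, acks', hcli, -, -, hadvance⟩) henter
    · exact Nat.zero_le _
    · exact Nat.zero_le _
    · have hproc : ((R.state n).cli i).proc = some pr₀ := by rw [hcli]; rfl
      rcases Client.level_of_advance hadvance with ⟨t, s, rfl, rfl⟩ | hlevel
      · have hquiet := hq n ((h.zero_le l).trans hn) hn' i hi t s (by rw [henter]; rfl)
        rw [hproc] at hquiet
        cases hquiet
      · have hpr₀ := ih n hn hn'.le pr₀ hproc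
        omega

lemma isMild (h : Calm R w B) (hq : Quiet R (w 0) B) (hi : i ∈ p.clients) (hj : j ∈ p.servers) :
    After w B 4 fun n => ∀ r, (R.state n).ping i j = .request (some r) → r.IsMild :=
  h.after_request (k := 3) hi hj (Φ := fun _ r => r.IsMild) (fun _ _ _ _ => id)
    fun n hn hn' pr hpr => Proc.isMild_req (Nat.le_zero.1 (h.level_le hq hi 3 n hn hn' pr hpr)) j

lemma after_reader_reply (h : Calm R w B) {Φ : ℕ → Tag P → Prop}
    (hΦ : ∀ n, w 0 ≤ n → n < B → ∀ t, Φ n t → Φ (n + 1) t) (hi : i ∈ p.clients)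
    (hj : j ∈ p.servers)
    (hfin : ∀ n, w 0 ≤ n → n ≤ B → Φ n (maxPhase ((R.state n).srv j).store finPhases)) :
    After w B 1 fun n => ∀ a,
      (R.state n).ping i j = .response (some (.query true)) (some a) → Φ n a.tag := by
  intro n hn hn' a hlink
  refine h.after_reply (k := 0) hi hj (Φ := fun n q a => q = some (.query true) →
    ∀ b, a = some b → Φ n b.tag) ?_ (fun _ _ _ => nofun) ?_ n hn hn' _ _ (Or.inr hlink) rfl a rfl
  · exact fun n hn hn' _ _ hqa hq a ha => hΦ n hn hn' _ (hqa hq a ha)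
  · rintro n hn hn' r a - hreply htag - ⟨⟩ b rfl
    obtain ⟨b', rfl, hb⟩ := Option.map_eq_some_iff.1 htag.symm
    rw [← hb, hreply.tag_eq_of_reader]
    exact hΦ n hn hn' _ (hfin n hn hn'.le)

/-- The tag of a reader is the supremum of tags that servers reported as finalized, so it inherits
what `Φ` says about these. -/
lemma after_reader (h : Calm R w B) {Φ : ℕ → Tag P → Prop}
    (hΦ : ∀ n, w 0 ≤ n → n < B → ∀ t, Φ n t → Φ (n + 1) t)
    (hbot : ∀ n, Φ n ⊥) (hsup : ∀ n s t, Φ n s → Φ n t → Φ n (s ⊔ t))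
    (hfin : ∀ n, w 0 ≤ n → n ≤ B → ∀ j ∈ p.servers,
      Φ n (maxPhase ((R.state n).srv j).store finPhases)) (hi : i ∈ p.clients)
    (hj : j ∈ p.servers) :
    After w B 4 fun n => ∀ t, (R.state n).ping i j = .request (some (.finalize true t false)) →
      Φ n t := by
  have hreply : ∀ j ∈ p.servers, After w B 1 fun n => ∀ pr : Proc P V, pr = .rQuery → ∀ a,
      (R.state n).ping i j = .response (some (pr.req p j)) (some a) → Φ n a.tag := by
    rintro j hj n hn hn' - rfl
    exact h.after_reader_reply hΦ hi hj (fun n hn hn' => hfin n hn hn' j hj) n hn hn'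
  have hacks := h.after_acks (k := 1) hi (K := fun pr => pr = .rQuery) (Φ := Φ)
    (fun n hn => hΦ n ((h.zero_le 1).trans hn)) hreply nofun
  have hproc := h.after_proc (k := 2) hi (Φ := fun n pr => ∀ t, pr = .rFin t → Φ n t)
    (fun n hn hn' _ hpr t ht => hΦ n ((h.zero_le 2).trans hn) hn' t (hpr t ht)) ?_
    fun _ => Or.inl nofun
  · refine fun n hn hn' t hlink => h.after_request (k := 3) hi hj
      (Φ := fun n r => ∀ t, r = .finalize true t false → Φ n t) ?_ ?_ n hn hn' _ hlink t rfl
    · exact fun n hn hn' _ hr t ht => hΦ n ((h.zero_le 3).trans hn) hn' t (hr t ht)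
    · intro n hn hn' pr hpr t ht
      refine hproc n hn hn' pr hpr t ?_
      cases pr <;> cases ht
      rfl
  · intro n hn hn' pr hcases henter t ht
    subst ht
    rcases hcases with ⟨-, ⟨s, hs⟩ | hs⟩ | ⟨pr₀, sent, acks, acks', hcli, hack, -, hadvance⟩
    · cases hs
    · cases hs
    · cases pr₀ <;> cases hadvance
      refine hΦ n ((h.zero_le 2).trans hn) hn' _ (Finset.sup_induction (hbot n)
        (fun s hs t ht => hsup n s t hs ht) fun k hk => ?_)
      rcases hak : acks' k with - | a
      · exact hbot n
      · exact hacks n hn hn'.le _ sent acks acks' rfl hcli hack k hk a hak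

end Calm

/-- The largest tag stored by a server. -/
def Execution.maxTop (R : Execution p) (n : ℕ) : Tag P := p.servers.sup (R.top n)

lemma Execution.top_le_maxTop (R : Execution p) (n : ℕ) (hj : j ∈ p.servers) :
    R.top n j ≤ R.maxTop n :=
  Finset.le_sup (f := R.top n) hj

namespace Calm

lemma maxTop_mono (h : Calm R w B) {n m : ℕ} (hn : w 0 ≤ n) (hnm : n ≤ m) (hB : m ≤ B) :
    R.maxTop n ≤ R.maxTop m :=
  Finset.sup_le fun j hj => (h.top_mono hn hnm hB j).trans (R.top_le_maxTop m hj)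

lemma inTransit_top_le_maxTop (h : Calm R w B) (hi : i ∈ p.servers) (hj : j ∈ p.servers)
    (hij : i ≠ j) :
    After w B 2 fun n => ∀ m, (R.state n).gossip i j = .inTransit (some m) →
      m.top ≤ R.maxTop n :=
  h.after_inTransit (k := 1) hi hj hij (Φ := fun n m => m.top ≤ R.maxTop n)
    (fun n hn hB _ hm => hm.trans (h.maxTop_mono ((h.zero_le 1).trans hn) n.le_succ hB))
    fun n hn hB => (h.settled n hn hB i hi).tx_top_le.trans (R.top_le_maxTop n hi)

lemma finalize_le_maxTop (h : Calm R w B) (hi : i ∈ p.clients) (hj : j ∈ p.servers) :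
    After w B 4 fun n => ∀ t, (R.state n).ping i j = .request (some (.finalize true t false)) →
      t ≤ R.maxTop n :=
  h.after_reader (Φ := fun n t => t ≤ R.maxTop n)
    (fun n hn hB _ ht => ht.trans (h.maxTop_mono hn n.le_succ hB)) (fun _ => bot_le)
    (fun _ _ _ => sup_le)
    (fun n _ _ _ hj =>
      (maxPhase_mono _ finPhases_subset_allPhases).trans (R.top_le_maxTop n hj)) hi hj

lemma maxTop_eq (h : Calm R w B) (hq : Quiet R (w 0) B) :
    After w B 4 fun n => R.maxTop n = R.maxTop (w 4) := by
  refine segment_induction (Q := fun n => R.maxTop n = R.maxTop (w 4)) (fun n hn hB hQ => ?_) rfl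
  have hn₀ := (h.zero_le 4).trans hn
  rw [← hQ]
  refine le_antisymm (Finset.sup_le fun j hj => ?_) (h.maxTop_mono hn₀ n.le_succ hB)
  have hsettled := h.settled.shift h (show 1 ≤ 4 by omega) n hn hB.le j hj
  have hc := h.resetFree n hn₀ hB.le
  rcases (R.step n).srv_cases hc j with heq | ⟨i, m, -, hi, hij, hm, heq⟩ | ⟨i, r, hi, hlink, heq⟩
  · rw [Execution.top, heq]
    exact R.top_le_maxTop n hj
  · rw [Execution.top, heq, maxPhase_allPhases_onGossip]
    refine gossipPre_le (fun k hk => ?_) (R.top_le_maxTop n hj)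
    by_cases hki : k = i
    · rw [hki, Function.update_self]
      exact (h.inTransit_top_le_maxTop hi hj hij).shift h (by omega) n hn hB.le m hm
    · rw [Function.update_of_ne hki]
      exact (hsettled.rx_top_le hk).trans (R.top_le_maxTop n hj)
  · rw [Execution.top, heq]
    refine maxPhase_storeAfter_le (R.top_le_maxTop n hj) fun t ht => ?_
    rcases h.isMild hq hi hj n hn hB.le r hlink with ⟨reader, rfl⟩ | ⟨s, rfl⟩
    · exact absurd ht id
    · obtain rfl : t = s := ht
      exact h.finalize_le_maxTop hi hj n hn hB.le t hlink

end Calm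

/-- All servers have the same largest tag `M`, and writers are not active beyond their queries. -/
structure Stable (R : Execution p) (w : ℕ → ℕ) (B : ℕ) (M : Tag P) : Prop where
  calm : Calm R w B
  top : ∀ n, w 0 ≤ n → n ≤ B → ∀ j ∈ p.servers, R.top n j = M
  settled : ∀ n, w 0 ≤ n → n ≤ B → ∀ j ∈ p.servers, Settled p j ((R.state n).srv j)
  mild : ∀ n, w 0 ≤ n → n ≤ B → ∀ i ∈ p.clients, ∀ j ∈ p.servers, ∀ r,
    (R.state n).ping i j = .request (some r) → r.IsMild

lemma Calm.stable (h : Calm R w B) (hq : Quiet R (w 0) B) :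
    Stable R (fun k => w (k + 8)) B (R.maxTop (w 4)) where
  calm := h.drop 8
  top n hn hB j hj := by
    rw [Nat.zero_add] at hn
    obtain ⟨i, hi, heq⟩ := Finset.exists_mem_eq_sup p.servers p.servers_nonempty (R.top (w 4))
    refine le_antisymm ?_ (h.le_top_after (k := 4) hi heq.le n hn hB j hj)
    rw [← (h.maxTop_eq hq).shift h (show 4 ≤ 8 by omega) n hn hB]
    exact R.top_le_maxTop n hj
  settled n hn := h.settled n ((h.monotone (by omega)).trans hn)
  mild n hn hB i hi j hj := h.isMild hq hi hj n ((h.monotone (by omega)).trans hn) hB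

namespace Stable

variable {M : Tag P}

lemma drop (h : Stable R w B M) (c : ℕ) : Stable R (fun k => w (k + c)) B M where
  calm := h.calm.drop c
  top n hn := h.top n ((h.calm.zero_le _).trans hn)
  settled n hn := h.settled n ((h.calm.zero_le _).trans hn)
  mild n hn := h.mild n ((h.calm.zero_le _).trans hn)

lemma restrict (h : Stable R w B M) {B' : ℕ} (hB : B' ≤ B) : Stable R w B' M where
  calm := h.calm.restrict hB
  top n hn hn' := h.top n hn (hn'.trans hB)
  settled n hn hn' := h.settled n hn (hn'.trans hB)
  mild n hn hn' := h.mild n hn (hn'.trans hB)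

end Stable

end Stabilization

section Fins

variable {P W V : Type*} [Fintype P] [LinearOrder P] [Nonempty P] [DecidableEq W]
  {p : Setup P W V} {R : Execution p} {w : ℕ → ℕ} {B n : ℕ} {i j : P} {M : Tag P}

/-- The largest finalized tag that the server of `j` does not forget.  The tag `M` of all
servers is left out unless `fin[j]` has it, because `updatePhase(M, ⊥, pre)` discards the phase of a
record of tag `M` without coded element. -/
def Execution.fins (R : Execution p) (M : Tag P) (n : ℕ) (j : P) : Tag P :=
  (R.rx n j j).fin ⊔ maxFinNe ((R.state n).srv j).store M

/-- The largest finalized tag that some server does not forget. -/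
def Execution.maxFins (R : Execution p) (M : Tag P) (n : ℕ) : Tag P := p.servers.sup (R.fins M n)

lemma Execution.fins_le_maxFins (R : Execution p) (M : Tag P) (n : ℕ) (hj : j ∈ p.servers) :
    R.fins M n j ≤ R.maxFins M n :=
  Finset.le_sup (f := R.fins M n) hj

lemma Execution.fins_congr {n m : ℕ} (h : (R.state n).srv j = (R.state m).srv j) :
    R.fins M n j = R.fins M m j := by
  simp only [Execution.fins, Execution.rx, h]

lemma Execution.fins_of_onGossip {m : Triple P} {s : Server P W}
    (h : (R.state n).srv j = (onGossip p j s i m).1) :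
    R.fins M n j = gossipFin p (Function.update s.rx i m) s.store := by
  rw [Execution.fins, Execution.rx, h, onGossip_rx_self, sup_eq_left,
    ← maxPhase_finPhases_onGossip p j s i m]
  exact maxFinNe_le_maxPhase _ _

namespace Stable

lemma gossipPre_eq (h : Stable R w B M) (hn : w 0 ≤ n) (hB : n < B) (hj : j ∈ p.servers)
    {m : Triple P} {s : Server P W} (heq : (R.state (n + 1)).srv j = (onGossip p j s i m).1) :
    gossipPre p (Function.update s.rx i m) s.store = M := by
  rw [← h.top (n + 1) (hn.trans n.le_succ) hB j hj, Execution.top, heq,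
    maxPhase_allPhases_onGossip]

lemma fins_le_succ (h : Stable R w B M) (hn : w 0 ≤ n) (hB : n < B) (hj : j ∈ p.servers) :
    R.fins M n j ≤ R.fins M (n + 1) j := by
  have hc := h.calm.resetFree n hn hB.le
  rcases (R.step n).srv_cases hc j with heq | ⟨i, m, -, -, hij, -, heq⟩ | ⟨i, r, hi, hlink, heq⟩
  · exact (Execution.fins_congr heq).ge
  · rw [Execution.fins_of_onGossip heq]
    refine sup_le ?_ (maxFinNe_le_iff.2 fun t ht hM => ?_)
    · rw [Execution.rx, ← Function.update_of_ne hij.symm m ((R.state n).srv j).rx]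
      exact le_sup_left.trans (topFin_le_gossipFin hj)
    · exact ht.le_gossipFin (by rwa [h.gossipPre_eq hn hB hj heq])
  · simp only [Execution.fins, Execution.rx, heq]
    refine sup_le_sup le_rfl (maxFinNe_le_iff.2 fun t ht hM => ?_)
    exact ((h.mild n hn hB.le i hi j hj r hlink).hasTag_storeAfter ht).le_maxFinNe hM

lemma maxFins_mono (h : Stable R w B M) {m : ℕ} (hn : w 0 ≤ n) (hnm : n ≤ m) (hB : m ≤ B) :
    R.maxFins M n ≤ R.maxFins M m :=
  segment_induction (Q := fun m => R.maxFins M n ≤ R.maxFins M m)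
    (fun m hm hB hnm => hnm.trans (Finset.sup_le fun _ hj =>
      (h.fins_le_succ (hn.trans hm) hB hj).trans (R.fins_le_maxFins M (m + 1) hj))) le_rfl m hnm hB

lemma maxFins_le (h : Stable R w B M) (hn : w 0 ≤ n) (hB : n ≤ B) : R.maxFins M n ≤ M := by
  refine Finset.sup_le fun j hj => ?_
  have htop := h.top n hn hB j hj
  have hsettled := h.settled n hn hB j hj
  refine sup_le ((hsettled.fin_le_pre.trans hsettled.pre_le).trans htop.le) ?_
  calc maxFinNe _ M ≤ maxPhase _ finPhases := maxFinNe_le_maxPhase _ _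
    _ ≤ R.top n j := maxPhase_mono _ finPhases_subset_allPhases
    _ = M := htop

lemma inTransit_topFin_le_maxFins (h : Stable R w B M) (hi : i ∈ p.servers) (hj : j ∈ p.servers)
    (hij : i ≠ j) :
    After w B 1 fun n => ∀ m, (R.state n).gossip i j = .inTransit (some m) →
      m.topFin ≤ R.maxFins M n := by
  refine h.calm.after_inTransit (k := 0) hi hj hij (Φ := fun n m => m.topFin ≤ R.maxFins M n)
    (fun n hn hB _ hm => hm.trans (h.maxFins_mono hn n.le_succ hB)) fun n hn hB => ?_
  have hsettled := h.settled n hn hB i hi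
  have hfin : (R.rx n i i).fin ≤ R.maxFins M n := le_sup_left.trans (R.fins_le_maxFins M n hi)
  exact sup_le (hsettled.tx_fin.trans_le hfin) (hsettled.tx_FIN_le.trans hfin)

lemma finalize_le_maxFins_or_eq (h : Stable R w B M) (hi : i ∈ p.clients) (hj : j ∈ p.servers) :
    After w B 4 fun n => ∀ t, (R.state n).ping i j = .request (some (.finalize true t false)) →
      t ≤ R.maxFins M n ∨ t = M :=
  h.calm.after_reader (Φ := fun n t => t ≤ R.maxFins M n ∨ t = M)
    (fun n hn hB _ ht => ht.imp_left fun ht => ht.trans (h.maxFins_mono hn n.le_succ hB))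
    (fun _ => Or.inl bot_le)
    (fun _ s t hs ht => by rcases le_total s t with hst | hst <;> simpa [hst])
    (fun n _ _ j hj => (maxPhase_finPhases_le_or_eq _ M).imp_left fun ht =>
      ht.trans (le_sup_right.trans (R.fins_le_maxFins M n hj))) hi hj

lemma fins_succ_le_or_eq (h : Stable R w B M) (hn : w 4 ≤ n) (hB : n < B) (hj : j ∈ p.servers) :
    R.fins M (n + 1) j ≤ R.maxFins M n ∨ R.fins M (n + 1) j = M := by
  have hn₀ := (h.calm.zero_le 4).trans hn
  have hfins := R.fins_le_maxFins M n hj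
  have hc := h.calm.resetFree n hn₀ hB.le
  rcases (R.step n).srv_cases hc j with heq | ⟨i, m, -, hi, hij, hm, heq⟩ | ⟨i, r, hi, hlink, heq⟩
  · exact Or.inl ((Execution.fins_congr heq).trans_le hfins)
  · rw [Execution.fins_of_onGossip heq]
    refine gossipFin_le_or_eq (fun k hk => ?_) (le_sup_right.trans hfins)
    by_cases hki : k = i
    · rw [hki, Function.update_self]
      exact (h.inTransit_topFin_le_maxFins hi hj hij).shift h.calm (by omega) n hn hB.le m hm
    · rw [Function.update_of_ne hki]
      exact ((h.settled n hn₀ hB.le j hj).topFin_le k hk).trans (le_sup_left.trans hfins)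
  · left
    simp only [Execution.fins, Execution.rx, heq]
    refine sup_le (le_sup_left.trans hfins) (maxFinNe_le_iff.2 fun t ht hM => ?_)
    rcases (h.mild n hn₀ hB.le i hi j hj r hlink).hasTag_of_storeAfter ht with ht | rfl
    · exact (ht.le_maxFinNe hM).trans (le_sup_right.trans hfins)
    · exact (h.finalize_le_maxFins_or_eq hi hj n hn hB.le t hlink).resolve_right hM

lemma maxFins_eq_or_eq (h : Stable R w B M) :
    After w B 4 fun n => R.maxFins M n = R.maxFins M (w 4) ∨ R.maxFins M n = M := by
  refine segment_induction (Q := fun n => R.maxFins M n = R.maxFins M (w 4) ∨ R.maxFins M n = M)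
    (fun n hn hB hQ => ?_) (Or.inl rfl)
  have hn₀ := (h.calm.zero_le 4).trans hn
  have hle : R.maxFins M (n + 1) ≤ M := h.maxFins_le (hn₀.trans n.le_succ) hB
  have hge : R.maxFins M n ≤ R.maxFins M (n + 1) := h.maxFins_mono hn₀ n.le_succ hB
  by_cases hM : ∃ j ∈ p.servers, R.fins M (n + 1) j = M
  · obtain ⟨j, hj, heq⟩ := hM
    exact Or.inr (hle.antisymm (heq.ge.trans (R.fins_le_maxFins M (n + 1) hj)))
  · push Not at hM
    have heq : R.maxFins M (n + 1) = R.maxFins M n := hge.antisymm' <|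
      Finset.sup_le fun j hj => (h.fins_succ_le_or_eq hn hB hj).resolve_right (hM j hj)
    rwa [heq]

end Stable

end Fins

section Agreement

variable {P W V : Type*} [Fintype P] [LinearOrder P] [Nonempty P] [DecidableEq W]
  {p : Setup P W V} {R : Execution p} {w : ℕ → ℕ} {B : ℕ} {i j : P} {M H : Tag P}

namespace Stable

lemma exists_le_fin (h : Stable R w B M) (hconst : ∀ n, w 0 ≤ n → n ≤ B → R.maxFins M n = H) :
    ∃ i ∈ p.servers, After w B 1 fun n => H ≤ (R.rx n i i).fin := by
  obtain ⟨i, hi, heq⟩ := Finset.exists_mem_eq_sup p.servers p.servers_nonempty (R.fins M (w 0))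
  refine ⟨i, hi, h.calm.after_receive (k := 0) hi ?_ fun n hn hB _ _ _ _ _ hgossip => ?_⟩
  · rintro n - - hQ (heq | ⟨-, r, -, -, heq⟩) <;> rwa [Execution.rx, heq]
  · have hfins : R.fins M (n + 1) i = (R.rx (n + 1) i i).fin := by
      rw [Execution.fins_of_onGossip hgossip, Execution.rx, hgossip, onGossip_rx_self]
    rw [← hfins, ← hconst (w 0) le_rfl (hn.trans hB.le)]
    refine heq.le.trans (segment_induction (Q := fun m => R.fins M (w 0) i ≤ R.fins M m i)
      (fun m hm hB hQ => hQ.trans (h.fins_le_succ hm hB hi)) le_rfl (n + 1) (by omega) hB)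

lemma fin_eq (h : Stable R w B M) (hconst : ∀ n, w 0 ≤ n → n ≤ B → R.maxFins M n = H)
    (hj : j ∈ p.servers) : After w B 3 fun n => (R.rx n j j).fin = H := by
  obtain ⟨i, hi, hiH⟩ := h.exists_le_fin hconst
  intro n hn hB
  have hn₀ := (h.calm.zero_le 3).trans hn
  have hsettled := h.settled n hn₀ hB j hj
  refine le_antisymm ?_ ?_
  · rw [← hconst n hn₀ hB]
    exact le_sup_left.trans (R.fins_le_maxFins M n hj)
  · by_cases hij : i = j
    · subst hij
      exact hiH.shift h.calm (show 1 ≤ 3 by omega) n hn hB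
    · refine le_trans ?_ (hsettled.topFin_le i hi)
      refine le_sup_of_le_left (h.calm.after_rx (k := 1) hi hj hij (Φ := fun _ m => H ≤ m.fin)
        (fun _ _ _ _ => id) (fun n hn hB => ?_) n hn hB)
      exact (hiH n hn hB).trans (h.settled n ((h.calm.zero_le 1).trans hn) hB i hi).tx_fin.ge

lemma tx_fin_eq (h : Stable R w B M) (hconst : ∀ n, w 0 ≤ n → n ≤ B → R.maxFins M n = H)
    (hj : j ∈ p.servers) : After w B 3 fun n => (R.tx n j).fin = H := fun n hn hB =>
  (h.settled n ((h.calm.zero_le 3).trans hn) hB j hj).tx_fin.trans (h.fin_eq hconst hj n hn hB)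

lemma update_rx_fin_eq (h : Stable R w B M)
    (hconst : ∀ n, w 0 ≤ n → n ≤ B → R.maxFins M n = H) (hi : i ∈ p.servers) (hj : j ∈ p.servers)
    (hij : i ≠ j) {k : P} (hk : k ∈ p.servers) (hkj : k ≠ j) :
    After w B 5 fun n => ∀ m, (R.state n).gossip i j = .inTransit (some m) →
      (Function.update (R.rx n j) i m k).fin = H := by
  intro n hn hB m hm
  by_cases hki : k = i
  · rw [hki, Function.update_self]
    exact (h.calm.after_inTransit (k := 3) hi hj hij (Φ := fun _ m => m.fin = H)
      (fun _ _ _ _ => id) (h.tx_fin_eq hconst hi)).shift h.calm (by omega) n hn hB m hm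
  · rw [Function.update_of_ne hki]
    exact h.calm.after_rx (k := 3) hk hj hkj (Φ := fun _ m => m.fin = H)
      (fun _ _ _ _ => id) (h.tx_fin_eq hconst hk) n hn hB

lemma gossipFin_eq (h : Stable R w B M) (hconst : ∀ n, w 0 ≤ n → n ≤ B → R.maxFins M n = H)
    (hj : j ∈ p.servers) {n : ℕ} (hn : w 3 ≤ n) (hB : n < B) {m : Triple P}
    (heq : (R.state (n + 1)).srv j = (onGossip p j ((R.state n).srv j) i m).1) :
    gossipFin p (Function.update (R.rx n j) i m) ((R.state n).srv j).store = H := by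
  have hfin : (R.rx (n + 1) j j).fin = H := h.fin_eq hconst hj (n + 1) (hn.trans n.le_succ) hB
  rwa [Execution.rx, heq, onGossip_rx_self] at hfin

lemma gossipFIN_eq_gossipFin (h : Stable R w B M)
    (hconst : ∀ n, w 0 ≤ n → n ≤ B → R.maxFins M n = H) (hi : i ∈ p.servers) (hj : j ∈ p.servers)
    (hij : i ≠ j) {n : ℕ} (hn : w 5 ≤ n) (hB : n < B) {m : Triple P}
    (hm : (R.state n).gossip i j = .inTransit (some m))
    (heq : (R.state (n + 1)).srv j = (onGossip p j ((R.state n).srv j) i m).1) :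
    gossipFIN p j (Function.update (R.rx n j) i m) ((R.state n).srv j).store =
      gossipFin p (Function.update (R.rx n j) i m) ((R.state n).srv j).store :=
  BoundedCAS.gossipFIN_eq_gossipFin fun k hk hkj => by
    rw [h.gossipFin_eq hconst hj ((h.calm.monotone (by omega)).trans hn) hB heq,
      h.update_rx_fin_eq hconst hi hj hij hk hkj n hn hB.le m hm]

lemma rx_self_eq_and_tx_eq (h : Stable R w B M)
    (hconst : ∀ n, w 0 ≤ n → n ≤ B → R.maxFins M n = H) (hj : j ∈ p.servers) :
    After w B 6 fun n => R.rx n j j = ⟨M, H, H⟩ ∧ R.tx n j = ⟨M, H, H⟩ := by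
  refine h.calm.after_receive (k := 5) hj ?_ fun n hn hB i hi hij m hm heq => ?_
  · rintro n - - hQ (heq | ⟨-, r, -, -, heq⟩) <;> rwa [Execution.rx, Execution.tx, heq]
  · have hpre := h.gossipPre_eq ((h.calm.zero_le 5).trans hn) hB hj heq
    have hfin := h.gossipFin_eq hconst hj ((h.calm.monotone (by omega)).trans hn) hB heq
    have hFIN := h.gossipFIN_eq_gossipFin hconst hi hj hij hn hB hm heq
    simp only [Execution.rx, Execution.tx, heq]
    constructor
    · rw [onGossip_rx_self, hpre, hFIN, hfin]
    · rw [onGossip_tx, tagTuple, maxPhase_allPhases_onGossip, maxPhase_finPhases_onGossip,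
        maxPhase_FIN_onGossip p j _ i m hFIN, hpre, hfin]

/-- Once all gossip triples agree, the next arrival of gossip calls `globalReset`. -/
lemma lt_of_maxFins_eq (h : Stable R w B M) (hM : (p.tTop : Tag P) ≤ M)
    (hconst : ∀ n, w 0 ≤ n → n ≤ B → R.maxFins M n = H) : B < w 9 := by
  by_contra! hB
  obtain ⟨j, hj⟩ := p.servers_nonempty
  obtain ⟨i, hi, hij⟩ := p.exists_server_ne j
  obtain ⟨b₁, b₂, h₁, h₂, h₃, -, hev⟩ := (h.calm.cycle 8).exists_gossip hi hj hij
  have hb : w 8 ≤ b₂ := h₁.trans h₂.le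
  have hb₀ : w 0 ≤ b₂ := (h.calm.zero_le 8).trans hb
  have hbB : b₂ < B := h₃.trans_le hB
  obtain ⟨m, hm, heq⟩ := h.calm.exists_receive hb₀ hbB hev
  refine onGossip_snd_ne_none p j _ i m ?_ ?_ (fun k hk => ?_)
    (h.calm.onGossip_snd hb₀ hbB hj hev hm)
  · rwa [h.gossipPre_eq hb₀ hbB hj heq]
  · exact h.gossipFIN_eq_gossipFin hconst hi hj hij ((h.calm.monotone (by omega)).trans hb) hbB
      hm heq
  · by_cases hkj : k = j
    · rw [hkj]
    · have hk : R.rx (b₂ + 1) j k = ⟨M, H, H⟩ := h.calm.after_rx (k := 6) hk hj hkj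
        (Φ := fun _ m => m = ⟨M, H, H⟩) (fun _ _ _ _ => id)
        (fun n hn hB => (h.rx_self_eq_and_tx_eq hconst hk n hn hB).2) _ (hb.trans b₂.le_succ) hbB
      have hj := (h.rx_self_eq_and_tx_eq hconst hj).shift h.calm (show 6 ≤ 8 by omega) (b₂ + 1)
        (hb.trans b₂.le_succ) hbB
      rw [← heq, ← Execution.rx, ← Execution.rx, hk, hj.1]

lemma lt (h : Stable R w B M) (hM : (p.tTop : Tag P) ≤ M) : B < w 22 := by
  by_contra! hB
  have h₁₃ : w 13 ≤ B := (h.calm.monotone (by omega)).trans hB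
  have h₄ : w 4 ≤ w 13 := h.calm.monotone (by omega)
  have hmono : ∀ {n m}, w 4 ≤ n → n ≤ m → m ≤ B → R.maxFins M n ≤ R.maxFins M m :=
    fun hn => h.maxFins_mono ((h.calm.zero_le 4).trans hn)
  rcases h.maxFins_eq_or_eq (w 13) h₄ h₁₃ with heq | heq
  · refine (((h.drop 4).restrict h₁₃).lt_of_maxFins_eq (H := R.maxFins M (w 4)) hM
      fun n hn hn' => ?_).false
    rw [Nat.zero_add] at hn
    exact ((hmono hn hn' h₁₃).trans heq.le).antisymm (hmono le_rfl hn (hn'.trans h₁₃))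
  · refine ((h.drop 13).lt_of_maxFins_eq (H := M) hM fun n hn hn' => ?_).not_ge hB
    rw [Nat.zero_add] at hn
    exact (h.maxFins_le ((h.calm.zero_le 13).trans hn) hn').antisymm
      (heq.ge.trans (hmono h₄ hn hn'))

end Stable

namespace Calm

lemma lt_of_quiet (h : Calm R w B) (hq : Quiet R (w 0) B)
    (htop : ∀ j ∈ p.servers, (p.tTop : Tag P) ≤ R.top (w 0) j) : B < w 30 := by
  by_contra! hB
  obtain ⟨j, hj⟩ := p.servers_nonempty
  refine ((h.stable hq).lt ?_).not_ge hB
  calc (p.tTop : Tag P) ≤ R.top (w 0) j := htop j hj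
    _ ≤ R.top (w 4) j := h.top_mono le_rfl (h.zero_le 4) ((h.monotone (by omega)).trans hB) j
    _ ≤ R.maxTop (w 4) := R.top_le_maxTop (w 4) hj

lemma lt_of_tTop_le (h : Calm R w B)
    (htop : ∀ n, w 0 ≤ n → n ≤ B → ∀ j ∈ p.servers, (p.tTop : Tag P) ≤ R.top n j) :
    B < w 71 := by
  by_contra! hB
  have hwB : ∀ k ≤ 71, w k ≤ B := fun k hk => (h.monotone hk).trans hB
  by_cases hle : ∀ j ∈ p.servers, R.top (w 33) j ≤ (p.tTop : Tag P)
  · have h₃₃ := h.restrict (hwB 33 (by omega))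
    have hq : Quiet R (w 2) (w 32) := h₃₃.quiet_of_top_eq (k := 32) le_rfl fun n hn hn' j hj =>
      ((h₃₃.top_mono hn hn' le_rfl j).trans (hle j hj)).antisymm
        (htop n hn (hn'.trans (hwB 33 (by omega))) j hj)
    refine (((h.drop 2).restrict (hwB 32 (by omega))).lt_of_quiet ?_ ?_).false
    · simpa only [Nat.zero_add] using hq
    · exact htop _ (h.zero_le _) (hwB _ (by omega))
  · push Not at hle
    obtain ⟨i, hi, hlt⟩ := hle
    have hq : Quiet R (w 39) B := (h.drop 37).quiet_of_lt_top fun n hn hn' j hj =>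
      hlt.trans_le (h.le_top_after (k := 33) hi le_rfl n (by simpa only [Nat.zero_add] using hn)
        hn' j hj)
    refine ((h.drop 39).lt_of_quiet ?_ ?_).not_ge (hwB 69 (by omega))
    · simpa only [Nat.zero_add] using hq
    · exact htop _ (h.zero_le _) (hwB _ (by omega))

lemma exists_overflowFree (h : Calm R w B) (hB : w 80 ≤ B) :
    ∃ n, w 0 ≤ n ∧ n ≤ B ∧ (R.state n).OverflowFree p := by
  have hwB : ∀ k ≤ 80, w k ≤ B := fun k hk => (h.monotone hk).trans hB
  by_cases hlt : ∀ j ∈ p.servers, R.top (w 5) j < (p.tTop : Tag P)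
  · refine ⟨w 4, h.zero_le 4, hwB 4 (by omega),
      (h.restrict (hwB 5 (by omega))).overflowFree le_rfl fun n hn hn' j hj => ?_⟩
    exact (h.top_mono hn hn' (hwB 5 (by omega)) j).trans_lt (hlt j hj)
  · push Not at hlt
    obtain ⟨i, hi, hle⟩ := hlt
    refine absurd ((h.drop 9).lt_of_tTop_le fun n hn => ?_) hB.not_gt
    rw [Nat.zero_add] at hn
    exact h.le_top_after (k := 5) hi hle n hn

end Calm

end Agreement

section Links

variable {P W V : Type*}

lemma GossipLink.tags_clear (l : GossipLink P) : l.clear.tags = ∅ := by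
  cases l <;> simp [clear, tags]

lemma PingLink.tags_clear (l : PingLink P W) : l.clear.tags = ∅ := by
  cases l <;> simp [clear, tags, payloadTags]

/-- The position of the token of a gossip link. -/
def GossipLink.stage : GossipLink P → Fin 2
  | .atSender => 0
  | .inTransit _ => 1

/-- The step that takes the token of a gossip link out of the given position. -/
def Event.gossipMove (i j : P) : Fin 2 → Event P V
  | 0 => .gossipSend i j
  | 1 => .gossipReceive i j

/-- The position of the token of a ping-pong link, counted from the client. -/
def PingLink.stage : PingLink P W → Fin 4
  | .atClient => 0
  | .request _ => 1
  | .atServer _ _ => 2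
  | .response _ _ => 3

/-- The step that takes the token of a ping-pong link out of the given position. -/
def Event.pingMove (i j : P) : Fin 4 → Event P V
  | 0 => .pingSend i j
  | 1 => .pingReceive i j
  | 2 => .pongSend i j
  | 3 => .pongReceive i j

lemma GossipLink.stage_clear (l : GossipLink P) : l.clear.stage = l.stage := by
  cases l <;> rfl

lemma PingLink.stage_clear (l : PingLink P W) : l.clear.stage = l.stage := by
  cases l <;> rfl

end Links

section Fairness

variable {P W V : Type*} [Fintype P] [LinearOrder P] [Nonempty P] [DecidableEq W]
  {p : Setup P W V} {R : Execution p}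

/-- A token that circulates through `m` stages: the step `move s` moves it from stage `s` to the
next one, and it is applicable as long as the token is in stage `s`. -/
structure IsToken (p : Setup P W V) {m : ℕ} [NeZero m] (stage : State P W V → Fin m)
    (move : Fin m → Event P V) : Prop where
  isComm : ∀ s, (move s).IsComm
  applicable : ∀ c, ∃ c', Step p c (move (stage c)) c'
  stage_eq : ∀ {c ev c'}, Step p c ev c' → ev ≠ move (stage c) → stage c' = stage c
  stage_move : ∀ {c c'}, Step p c (move (stage c)) c' → stage c' = stage c + 1

section Token

variable {m : ℕ} [NeZero m] {stage : State P W V → Fin m} {move : Fin m → Event P V}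

lemma IsToken.exists_next (h : IsToken p stage move) (hF : R.Fair) (n : ℕ) :
    ∃ l, n ≤ l ∧ R.event l = move (stage (R.state n)) ∧
      stage (R.state (l + 1)) = stage (R.state n) + 1 := by
  classical
  have hmove : ∃ b, n ≤ b ∧ R.event b = move (stage (R.state n)) := by
    by_contra! hno
    have hstay : ∀ b, n ≤ b → stage (R.state b) = stage (R.state n) := fun b hb =>
      segment_induction (Q := fun l => stage (R.state l) = stage (R.state n)) (y := b)
        (fun l hl _ hs => (h.stage_eq (R.step l) (hs ▸ hno l hl)).trans hs) rfl b hb le_rfl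
    obtain ⟨b, hb, hev⟩ := hF _ (h.isComm (stage (R.state n)))
      (fun l => ⟨max l n, le_max_left _ _, hstay _ (le_max_right l n) ▸ h.applicable _⟩) n
    exact hno b hb hev
  obtain ⟨hnl, hev⟩ := Nat.find_spec hmove
  set l := Nat.find hmove
  have hstay : stage (R.state l) = stage (R.state n) :=
    segment_induction (Q := fun l => stage (R.state l) = stage (R.state n))
      (fun k hk hkl hs => (h.stage_eq (R.step k) fun hev =>
        Nat.find_min hmove hkl ⟨hk, hs ▸ hev⟩).trans hs) rfl l hnl le_rfl
  have hs := R.step l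
  rw [hev, ← hstay] at hs
  exact ⟨l, hnl, hev, hstay ▸ h.stage_move hs⟩

open Fin.CommRing in
lemma IsToken.exists_move (h : IsToken p stage move) (hF : R.Fair) (s : Fin m) (n : ℕ) :
    ∃ l, n ≤ l ∧ R.event l = move s := by
  suffices hk : ∀ (k n : ℕ), stage (R.state n) + (k : Fin m) = s →
      ∃ l, n ≤ l ∧ R.event l = move s from
    hk (s - stage (R.state n)).val n (by rw [Fin.cast_val_eq_self, add_sub_cancel])
  intro k
  induction k with
  | zero =>
    intro n hn
    obtain ⟨l, hl, hev, -⟩ := h.exists_next hF n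
    exact ⟨l, hl, by rw [hev, ← hn, Nat.cast_zero, add_zero]⟩
  | succ k ih =>
    intro n hn
    obtain ⟨b, hb, -, hstage⟩ := h.exists_next hF n
    obtain ⟨l, hl, hev⟩ := ih (b + 1) (by
      rw [hstage, add_assoc, add_comm 1, ← Nat.cast_succ, hn])
    exact ⟨l, by omega, hev⟩

end Token

lemma isToken_gossip {i j : P} (hi : i ∈ p.servers) (hj : j ∈ p.servers) (hij : i ≠ j) :
    IsToken p (fun c => (c.gossip i j).stage) (.gossipMove i j) where
  isComm s := by fin_cases s <;> trivial
  applicable c := by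
    rcases hc : c.gossip i j with _ | m
    exacts [⟨_, hi, hj, hij, hc, rfl⟩, ⟨_, hi, hj, hij, m, hc, rfl⟩]
  stage_eq {c ev c'} hs hev := by
    have hsend : c.gossip i j = .atSender → ev ≠ .gossipSend i j := fun hc => by
      rw [hc] at hev
      exact hev
    have hreceive : ∀ m, c.gossip i j = .inTransit m → ev ≠ .gossipReceive i j := fun m hc => by
      rw [hc] at hev
      exact hev
    clear hev
    cases ev
    case pingReceive => have := hs.pingReceive_cases; clear hs; grind
    all_goals grind [Step, set₂_eq_ite, GossipLink.stage, GossipLink.stage_clear]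
  stage_move {c c'} hs := by
    rcases hc : c.gossip i j with _ | m <;> rw [hc] at hs
    · obtain ⟨-, -, -, -, rfl⟩ := hs
      simp [set₂_eq_ite, GossipLink.stage]
    · obtain ⟨-, -, -, m, -, rfl⟩ := hs
      simp [set₂_eq_ite, GossipLink.stage]

lemma exists_step_pingReceive {i j : P} (hi : i ∈ p.clients) (hj : j ∈ p.servers)
    {c : State P W V} {q : Option (Req P W)} (hq : c.ping i j = .request q) :
    ∃ c', Step p c (.pingReceive i j) c' := by
  by_cases hon : c.srvOn j = true
  · rcases q with _ | r
    · exact ⟨{ c with ping := set₂ c.ping i j (.atServer none none) }, hi, hj, none, hq, rfl⟩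
    · obtain ⟨a, ha⟩ := exists_replies p (storeAfter (c.srv j).store r) r
      refine ⟨{ c with
        ping := set₂ c.ping i j (.atServer (some r) a)
        srv := Function.update c.srv j
          { c.srv j with store := storeAfter (c.srv j).store r } }, hi, hj, some r, hq, ?_⟩
      rw [hon]
      exact ⟨a, a, ha, by split_ifs <;> rfl, rfl⟩
  · refine ⟨{ c with ping := set₂ c.ping i j (.atServer none none) }, hi, hj, q, hq, ?_⟩
    rw [Bool.not_eq_true] at hon
    rw [hon]
    cases q <;> rfl

lemma isToken_ping {i j : P} (hi : i ∈ p.clients) (hj : j ∈ p.servers) :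
    IsToken p (fun c => (c.ping i j).stage) (.pingMove i j) where
  isComm s := by fin_cases s <;> trivial
  applicable c := by
    rcases hc : c.ping i j with _ | q | ⟨q, a⟩ | ⟨q, a⟩
    exacts [⟨_, hi, hj, hc, rfl⟩, exists_step_pingReceive hi hj hc, ⟨_, hi, hj, q, a, hc, rfl⟩,
      ⟨_, hi, hj, q, a, hc, rfl⟩]
  stage_eq {c ev c'} hs hev := by
    have hsend : c.ping i j = .atClient → ev ≠ .pingSend i j := fun hc => by
      rw [hc] at hev
      exact hev
    have hreceive : ∀ q, c.ping i j = .request q → ev ≠ .pingReceive i j := fun q hc => by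
      rw [hc] at hev
      exact hev
    have hreply : ∀ q a, c.ping i j = .atServer q a → ev ≠ .pongSend i j := fun q a hc => by
      rw [hc] at hev
      exact hev
    have hreturn : ∀ q a, c.ping i j = .response q a → ev ≠ .pongReceive i j := fun q a hc => by
      rw [hc] at hev
      exact hev
    clear hev
    cases ev
    case pingReceive =>
      have := hs.pingReceive_cases
      clear hs
      grind [set₂_eq_ite, PingLink.stage]
    all_goals grind [Step, set₂_eq_ite, PingLink.stage, PingLink.stage_clear]
  stage_move {c c'} hs := by
    rcases hc : c.ping i j with _ | q | ⟨q, a⟩ | ⟨q, a⟩ <;> rw [hc] at hs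
    · obtain ⟨-, -, -, rfl⟩ := hs
      simp [set₂_eq_ite, PingLink.stage]
    · obtain ⟨-, -, -, -, ⟨-, rfl⟩ | ⟨-, -, -, -, -, -, -, rfl⟩⟩ := Step.pingReceive_cases hs <;>
        simp [set₂_eq_ite, PingLink.stage]
    · obtain ⟨-, -, -, -, -, rfl⟩ := hs
      by_cases hon : c.srvOn j = true <;> simp [set₂_eq_ite, PingLink.stage, hon]
    · obtain ⟨-, -, -, -, -, rfl⟩ := hs
      simp [set₂_eq_ite, PingLink.stage]

lemma Execution.Fair.exists_gossip (hF : R.Fair) {i j : P} (hi : i ∈ p.servers)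
    (hj : j ∈ p.servers) (hij : i ≠ j) (x : ℕ) :
    ∃ b₁ b₂, x ≤ b₁ ∧ b₁ < b₂ ∧ R.event b₁ = .gossipSend i j ∧
      R.event b₂ = .gossipReceive i j := by
  have token := isToken_gossip hi hj hij
  obtain ⟨b₁, h₁, hsend⟩ := token.exists_move hF 0 x
  obtain ⟨b₂, h₂, hreceive⟩ := token.exists_move hF 1 (b₁ + 1)
  exact ⟨b₁, b₂, h₁, h₂, hsend, hreceive⟩

lemma Execution.Fair.exists_roundTrip (hF : R.Fair) {i j : P} (hi : i ∈ p.clients)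
    (hj : j ∈ p.servers) (x : ℕ) : ∃ y, R.RoundTrip x y i j := by
  have token := isToken_ping hi hj
  obtain ⟨b₁, h₁, hev₁⟩ := token.exists_move hF 0 x
  obtain ⟨b₂, h₂, hev₂⟩ := token.exists_move hF 1 (b₁ + 1)
  obtain ⟨b₃, h₃, hev₃⟩ := token.exists_move hF 2 (b₂ + 1)
  obtain ⟨b₄, h₄, hev₄⟩ := token.exists_move hF 3 (b₃ + 1)
  exact ⟨b₄ + 1, b₁, b₂, b₃, b₄, h₁, h₂, h₃, h₄, b₄.lt_succ_self, hev₁, hev₂, hev₃, hev₄⟩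

lemma exists_forall_mem_of_monotone {α : Type*} (s : Finset α) {Q : α → ℕ → Prop}
    (hmono : ∀ a y y', y ≤ y' → Q a y → Q a y') (h : ∀ a ∈ s, ∃ y, Q a y) :
    ∃ y, ∀ a ∈ s, Q a y := by
  choose! f hf using h
  exact ⟨s.sup f, fun a ha => hmono a _ _ (Finset.le_sup ha) (hf a ha)⟩

lemma Execution.ServerIteration.mono {x x' y y' : ℕ} {i : P} (h : R.ServerIteration x y i)
    (hx : x' ≤ x) (hy : y ≤ y') : R.ServerIteration x' y' i := by
  obtain ⟨a, k, ha, hev, h⟩ := h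
  refine ⟨a, k, hx.trans ha, hev, fun j hj hij => ?_⟩
  obtain ⟨b₁, b₂, b₃, b₄, h₁, h₂, h₃, h₄, h₅, hevs⟩ := h j hj hij
  exact ⟨b₁, b₂, b₃, b₄, h₁, h₂, h₃, h₄, h₅.trans_le hy, hevs⟩

lemma Execution.RoundTrip.mono {x x' y y' : ℕ} {i j : P} (h : R.RoundTrip x y i j)
    (hx : x' ≤ x) (hy : y ≤ y') : R.RoundTrip x' y' i j := by
  obtain ⟨b₁, b₂, b₃, b₄, h₁, h₂, h₃, h₄, h₅, hevs⟩ := h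
  exact ⟨b₁, b₂, b₃, b₄, hx.trans h₁, h₂, h₃, h₄, h₅.trans_le hy, hevs⟩

lemma Execution.LinkCycle.mono {x x' y y' : ℕ} (h : R.LinkCycle x y)
    (hx : x' ≤ x) (hy : y ≤ y') : R.LinkCycle x' y' :=
  ⟨fun i hi => (h.1 i hi).mono hx hy, fun i hi j hj => (h.2 i hi j hj).mono hx hy⟩

lemma Execution.Fair.exists_serverIteration (hF : R.Fair) {i : P} (hi : i ∈ p.servers)
    (x : ℕ) : ∃ y, R.ServerIteration x y i := by
  obtain ⟨k, hk, hki⟩ := p.exists_server_ne i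
  obtain ⟨b, a, hb, hba, -, hreceive⟩ := hF.exists_gossip hk hi hki x
  have hj : ∀ j ∈ p.servers, ∃ y, j ≠ i → ∃ b₁ b₂ b₃ b₄, a < b₁ ∧ b₁ < b₂ ∧ b₂ < b₃ ∧ b₃ < b₄ ∧
      b₄ < y ∧ R.event b₁ = .gossipSend i j ∧ R.event b₂ = .gossipReceive i j ∧
      R.event b₃ = .gossipSend j i ∧ R.event b₄ = .gossipReceive j i := by
    intro j hj
    by_cases hji : j = i
    · exact ⟨0, fun hne => absurd hji hne⟩
    · obtain ⟨b₁, b₂, h₁, h₂, hev₁, hev₂⟩ := hF.exists_gossip hi hj (Ne.symm hji) (a + 1)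
      obtain ⟨b₃, b₄, h₃, h₄, hev₃, hev₄⟩ := hF.exists_gossip hj hi hji (b₂ + 1)
      exact ⟨b₄ + 1, fun _ =>
        ⟨b₁, b₂, b₃, b₄, h₁, h₂, h₃, h₄, b₄.lt_succ_self, hev₁, hev₂, hev₃, hev₄⟩⟩
  obtain ⟨y, hy⟩ := exists_forall_mem_of_monotone p.servers (fun _ _ _ hyy' h hji =>
    let ⟨b₁, b₂, b₃, b₄, h₁, h₂, h₃, h₄, h₅, hevs⟩ := h hji
    ⟨b₁, b₂, b₃, b₄, h₁, h₂, h₃, h₄, h₅.trans_le hyy', hevs⟩) hj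
  exact ⟨y, a, k, by omega, hreceive, hy⟩

lemma Execution.Fair.exists_linkCycle (hF : R.Fair) (x : ℕ) : ∃ y, R.LinkCycle x y := by
  obtain ⟨y₁, hiter⟩ := exists_forall_mem_of_monotone p.servers
    (Q := fun i y => R.ServerIteration x y i) (fun _ _ _ hy h => h.mono le_rfl hy)
    fun i hi => hF.exists_serverIteration hi x
  have htrips : ∀ i ∈ p.clients, ∃ y, ∀ j ∈ p.servers, R.RoundTrip x y i j := fun i hi =>
    exists_forall_mem_of_monotone p.servers (Q := fun j y => R.RoundTrip x y i j)
      (fun _ _ _ hy h => h.mono le_rfl hy) fun j hj => hF.exists_roundTrip hi hj x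
  obtain ⟨y₂, htrip⟩ := exists_forall_mem_of_monotone p.clients
    (Q := fun i y => ∀ j ∈ p.servers, R.RoundTrip x y i j)
    (fun _ _ _ hy h j hj => (h j hj).mono le_rfl hy) htrips
  exact ⟨max y₁ y₂, fun i hi => (hiter i hi).mono le_rfl (le_max_left _ _),
    fun i hi j hj => (htrip i hi j hj).mono le_rfl (le_max_right _ _)⟩

end Fairness

section Cycles

variable {P W V : Type*} [Fintype P] [LinearOrder P] [Nonempty P] [DecidableEq W]
  {p : Setup P W V} {R : Execution p} {a m x x' y z : ℕ}

lemma Execution.CycleDone.linkCycle (h : R.CycleDone x y) : R.LinkCycle x y := ⟨h.1, h.2.1⟩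

lemma Execution.exists_endsRound {i : P} (hxy : x ≤ y)
    (hx : ((R.state x).cli i).proc ≠ none) (hy : ((R.state y).cli i).proc = none) :
    ∃ n, x ≤ n ∧ n < y ∧ R.EndsRound n i := by
  by_contra! hno
  refine segment_induction (Q := fun n => ((R.state n).cli i).proc ≠ none)
    (fun n hn hny hproc hnone => hno n hn hny ⟨hproc, fun heq => ?_⟩) hx y hxy le_rfl hy
  exact hproc (heq.symm.trans hnone)

lemma Execution.CycleDone.extend (h : R.CycleDone x y) (hx : x' ≤ x) : R.CycleDone x' y := by
  have hlink := h.linkCycle.mono hx le_rfl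
  refine ⟨hlink.1, hlink.2, fun i hi ⟨n, hn, hny, hproc⟩ => ?_⟩
  by_cases hbusy : ∃ n, x ≤ n ∧ n < y ∧ ((R.state n).cli i).proc ≠ none
  · obtain ⟨m, hxm, hmy, hend⟩ := h.2.2 i hi hbusy
    exact ⟨m, hx.trans hxm, hmy, hend⟩
  · push Not at hbusy
    have hxy := h.linkCycle.lt
    have hnx : n < x := not_le.1 fun hxn => hproc (hbusy n hxn hny)
    obtain ⟨m, hnm, hmx, hend⟩ := exists_endsRound hnx.le hproc (hbusy x le_rfl hxy)
    exact ⟨m, hn.trans hnm, hmx.trans hxy, hend⟩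

lemma Execution.CycleDone.exists_isCycle (h : R.CycleDone x z) : ∃ y, y ≤ z ∧ R.IsCycle x y := by
  classical
  exact ⟨Nat.find ⟨z, h⟩, Nat.find_min' _ h, Nat.find_spec ⟨z, h⟩, fun _ => Nat.find_min _⟩

lemma Execution.Within.exists_cyclesEnd (h : R.Within x a y) (hz : R.CyclesEnd x (a + m) z) :
    ∃ y', y' ≤ z ∧ R.CyclesEnd y m y' := by
  induction m generalizing z with
  | zero => exact ⟨y, h.2 z hz, .zero⟩
  | succ m ih =>
    obtain _ | ⟨hcycles, hcycle⟩ := hz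
    obtain ⟨y', hle, hy'⟩ := ih hcycles
    obtain ⟨y'', hle', hy''⟩ := (hcycle.1.extend hle).exists_isCycle
    exact ⟨y'', hle', hy'.succ hy''⟩

lemma Execution.Within.trans {u : ℕ} (h : R.Within x a y) (h' : R.Within y m u) :
    R.Within x (a + m) u := by
  refine ⟨h.1.trans h'.1, fun z hz => ?_⟩
  obtain ⟨y', hle, hy'⟩ := h.exists_cyclesEnd hz
  exact (h'.2 y' hy').trans hle

lemma Execution.CyclesEnd.le (h : R.CyclesEnd x m z) : x ≤ z := by
  induction h with
  | zero => exact le_rfl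
  | succ _ hcycle ih => exact ih.trans hcycle.1.linkCycle.lt.le

lemma Execution.Within.mono {b : ℕ} (h : R.Within x a y) (hab : a ≤ b) : R.Within x b y := by
  obtain ⟨m, rfl⟩ := Nat.exists_eq_add_of_le hab
  exact h.trans ⟨le_rfl, fun _ hz => hz.le⟩

lemma Execution.Within.of_le (h : R.Within x a y) (hx : x ≤ z) (hz : z ≤ y) : R.Within x a z :=
  ⟨hx, fun u hu => hz.trans (h.2 u hu)⟩

lemma Execution.Fair.exists_linkCycles (hF : R.Fair) (hy : R.Within x a y) :
    ∃ w : ℕ → ℕ, w 0 = y ∧ (∀ k, R.LinkCycle (w k) (w (k + 1))) ∧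
      ∀ k, R.Within x (a + k) (w k) := by
  classical
  have hleast : ∀ x, ∃ y, R.LinkCycle x y ∧ ∀ y', R.LinkCycle x y' → y ≤ y' := fun x =>
    ⟨Nat.find (hF.exists_linkCycle x), Nat.find_spec _, fun y' => Nat.find_min' _⟩
  choose next hnext hmin using hleast
  have hcycle : ∀ k, R.LinkCycle (next^[k] y) (next^[k + 1] y) := fun k => by
    simpa only [Function.iterate_succ_apply'] using hnext (next^[k] y)
  refine ⟨fun k => next^[k] y, rfl, hcycle, fun k => ?_⟩
  induction k with
  | zero => exact hy
  | succ k ih =>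
    refine ⟨ih.1.trans (hcycle k).lt.le, fun z hz => ?_⟩
    obtain _ | ⟨hcycles, hlast⟩ := hz
    simp only [Function.iterate_succ_apply']
    exact hmin _ _ (hlast.1.linkCycle.mono (ih.2 _ hcycles) le_rfl)

end Cycles

section Reset

variable {P W V : Type*} [LinearOrder P] {c c' : State P W V} {ev : Event P V} {i : P}

/-- The tags at node `i` are as after a call to `localReset` there: the stored ones have the
counter `1`, the gossip buffers have only default tags, and the client is idle. -/
structure WasReset (c : State P W V) (i : P) : Prop where
  store : ∀ r ∈ (c.srv i).store, (ofLex r.tag).1 = 1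
  rx : ∀ k, (c.srv i).rx k = ⟨⊥, ⊥, ⊥⟩
  tx : (c.srv i).tx = ⟨⊥, ⊥, ⊥⟩
  cli : c.cli i = .idle

lemma eq_one_of_mem_localResetStore [DecidableEq W] {S : Finset (Record P W)} {t : Tag P}
    {r : Record P W} (hr : r ∈ localResetStore S t) : (ofLex r.tag).1 = 1 := by
  induction t using WithBot.recBotCoe with
  | bot => exact absurd hr (Finset.notMem_empty r)
  | coe t =>
    obtain ⟨r', -, rfl⟩ := Finset.mem_image.1 hr
    rfl

variable [Fintype P] [Nonempty P] {p : Setup P W V}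

lemma overflowFree_of_wasReset (h : ∀ i, WasReset c i) (hc : c.Cleaned) : c.OverflowFree p := by
  have hbot : (⊥ : Tag P) < (p.tTop : Tag P) := WithBot.bot_lt_coe _
  rintro t (⟨i, -, (⟨r, hr, rfl⟩ | ⟨k, -, ht⟩) | ht⟩ | ⟨i, -, ht⟩ | ⟨i, -, j, -, -, ht⟩ |
    ⟨i, -, j, -, ht⟩)
  · refine WithBot.coe_lt_coe.2 (Prod.Lex.lt_iff.2 (Or.inl ?_))
    rw [(h i).store r hr]
    exact p.maxInt_gt
  · rw [(h i).rx k] at ht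
    rcases ht with rfl | rfl | rfl <;> exact hbot
  · rw [(h i).tx] at ht
    rcases ht with rfl | rfl | rfl <;> exact hbot
  · rw [(h i).cli] at ht
    exact ht.elim
  · rw [hc.1 i j, GossipLink.tags_clear] at ht
    exact ht.elim
  · rw [hc.2 i j, PingLink.tags_clear] at ht
    exact ht.elim

variable [DecidableEq W]

lemma Step.wasReset_of_localReset {t : Tag P} (hs : Step p c (.localReset i t) c') :
    WasReset c' i := by
  obtain ⟨-, -, rfl⟩ := hs
  constructor
  case store =>
    simp only [Function.update_self]
    exact fun r hr => eq_one_of_mem_localResetStore hr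
  all_goals simp [localResetServer]

lemma Step.eq_of_disabled (hs : Step p c ev c') (hd : c.Disabled i)
    (hev : ∀ t, ev ≠ .localReset i t) : c'.srv i = c.srv i ∧ c'.cli i = c.cli i := by
  obtain ⟨hsrv, hcli⟩ := hd
  cases ev
  case pingReceive =>
    have := hs.pingReceive_cases
    clear hs
    grind [update_eq_ite]
  all_goals grind [Step, update_eq_ite]

lemma Step.wasReset (hs : Step p c ev c') (hd : c.Disabled i) (h : WasReset c i) :
    WasReset c' i := by
  by_cases hev : ∃ t, ev = .localReset i t
  · obtain ⟨t, rfl⟩ := hev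
    exact hs.wasReset_of_localReset
  · obtain ⟨hsrv, hcli⟩ := hs.eq_of_disabled hd (not_exists.1 hev)
    exact ⟨hsrv ▸ h.store, hsrv ▸ h.rx, hsrv ▸ h.tx, hcli ▸ h.cli⟩

lemma Step.cleaned (hs : Step p c ev c') (hd : ∀ i, c.Disabled i) (h : c.Cleaned) :
    c'.Cleaned := by
  have hsrv : ∀ i, c.srvOn i = false := fun i => (hd i).1
  have hcli : ∀ i, c.cliOn i = false := fun i => (hd i).2
  clear hd
  obtain ⟨hgossip, hping⟩ := h
  constructor
  all_goals
    intro i j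
    have := hgossip i j
    have := hping i j
    cases ev
    case pingReceive =>
      have := hs.pingReceive_cases
      clear hs
      grind [set₂_eq_ite, PingLink.clear]
    all_goals grind [Step, set₂_eq_ite, PingLink.clear, GossipLink.clear]

lemma Execution.overflowFree_of_localReset {R : Execution p} {u : ℕ}
    (hreset : ∀ i, ∃ v t, v < u ∧ R.event v = .localReset i t ∧
      ∀ n, v < n → n ≤ u → (R.state n).Disabled i)
    (hc : (R.state u).Cleaned) : (R.state (u + 1)).OverflowFree p := by
  have hd : ∀ i, (R.state u).Disabled i := fun i => by
    obtain ⟨v, t, hv, -, hdis⟩ := hreset i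
    exact hdis u hv le_rfl
  refine overflowFree_of_wasReset (fun i => ?_) ((R.step u).cleaned hd hc)
  obtain ⟨v, t, hv, hev, hdis⟩ := hreset i
  have hs := R.step v
  rw [hev] at hs
  exact segment_induction (Q := fun n => WasReset (R.state n) i) (x := v + 1)
    (fun n hn hn' => (R.step n).wasReset (hdis n hn (Nat.le_of_lt_succ hn')))
    hs.wasReset_of_localReset (u + 1) (by omega) le_rfl

end Reset

section Recovery

variable {P W V : Type*} [Fintype P] [LinearOrder P] [Nonempty P] [DecidableEq W]
  {p : Setup P W V} {R : Execution p} {Ψ : ℕ}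

lemma Execution.ResetLegal.exists_overflowFree_of_callsReset (hR : R.ResetLegal Ψ) {a y : ℕ}
    (hy : R.Within 0 a y) (hcall : ∃ x < y, ∃ i t, R.CallsReset x i t) :
    ∃ n, R.Within 0 (a + Ψ) n ∧ (R.state n).ResetFree p ∧ (R.state n).OverflowFree p := by
  classical
  obtain ⟨hxy, hx⟩ := Nat.find_spec hcall
  obtain ⟨u, -, hu, hreset, hclean, hfree⟩ := hR.explicit _ hx fun n hn i t hn' =>
    Nat.find_min hcall hn ⟨hn.trans hxy, i, t, hn'⟩
  refine ⟨u + 1, (hy.of_le (Nat.zero_le _) hxy.le).trans hu, hfree,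
    overflowFree_of_localReset (fun i => ?_) hclean⟩
  obtain ⟨v, t, -, hv, hev, -, hdis⟩ := hreset i
  exact ⟨v, t, hv, hev, hdis⟩

lemma calm_of_resetFree {w : ℕ → ℕ} {B : ℕ} (hw : ∀ k, R.LinkCycle (w k) (w (k + 1)))
    (hfree : ∀ n, w 0 ≤ n → n ≤ B → (R.state n).ResetFree p)
    (hcall : ∀ n, w 0 ≤ n → n < B → ∀ i t, ¬ R.CallsReset n i t) :
    Calm R (fun k => w (k + 1)) B where
  cycle k := hw (k + 1)
  resetFree n hn := hfree n ((hw 0).lt.le.trans hn)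
  noCall n hn := hcall n ((hw 0).lt.le.trans hn)
  gossip_ne n hn hn' i hi j hj hij := by
    obtain ⟨b₁, b₂, hb₁, hb, hb₂, hsend, -⟩ := (hw 0).exists_gossip hi hj hij
    refine segment_induction (Q := fun l => (R.state l).gossip i j ≠ .inTransit none)
      (x := b₁ + 1) (fun l hl hln h => ?_) ?_ n (by omega) le_rfl
    · have := (R.step l).gossip_cases (hfree l (by omega) (by omega)) i j
      grind
    · have := (R.step b₁).gossip_cases (hfree b₁ hb₁ (by omega)) i j
      grind

end Recovery

end BoundedCAS

theorem mainTheorem10_general {P W V : Type*} [Fintype P] [LinearOrder P] [Nonempty P]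
    [DecidableEq W] {p : BoundedCAS.Setup P W V} {Ψ : ℕ} {R : BoundedCAS.Execution p}
    (hF : R.Fair) (hR : R.ResetLegal Ψ) :
    ∃ n, R.Within 0 (2 * Ψ + 81) n ∧ (R.state n).ResetFree p ∧ (R.state n).OverflowFree p := by
  obtain ⟨y, hy, hfree⟩ := hR.spontaneous
  obtain ⟨w, rfl, hw, hwithin⟩ := hF.exists_linkCycles hy
  by_cases hcall : ∃ x < w 81, ∃ i t, R.CallsReset x i t
  · obtain ⟨n, hn, hresult⟩ := hR.exists_overflowFree_of_callsReset (hwithin 81) hcall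
    exact ⟨n, hn.mono (by omega), hresult⟩
  · push Not at hcall
    have hcalm : BoundedCAS.Calm R (fun k => w (k + 1)) (w 81) := BoundedCAS.calm_of_resetFree hw
      (fun n hn hn' => hfree n hn fun m hm => hcall m (hm.trans_le hn')) fun n _ => hcall n
    obtain ⟨n, hn, hn', hoverflow⟩ := hcalm.exists_overflowFree le_rfl
    refine ⟨n, ((hwithin 81).of_le n.zero_le hn').mono (by omega), hfree n ?_ fun m hm => ?_,
      hoverflow⟩
    · exact (hw 0).lt.le.trans hn
    · exact hcall m (hm.trans_le hn')

theorem mainTheorem10 :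
    ∃ C : ℕ, ∀ (P W V : Type*) [Fintype P] [LinearOrder P] [Nonempty P] [DecidableEq W]
      (p : BoundedCAS.Setup P W V) (Ψ : ℕ) (R : BoundedCAS.Execution p),
      1 ≤ Ψ → R.Fair → R.ResetLegal Ψ →
      (∃ i ∈ p.servers, ∃ r ∈ ((R.state 0).srv i).store, p.tTop ≤ r.tag) →
      ∃ n, R.Within 0 (C * Ψ) n ∧
        (R.state n).ResetFree p ∧ (R.state n).OverflowFree p :=
  ⟨83, fun _ _ _ _ _ _ _ _ _ _ hΨ hF hR _ =>
    (mainTheorem10_general hF hR).imp fun _ h => ⟨h.1.mono (by omega), h.2⟩⟩
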